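/- Let $P_n(z)$ be the probability that the simple random walk on $\mathbb Z^2\cong\mathbb Z[i]$ started at $0$ (steps $1,-1,i,-i$, each with probability $\frac14$) is at $z$ after $n$ steps, and let $a(z)=\sum_{n\ge 0}\big(P_n(0)-P_n(z)\big)$ be its discrete harmonic potential (the sum being the limit of the partial sums). A *formal expansion* is a family $E=(\alpha,(c_{n,m})_{n\ge0,\,m\in\mathbb Z})$ of complex numbers, with finitely many nonzero $c_{n,m}$ for each $n$; put $$E_K(z)=\alpha\log|z|+\sum_{n<K}\sum_m c_{n,m}\,\frac{z^m}{|z|^{n+m}},\qquad K\ge0 .$$ It is *the high-order expansion of $a$* if $a(z)-E_K(z)=O(|z|^{-K})$ as $z\to\infty$ in $\mathbb Z^2$, for every $K$. Let $$D_nf(z)=\frac1{n!}\sum_{v\in\{1,-1,i,-i\}}\frac14\,\frac{\partial^n f}{\partial v^n}(z)$$ be the terms of the Taylor expansion of the discrete Laplacian $\Delta f(z)=\frac14\sum_v f(z+v)-f(z)$. Consider the following conditions on $E$: 1. (differential equations) $\Big(\sum_{n=1}^{K-1}D_n\Big)E_K(z)=O(|z|^{-K})$ as $z\to\infty$ in $\mathbb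 C$, for every $K$; 2. (diagonal values) $\frac4\pi\big(1+\frac13+\dots+\frac1{2m-1}\big)-E_K(m+im)=O(m^{-K})$ as $m\to\infty$, for every $K$; 3. (symmetry) $E_K(iz)=E_K(z)=E_K(\bar z)$ for all $z$ and $K$. **Theorem.** The series defining $a$ converges for every $z\in\mathbb Z^2$, and $a(m+im)=\frac4\pi\left(1+\frac13+\dots+\frac1{2m-1}\right)$ for all $m\ge0$. The potential $a$ has exactly one high-order expansion $E$, and this $E$ is also the only formal expansion that satisfies 1, 2 and 3; that is, all the coefficients of the expansion of $a$ are determined by the differential equations and the diagonal values (within the expansions that have the symmetries of the walk). They can be calculated as follows: $\alpha=\frac2\pi$; $c_{0,0}=\frac{2\gamma+\log 8}{\pi}$ with $\gamma$ Euler's constant; $c_{0,m}=0$ for $m\ne0$; and $c_{n,m}=q_{n,m}/\pi$ for $n\ge1$, where the rational numbers $q_{n,m}$ are computed recursively in $n$, from $q_{0,m}=0$, by: * $q_{n,m}=0$ if $4\nmid m$; * if $4\mid m$ and $m\ne\pm n$ (from the differential equations), $$q_{n,m}=\frac4{m^2-n^2}\left(\sum_{\substack{i,j\ge0,\;4\le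 i+j\le n+2\\ 4\mid i-j}}\binom{\frac{m'-n'}2}{i}\binom{\frac{-m'-n'}2}{j}\,q_{n',m'}-\frac{[\,|m|=n+2\,]}{n+2}\right),$$ where $n'=n+2-i-j$, $m'=m+i-j$, $\binom{x}{i}=x(x-1)\cdots(x-i+1)/i!$, and $[\,\cdot\,]$ is $1$ if the condition holds and $0$ otherwise; * if $4\mid n$ and $m=\pm n$ (from the diagonal values), $$q_{n,m}=\frac{(-1)^{n/4}}2\left(4\cdot2^{n/2}\,\frac{B_n}n\left(\frac12-\frac1{2^n}\right)-\sum_{\substack{|r|\le 2n,\;4\mid r\\ r\neq\pm n}}(-1)^{r/4}\,q_{n,r}\right),$$ where $B_n$ is the $n$-th Bernoulli number. -/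

import Mathlib

open Filter Topology Asymptotics

/-- The four steps `1, -1, i, -i` of the simple random walk on `ℤ²`. -/
def srwSteps : Finset (ℤ × ℤ) := {(1, 0), (-1, 0), (0, 1), (0, -1)}

theorem srwSteps_nonempty : srwSteps.Nonempty := ⟨(1, 0), by simp [srwSteps]⟩

/-- The law of the position after `n` steps of the simple random walk started at the origin. -/
noncomputable def srwLaw : ℕ → PMF (ℤ × ℤ)
  | 0 => PMF.pure 0
  | n + 1 => (srwLaw n).bind fun z =>
      (PMF.uniformOfFinset srwSteps srwSteps_nonempty).map fun v => z + v

/-- `P_n(z)`, the probability that the walk is at `z` after `n` steps. -/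
noncomputable def srwProb (n : ℕ) (z : ℤ × ℤ) : ℝ := (srwLaw n z).toReal

/-- The partial sums of the series `∑ (P_n(0) - P_n(z))`. -/
noncomputable def srwPartialSum (z : ℤ × ℤ) (N : ℕ) : ℝ :=
  ∑ n ∈ Finset.range N, (srwProb n 0 - srwProb n z)

/-- The discrete harmonic potential `a(z) = ∑_{n ≥ 0} (P_n(0) - P_n(z))`.  The series is in general
only conditionally convergent, so its sum is the limit of the partial sums. -/
noncomputable def harmonicPotential (z : ℤ × ℤ) : ℝ := limUnder atTop (srwPartialSum z)

/-- The lattice point `(x, y)` as the complex number `x + i y`. -/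
def latticeToComplex (z : ℤ × ℤ) : ℂ := ⟨(z.1 : ℝ), (z.2 : ℝ)⟩

/-- The coefficients of a formal expansion
`α log |z| + ∑_{n ≥ 0} ∑_m c_{n,m} z ^ m |z| ^ (-(n + m))`, with finitely many terms of each
order `n`.  The term with index `(n, m)` is homogeneous of degree `-n`; in the form
`z ^ k * (conj z) ^ l` it has `k = (m - n) / 2` and `l = (-m - n) / 2`. -/
structure PotentialExpansion where
  logCoeff : ℂ
  coeff : ℕ → ℤ →₀ ℂ

namespace PotentialExpansion

/-- The expansion truncated to the orders `n < K`, as a function on `ℂ` (meaningful for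
`z ≠ 0`). -/
noncomputable def trunc (E : PotentialExpansion) (K : ℕ) (z : ℂ) : ℂ :=
  E.logCoeff * (Real.log ‖z‖ : ℂ) +
    ∑ n ∈ Finset.range K, (E.coeff n).sum fun m c => c * z ^ m * (‖z‖ : ℂ) ^ (-((n : ℤ) + m))

/-- `E` is the high-order expansion of `f`: for every `K`, `f` equals the part of `E` of orders
`< K` up to `O(|z| ^ (-K))` as `|z| → ∞` in `ℤ²`. -/
def IsExpansionOf (E : PotentialExpansion) (f : ℤ × ℤ → ℝ) : Prop :=
  ∀ K : ℕ, (fun z : ℤ × ℤ => (f z : ℂ) - E.trunc K (latticeToComplex z)) =O[cofinite]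
    fun z : ℤ × ℤ => ‖latticeToComplex z‖ ^ (-(K : ℤ))

end PotentialExpansion

/-- The term of order `n` in the Taylor expansion of the discrete Laplacian
`(Δf)(z) = ¼ ∑_v f(z + v) - f(z)`, namely
`(D_n f)(z) = (1 / n!) ∑_v ¼ (∂/∂v)^n f (z)`. -/
noncomputable def laplaceTaylorTerm (n : ℕ) (f : ℂ → ℂ) (z : ℂ) : ℂ :=
  ((n.factorial : ℂ))⁻¹ * ∑ v ∈ srwSteps,
    (1 / 4 : ℂ) * iteratedDeriv n (fun t : ℝ => f (z + (t : ℂ) * latticeToComplex v)) 0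

namespace PotentialExpansion

/-- The differential equations: for every `K`, the operator `∑_{n=1}^{K-1} D_n` applied to the part
of the expansion of orders `< K` is `O(|z| ^ (-K))`. -/
def SatisfiesDifferentialEquations (E : PotentialExpansion) : Prop :=
  ∀ K : ℕ, (fun z : ℂ => ∑ n ∈ Finset.Icc 1 (K - 1), laplaceTaylorTerm n (E.trunc K) z)
    =O[Bornology.cobounded ℂ] fun z : ℂ => ‖z‖ ^ (-(K : ℤ))

end PotentialExpansion

/-- `(4 / π) (1 + 1/3 + ⋯ + 1/(2m - 1))`. -/
noncomputable def diagonalValue (m : ℕ) : ℝ :=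
  4 / Real.pi * ∑ j ∈ Finset.range m, 1 / (2 * (j : ℝ) + 1)

namespace PotentialExpansion

/-- The expansion agrees to all orders with the explicit diagonal values at `m + i m`. -/
def SatisfiesDiagonalEquations (E : PotentialExpansion) : Prop :=
  ∀ K : ℕ, (fun m : ℕ => (diagonalValue m : ℂ) - E.trunc K ((m : ℂ) * (1 + Complex.I))) =O[atTop]
    fun m : ℕ => (m : ℝ) ^ (-(K : ℤ))

/-- The expansion has the symmetries of the simple random walk on `ℤ²`: invariance under rotation by
a right angle and under reflection in the real axis. -/
def IsSymmetric (E : PotentialExpansion) : Prop :=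
  ∀ (K : ℕ) (z : ℂ), E.trunc K (Complex.I * z) = E.trunc K z ∧
    E.trunc K ((starRingEnd ℂ) z) = E.trunc K z

end PotentialExpansion

/-! ### The algorithm, in exact rational arithmetic

It computes `π c_{n,m}` for `n ≥ 1`, one order `n` after the other. -/

/-- The generalized binomial coefficient `x (x - 1) ⋯ (x - i + 1) / i!`. -/
def rationalBinomial (x : ℚ) (i : ℕ) : ℚ := ∏ t ∈ Finset.range i, (x - t) / (t + 1)

/-- The coefficient of index `(n, m)`, `m ≠ ± n`, found from the coefficients `prev` of lower order
by comparing coefficients of `z ^ m |z| ^ (-(n + 2 + m))` in the differential equations.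
The pair `p = (i, j)` stands for the derivative `∂^i ∂̄^j / (i! j!)`, which occurs
in `∑ D_n` exactly if `4 ∣ i - j`; the pair `(1, 1)` gives the term that is solved for; the last
summand comes from the logarithm. -/
def solveDifferential (prev : ℕ → ℤ → ℚ) (n : ℕ) (m : ℤ) : ℚ :=
  4 / ((m : ℚ) ^ 2 - (n : ℚ) ^ 2) *
    ((∑ p ∈ (Finset.range (n + 3) ×ˢ Finset.range (n + 3)).filter
        (fun p => 4 ≤ p.1 + p.2 ∧ p.1 + p.2 ≤ n + 2 ∧ (4 : ℤ) ∣ (p.1 : ℤ) - p.2),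
        rationalBinomial ((((m + p.1 - p.2 : ℤ) : ℚ) - ((n + 2 - (p.1 + p.2) : ℕ) : ℚ)) / 2) p.1 *
        rationalBinomial ((-((m + p.1 - p.2 : ℤ) : ℚ) - ((n + 2 - (p.1 + p.2) : ℕ) : ℚ)) / 2) p.2 *
        prev (n + 2 - (p.1 + p.2)) (m + p.1 - p.2)) -
      if m.natAbs = n + 2 then 1 / ((n : ℚ) + 2) else 0)

/-- `π` times the coefficient of `|z| ^ (-n)`, `n ≥ 1`, in the asymptotic expansion of the
diagonal values as `z = m + i m → ∞`. -/
def diagonalCoefficient (n : ℕ) : ℚ :=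
  if Even n then 4 * 2 ^ (n / 2) * (bernoulli n / n) * (1 / 2 - 1 / 2 ^ n) else 0

/-- The coefficients of order `n`, given those of lower order: the harmonic coefficients `m = ± n`
come from the diagonal, all the others from the differential equations.  On the diagonal
`(z / |z|) ^ r = (-1) ^ (r / 4)` for `4 ∣ r`, and the frequencies `r` of order `n` satisfy
`|r| ≤ 2 n`, so that `r = t - 2 n` with `0 ≤ t ≤ 4 n`. -/
def solveOrder (prev : ℕ → ℤ → ℚ) (n : ℕ) (m : ℤ) : ℚ :=
  if n = 0 ∨ ¬ (4 : ℤ) ∣ m then 0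
  else if m.natAbs = n then
    (-1) ^ (n / 4) / 2 * (diagonalCoefficient n -
      ∑ t ∈ (Finset.range (4 * n + 1)).filter
        (fun t : ℕ => (4 : ℤ) ∣ (t : ℤ) - 2 * n ∧ ((t : ℤ) - 2 * n).natAbs ≠ n),
        (-1) ^ (((t : ℤ) - 2 * n).natAbs / 4) * solveDifferential prev n ((t : ℤ) - 2 * n))
  else solveDifferential prev n m

/-- The table of all coefficients of orders `< N` (with `0` at the other places). -/
def coefficientTable : ℕ → ℕ → ℤ → ℚ
  | 0 => fun _ _ => 0
  | N + 1 => fun n m =>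
      if n = N then solveOrder (coefficientTable N) N m else coefficientTable N n m

/-- The output of the algorithm at index `(n, m)`. -/
def algorithmCoefficient (n : ℕ) (m : ℤ) : ℚ := coefficientTable (n + 1) n m

/-!
The proof has three independent parts: `a` has some expansion; an expansion of `a` satisfies the
differential equations, the diagonal equations and the symmetries; and these three conditions
determine every coefficient.

**The potential.** With `p = x + y` and `q = x - y` the walk splits into two independent walks on
`ℤ`, so that `P_n` is a product of two Fourier integrals (`srwProb_eq_walkIntegral`). Summing the
geometric series under the integral gives convergence (`tendsto_srwPartialSum`) and a double
integral for `a`; the inner integral is a Poisson integral, and with `t = tan (α / 2)`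
$$a(z) = \frac2\pi\int_0^1\Big(1-\cos(2p\arctan t)\Big(\frac{1-t}{1+t}\Big)^{|q|}\Big)\frac{dt}t$$
(`harmonicPotential_eq_integral_tan`). For `q = 0` this integral is elementary and gives the
diagonal values (`harmonicPotential_diagonal`).

**Existence of the expansion.** Put `w = 2 (q - i p)`. In a sector around the positive `q` axis the
integrand is the real part of `exp (tanExponent w t)`, whose exponent is
`-(w t + conj w t ^ 3 / 3 + w t ^ 5 / 5 + ⋯)`. Expanding all but `exp (-w t)` gives Laplace
integrals of monomials `w ^ i (conj w) ^ j t ^ b`, which are homogeneous terms up to exponentially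
small errors, and a remainder that is small because it has more powers of `t` than of `w`
(`hasOrderExpansion_integral_sub_log`). Four rotated sectors cover the lattice. An expansion is
determined by its values on any sufficiently large subset of the lattice
(`PotentialExpansion.eq_of_isBigO_sub`), hence the expansions of different orders are compatible,
and those in neighbouring sectors agree (`exists_isExpansionOf_harmonicPotential`).

**The three conditions.** The Taylor terms of the discrete Laplacian map homogeneous terms to
homogeneous terms, so `PotentialExpansion.laplacian` is an operation on the coefficients, and the
differential equations say that it gives zero
(`PotentialExpansion.satisfiesDifferentialEquations_iff`). As `a` is discrete harmonic off the
origin, its expansion satisfies them. Symmetry follows from that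
of `a` and uniqueness, and the diagonal equations hold by restriction to the diagonal.

**Determination of the coefficients.** In the coefficient of `z ^ m |z| ^ (-(n + 2 + m))` of the
formal Laplacian, `c_{n,m}` occurs with the factor `(n² - m²) / 4`, and all other coefficients have
order less than `n` (`PotentialExpansion.laplacian_coeff_apply`). This gives `c_{n,m}` for
`m ≠ ± n`. The expansion of the harmonic numbers in Bernoulli numbers (`diagonalValue_isBigO`) gives
`∑_m (-1) ^ (m / 4) c_{n,m}`, and together with `c_{n,-n} = c_{n,n}` the remaining two coefficients
(`PotentialExpansion.coeff_formula`).
-/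

/-! ### The transition probabilities of the walk -/

theorem srwProb_zero (z : ℤ × ℤ) : srwProb 0 z = if z = 0 then 1 else 0 := by
  unfold srwProb srwLaw
  rw [PMF.pure_apply]
  split_ifs <;> simp

theorem srwLaw_succ_apply (n : ℕ) (z : ℤ × ℤ) :
    srwLaw (n + 1) z = ∑ v ∈ srwSteps, 4⁻¹ * srwLaw n (z - v) := by
  have hmap : ∀ v : ℤ × ℤ, (srwLaw n).map (fun w => w + v) z = srwLaw n (z - v) := by
    intro v
    rw [PMF.map_apply, tsum_eq_single (z - v)]
    · simp
    · intro w hw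
      rw [if_neg]
      rintro rfl
      simp at hw
  have h1 : srwLaw (n + 1) = (PMF.uniformOfFinset srwSteps srwSteps_nonempty).bind
      fun v => (srwLaw n).map fun w => w + v := by
    simp only [srwLaw, PMF.map, Function.comp_def]
    rw [PMF.bind_comm]
  rw [h1, PMF.bind_apply, tsum_eq_sum (s := srwSteps)]
  · refine Finset.sum_congr rfl fun v hv => ?_
    rw [hmap, PMF.uniformOfFinset_apply_of_mem _ hv]
    have : srwSteps.card = 4 := by decide
    rw [this]
    norm_num
  · intro v hv
    rw [PMF.uniformOfFinset_apply_of_notMem _ hv, zero_mul]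

theorem sum_srwSteps {M : Type*} [AddCommMonoid M] (f : ℤ × ℤ → M) :
    ∑ v ∈ srwSteps, f v = f (1, 0) + (f (-1, 0) + (f (0, 1) + f (0, -1))) := by
  unfold srwSteps
  rw [Finset.sum_insert (by decide), Finset.sum_insert (by decide), Finset.sum_insert (by decide),
    Finset.sum_singleton]

theorem srwProb_succ (n : ℕ) (z : ℤ × ℤ) :
    srwProb (n + 1) z = ∑ v ∈ srwSteps, 1 / 4 * srwProb n (z - v) := by
  unfold srwProb
  rw [srwLaw_succ_apply, ENNReal.toReal_sum]
  · simp [ENNReal.toReal_mul]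
  · intro v _
    exact ENNReal.mul_ne_top (by norm_num) (PMF.apply_ne_top _ _)

/-- `n`-step probabilities of the simple random walk on `ℤ`, as a Fourier integral over `[0, b]`;
`b = π` gives the probability of reaching `p`, and `b = π / 2` the same for even `p + n`. -/
noncomputable def walkIntegral (b : ℝ) (n : ℕ) (p : ℤ) : ℝ :=
  b⁻¹ * ∫ t in (0 : ℝ)..b, Real.cos t ^ n * Real.cos (p * t)

theorem walkIntegral_succ (b : ℝ) (n : ℕ) (p : ℤ) :
    walkIntegral b (n + 1) p = (walkIntegral b n (p - 1) + walkIntegral b n (p + 1)) / 2 := by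
  unfold walkIntegral
  rw [← mul_add, ← intervalIntegral.integral_add, mul_div_assoc, ← intervalIntegral.integral_div]
  · congr 1
    refine intervalIntegral.integral_congr fun t _ => ?_
    simp only [Int.cast_sub, Int.cast_add, Int.cast_one, sub_mul, add_mul, one_mul,
      Real.cos_sub, Real.cos_add]
    ring
  · exact Continuous.intervalIntegrable (by fun_prop) _ _
  · exact Continuous.intervalIntegrable (by fun_prop) _ _

theorem walkIntegral_zero {b : ℝ} (hb : b ≠ 0) (p : ℤ) (h : Real.sin (p * b) = 0) :
    walkIntegral b 0 p = if p = 0 then 1 else 0 := by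
  unfold walkIntegral
  split_ifs with hp
  · simp [hp, hb]
  · have hp' : (p : ℝ) ≠ 0 := by exact_mod_cast hp
    simp only [pow_zero, one_mul]
    rw [intervalIntegral.integral_comp_mul_left (fun t => Real.cos t) hp', integral_cos]
    simp [h]

/-- In the coordinates `x + y` and `x - y` the walk is a pair of independent walks on `ℤ`. Both
have the parity of `n`; it suffices that one factor vanishes at points of the wrong parity, so the
other integral may be taken over `[0, π / 2]`. -/
theorem srwProb_eq_walkIntegral (n : ℕ) (x y : ℤ) :
    srwProb n (x, y) =
      walkIntegral (Real.pi / 2) n (x + y) * walkIntegral Real.pi n (x - y) := by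
  induction n generalizing x y with
  | zero =>
    rw [srwProb_zero, walkIntegral_zero Real.pi_ne_zero _ (Real.sin_int_mul_pi _)]
    -- At time `0` the second factor vanishes unless `x = y`, and then `x + y` is even.
    by_cases h : x - y = 0
    · have hxy : x = y := by omega
      subst hxy
      rw [walkIntegral_zero (by positivity)]
      · by_cases hx : x = 0
        · simp [hx]
        · have : ¬ (x + x = 0) := by omega
          simp [hx, this]
      · rw [← Real.sin_int_mul_pi x]
        push_cast
        ring_nf
    · rw [if_neg, if_neg h, mul_zero]
      intro h0
      simp only [Prod.mk_eq_zero] at h0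
      omega
  | succ n ih =>
    rw [srwProb_succ, sum_srwSteps]
    simp only [Prod.mk_sub_mk, ih, walkIntegral_succ]
    ring_nf

/-! ### Convergence of the series of the potential -/

theorem sin_int_mul_sq_le (n : ℤ) (x : ℝ) :
    Real.sin (n * x) ^ 2 ≤ (n : ℝ) ^ 2 * Real.sin x ^ 2 := by
  have hnat : ∀ k : ℕ, |Real.sin (k * x)| ≤ k * |Real.sin x| := by
    intro k
    induction k with
    | zero => simp
    | succ k ih =>
      push_cast
      rw [add_mul, one_mul, Real.sin_add, add_mul, one_mul]
      refine (abs_add_le _ _).trans (add_le_add ?_ ?_)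
      · rw [abs_mul]
        exact (mul_le_of_le_one_right (abs_nonneg _) (Real.abs_cos_le_one _)).trans ih
      · rw [abs_mul]
        exact mul_le_of_le_one_left (abs_nonneg _) (Real.abs_cos_le_one _)
  rw [← mul_pow, sq_le_sq, abs_mul]
  obtain ⟨k, rfl | rfl⟩ := n.eq_nat_or_neg
  · simpa using hnat k
  · simpa using hnat k

/-- Both sides are squares of sines: the left side is `2 sin² ((x s + y t) / 2)`, and the last
factor is `sin² (s / 2) + sin² (t / 2)`. -/
theorem one_sub_cos_add_le (x y : ℤ) (s t : ℝ) :
    1 - Real.cos (x * s + y * t) ≤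
      4 * ((x : ℝ) ^ 2 + (y : ℝ) ^ 2) * (1 - (Real.cos s + Real.cos t) / 2) := by
  have half : ∀ u : ℝ, 1 - Real.cos u = 2 * Real.sin (u / 2) ^ 2 := by
    intro u
    have := Real.cos_two_mul' (u / 2)
    have h2 := Real.sin_sq_add_cos_sq (u / 2)
    rw [mul_div_cancel₀ u two_ne_zero] at this
    linarith
  have hx := sin_int_mul_sq_le x (s / 2)
  have hy := sin_int_mul_sq_le y (t / 2)
  have hadd : ∀ a b : ℝ, Real.sin (a + b) ^ 2 ≤ 2 * (Real.sin a ^ 2 + Real.sin b ^ 2) := by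
    intro a b
    have h : |Real.sin (a + b)| ≤ |Real.sin a| + |Real.sin b| := by
      rw [Real.sin_add]
      refine (abs_add_le _ _).trans (add_le_add ?_ ?_)
      · rw [abs_mul]
        exact mul_le_of_le_one_right (abs_nonneg _) (Real.abs_cos_le_one _)
      · rw [abs_mul]
        exact mul_le_of_le_one_left (abs_nonneg _) (Real.abs_cos_le_one _)
    rw [← sq_abs, ← sq_abs (Real.sin a), ← sq_abs (Real.sin b)]
    nlinarith [sq_nonneg (|Real.sin a| - |Real.sin b|), abs_nonneg (Real.sin (a + b))]
  have h := hadd (x * (s / 2)) (y * (t / 2))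
  have e : (x : ℝ) * (s / 2) + y * (t / 2) = (x * s + y * t) / 2 := by ring
  rw [e] at h
  have hs := half s
  have ht := half t
  have e2 : 1 - (Real.cos s + Real.cos t) / 2
      = Real.sin (s / 2) ^ 2 + Real.sin (t / 2) ^ 2 := by linarith
  rw [half, e2]
  nlinarith [sq_nonneg (Real.sin (s / 2)), sq_nonneg (Real.sin (t / 2)), sq_nonneg (x : ℝ),
    sq_nonneg (y : ℝ), mul_nonneg (sq_nonneg (x : ℝ)) (sq_nonneg (Real.sin (t / 2))),
    mul_nonneg (sq_nonneg (y : ℝ)) (sq_nonneg (Real.sin (s / 2)))]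

/-- The numerator of the Fourier integral of the potential vanishes at least as fast as its
denominator. -/
theorem one_sub_cos_mul_cos_le (x y : ℤ) (a b : ℝ) :
    1 - Real.cos ((x + y : ℤ) * a) * Real.cos ((x - y : ℤ) * b) ≤
      4 * ((x : ℝ) ^ 2 + (y : ℝ) ^ 2) * (1 - Real.cos a * Real.cos b) := by
  -- The average of the bounds for `cos` of the sum and of the difference of the two phases.
  have h1 := one_sub_cos_add_le x y (a + b) (a - b)
  have h2 := one_sub_cos_add_le x y (a - b) (a + b)
  have e1 : (x : ℝ) * (a + b) + y * (a - b) = (x + y : ℤ) * a + (x - y : ℤ) * b := by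
    push_cast; ring
  have e2 : (x : ℝ) * (a - b) + y * (a + b) = (x + y : ℤ) * a - (x - y : ℤ) * b := by
    push_cast; ring
  rw [e1, Real.cos_add, Real.cos_add, Real.cos_sub] at h1
  rw [e2, Real.cos_sub, Real.cos_add, Real.cos_sub] at h2
  linarith

open MeasureTheory in
/-- The measure `dα dβ` on the rectangle `(0, π / 2] × (0, π]`. -/
noncomputable def rectangleMeasure : Measure (ℝ × ℝ) :=
  (volume.restrict (Set.Ioc 0 (Real.pi / 2))).prod (volume.restrict (Set.Ioc 0 Real.pi))

open MeasureTheory in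
instance : IsFiniteMeasure rectangleMeasure := by
  unfold rectangleMeasure; infer_instance

open MeasureTheory in
theorem srwProb_eq_integral (n : ℕ) (x y : ℤ) :
    srwProb n (x, y) = 2 / Real.pi ^ 2 * ∫ t : ℝ × ℝ, (Real.cos t.1 * Real.cos t.2) ^ n *
      (Real.cos ((x + y : ℤ) * t.1) * Real.cos ((x - y : ℤ) * t.2)) ∂rectangleMeasure := by
  rw [srwProb_eq_walkIntegral, walkIntegral, walkIntegral,
    intervalIntegral.integral_of_le (by positivity), intervalIntegral.integral_of_le (by positivity),
    mul_mul_mul_comm, ← integral_prod_mul]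
  congr 1
  · field_simp
  · refine integral_congr_ae (Eventually.of_forall fun t => ?_)
    simp only [mul_pow]
    ring

open MeasureTheory in
theorem ae_rectangleMeasure {P : ℝ × ℝ → Prop}
    (h : ∀ a ∈ Set.Ioc 0 (Real.pi / 2), ∀ b ∈ Set.Ioc 0 Real.pi, P (a, b)) :
    ∀ᵐ t ∂rectangleMeasure, P t := by
  unfold rectangleMeasure
  rw [Measure.prod_restrict]
  refine (ae_restrict_iff' (measurableSet_Ioc.prod measurableSet_Ioc)).2
    (Eventually.of_forall fun t ht => ?_)
  exact h t.1 ht.1 t.2 ht.2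

theorem abs_cos_mul_cos_lt_one {a b : ℝ} (ha : a ∈ Set.Ioc 0 (Real.pi / 2)) :
    |Real.cos a * Real.cos b| < 1 := by
  have h0 : 0 ≤ Real.cos a := Real.cos_nonneg_of_mem_Icc ⟨by linarith [ha.1, Real.pi_pos], ha.2⟩
  have h1 : Real.cos a < 1 := by
    have := Real.cos_lt_cos_of_nonneg_of_le_pi_div_two le_rfl ha.2 ha.1
    simpa using this
  rw [abs_mul, abs_of_nonneg h0]
  exact (mul_le_of_le_one_right h0 (Real.abs_cos_le_one _)).trans_lt h1

/-- The integrand of the Fourier integral of the potential. -/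
noncomputable def potentialKernel (z : ℤ × ℤ) (t : ℝ × ℝ) : ℝ :=
  (1 - Real.cos ((z.1 + z.2 : ℤ) * t.1) * Real.cos ((z.1 - z.2 : ℤ) * t.2)) /
    (1 - Real.cos t.1 * Real.cos t.2)

theorem one_sub_cos_mul_cos_nonneg (a b : ℝ) : 0 ≤ 1 - Real.cos a * Real.cos b := by
  have : |Real.cos a * Real.cos b| ≤ 1 := by
    rw [abs_mul]
    exact mul_le_one₀ (Real.abs_cos_le_one _) (abs_nonneg _) (Real.abs_cos_le_one _)
  linarith [le_abs_self (Real.cos a * Real.cos b)]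

theorem abs_potentialKernel_le (z : ℤ × ℤ) {a b : ℝ} (ha : a ∈ Set.Ioc 0 (Real.pi / 2)) :
    |potentialKernel z (a, b)| ≤ 4 * ((z.1 : ℝ) ^ 2 + (z.2 : ℝ) ^ 2) := by
  have hlt := abs_cos_mul_cos_lt_one (b := b) ha
  have hpos : 0 < 1 - Real.cos a * Real.cos b := by linarith [(abs_lt.1 hlt).2]
  unfold potentialKernel
  rw [abs_div, abs_of_pos hpos, abs_of_nonneg (one_sub_cos_mul_cos_nonneg _ _), div_le_iff₀ hpos]
  exact one_sub_cos_mul_cos_le z.1 z.2 a b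

open MeasureTheory in
theorem integrable_potentialKernel (z : ℤ × ℤ) :
    Integrable (potentialKernel z) rectangleMeasure := by
  refine Integrable.of_bound (C := 4 * ((z.1 : ℝ) ^ 2 + (z.2 : ℝ) ^ 2)) ?_ ?_
  · unfold potentialKernel
    exact Measurable.aestronglyMeasurable (by fun_prop)
  · exact ae_rectangleMeasure fun a ha b _ => abs_potentialKernel_le z ha

open MeasureTheory in
/-- The partial sums are integrals of geometric series in `cos α cos β`, which are dominated by the
bounded function `potentialKernel z`. -/
theorem tendsto_srwPartialSum_integral (z : ℤ × ℤ) :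
    Tendsto (srwPartialSum z) atTop
      (𝓝 (2 / Real.pi ^ 2 * ∫ t, potentialKernel z t ∂rectangleMeasure)) := by
  obtain ⟨x, y⟩ := z
  have hint : ∀ (n : ℕ) (x y : ℤ), Integrable (fun t : ℝ × ℝ => (Real.cos t.1 * Real.cos t.2) ^ n *
      (Real.cos ((x + y : ℤ) * t.1) * Real.cos ((x - y : ℤ) * t.2))) rectangleMeasure := by
    intro n x y
    refine Integrable.of_bound (C := 1) (Continuous.aestronglyMeasurable (by fun_prop))
      (Eventually.of_forall fun t => ?_)
    have hc := Real.abs_cos_le_one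
    rw [Real.norm_eq_abs, abs_mul, abs_pow, abs_mul, abs_mul]
    exact mul_le_one₀ (pow_le_one₀ (by positivity) (mul_le_one₀ (hc _) (abs_nonneg _) (hc _)))
      (by positivity) (mul_le_one₀ (hc _) (abs_nonneg _) (hc _))
  have hsum : ∀ N, srwPartialSum (x, y) N = 2 / Real.pi ^ 2 * ∫ t,
      potentialKernel (x, y) t * (1 - (Real.cos t.1 * Real.cos t.2) ^ N) ∂rectangleMeasure := by
    intro N
    have h0 : ∀ n, srwProb n 0 = _ := fun n => srwProb_eq_integral n 0 0
    unfold srwPartialSum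
    simp only [h0, srwProb_eq_integral, ← mul_sub]
    rw [← Finset.mul_sum]
    congr 1
    simp only [← integral_sub (hint _ _ _) (hint _ _ _)]
    refine (integral_finsetSum _ fun n _ => (hint n 0 0).sub (hint n x y)).symm.trans ?_
    refine integral_congr_ae (ae_rectangleMeasure fun a ha b _ => ?_)
    have hlt := abs_cos_mul_cos_lt_one (b := b) ha
    have hpos : 1 - Real.cos a * Real.cos b ≠ 0 := by linarith [(abs_lt.1 hlt).2]
    beta_reduce
    rw [← mul_neg_geom_sum, potentialKernel, ← mul_assoc, div_mul_cancel₀ _ hpos, Finset.mul_sum]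
    refine Finset.sum_congr rfl fun n _ => ?_
    simp only [Pi.sub_apply, add_zero, sub_zero, Int.cast_zero, zero_mul, Real.cos_zero]
    ring
  refine Tendsto.congr (fun N => (hsum N).symm) (Tendsto.const_mul _ ?_)
  refine tendsto_integral_of_dominated_convergence
    (fun _ => 4 * ((x : ℝ) ^ 2 + (y : ℝ) ^ 2) * 2) ?_ (integrable_const _) ?_ ?_
  · intro N
    unfold potentialKernel
    exact Measurable.aestronglyMeasurable (by fun_prop)
  · intro N
    refine ae_rectangleMeasure fun a ha b _ => ?_
    have hlt := abs_cos_mul_cos_lt_one (b := b) ha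
    rw [norm_mul]
    refine mul_le_mul (abs_potentialKernel_le (x, y) ha) ?_ (norm_nonneg _) (by positivity)
    refine (norm_sub_le _ _).trans ?_
    rw [norm_one, norm_pow]
    have : ‖Real.cos a * Real.cos b‖ ^ N ≤ 1 := pow_le_one₀ (norm_nonneg _) hlt.le
    linarith
  · refine ae_rectangleMeasure fun a ha b _ => ?_
    have hlt := abs_cos_mul_cos_lt_one (b := b) ha
    have := (tendsto_pow_atTop_nhds_zero_of_abs_lt_one hlt).const_sub 1
    simpa using this.const_mul (potentialKernel (x, y) (a, b))

theorem tendsto_srwPartialSum (z : ℤ × ℤ) :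
    Tendsto (srwPartialSum z) atTop (𝓝 (harmonicPotential z)) := by
  unfold harmonicPotential
  exact tendsto_nhds_limUnder ⟨_, tendsto_srwPartialSum_integral z⟩

theorem harmonicPotential_eq_integral (z : ℤ × ℤ) :
    harmonicPotential z = 2 / Real.pi ^ 2 * ∫ t, potentialKernel z t ∂rectangleMeasure :=
  tendsto_nhds_unique (tendsto_srwPartialSum z) (tendsto_srwPartialSum_integral z)

/-! ### The potential as a simple integral -/

/-- The Poisson kernel reproduces the harmonic function `Re z ^ q` at the point `r`. -/
theorem integral_poissonKernel_mul_cos {r : ℝ} (hr0 : 0 ≤ r) (hr1 : r < 1) (q : ℕ) :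
    ∫ t in (0 : ℝ)..Real.pi, (1 - r ^ 2) / (1 - 2 * r * Real.cos t + r ^ 2) * Real.cos (q * t) =
      Real.pi * r ^ q := by
  set g : ℝ → ℝ := fun t => (1 - r ^ 2) / (1 - 2 * r * Real.cos t + r ^ 2) * Real.cos (q * t)
    with hg
  have hden : ∀ t : ℝ, 1 - 2 * r * Real.cos t + r ^ 2 ≠ 0 := by
    intro t
    have h1 := Real.cos_le_one t
    have : 0 < (1 - r) ^ 2 := by nlinarith
    nlinarith
  have hcont : Continuous g := by
    rw [hg]
    exact (continuous_const.div (by fun_prop) hden).mul (by fun_prop)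
  have hdiff : DiffContOnCl ℂ (fun z : ℂ => z ^ q) (Metric.ball 0 1) :=
    (differentiable_pow q).diffContOnCl
  have hw : (r : ℂ) ∈ Metric.ball (0 : ℂ) 1 := by
    simpa [abs_of_nonneg hr0] using hr1
  have h := hdiff.circleAverage_poissonKernel_smul' hw
  rw [Real.circleAverage_def] at h
  have hnorm : ∀ t : ℝ, ‖circleMap 0 1 t - r‖ ^ 2 = 1 - 2 * r * Real.cos t + r ^ 2 := by
    intro t
    rw [← Complex.normSq_eq_norm_sq, Complex.normSq_apply]
    have := Real.sin_sq_add_cos_sq t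
    simp [circleMap, Complex.exp_ofReal_mul_I_re, Complex.exp_ofReal_mul_I_im]
    nlinarith
  have hre : ∀ t : ℝ, (((‖circleMap 0 1 t - 0‖ ^ 2 - ‖(r : ℂ) - 0‖ ^ 2) /
      ‖circleMap 0 1 t - 0 - ((r : ℂ) - 0)‖ ^ 2) • (circleMap 0 1 t) ^ q).re = g t := by
    intro t
    have hpow : (circleMap 0 1 t) ^ q = Complex.exp ((q * t : ℝ) * Complex.I) := by
      simp only [circleMap, zero_add, Complex.ofReal_one, one_mul]
      rw [← Complex.exp_nat_mul]
      push_cast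
      ring_nf
    rw [hpow, sub_zero, sub_zero, hnorm, Complex.smul_re, Complex.exp_ofReal_mul_I_re]
    simp [hg]
  have hint : IntervalIntegrable (fun t : ℝ => ((‖circleMap 0 1 t - 0‖ ^ 2 - ‖(r : ℂ) - 0‖ ^ 2) /
      ‖circleMap 0 1 t - 0 - ((r : ℂ) - 0)‖ ^ 2) • (circleMap 0 1 t) ^ q)
      MeasureTheory.volume 0 (2 * Real.pi) := by
    refine Continuous.intervalIntegrable ?_ _ _
    have hc := continuous_circleMap 0 1
    simp only [sub_zero, hnorm]
    apply Continuous.fun_smul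
    · exact Continuous.div (by fun_prop) (by fun_prop) hden
    · fun_prop
  have hfull : ∫ t in (0 : ℝ)..2 * Real.pi, g t = 2 * Real.pi * r ^ q := by
    have h2 := congrArg Complex.re h
    rw [Complex.smul_re, ← Complex.reCLM_apply, ← Complex.reCLM.intervalIntegral_comp_comm hint]
      at h2
    simp only [Complex.reCLM_apply, hre] at h2
    have e : ((r : ℂ) ^ q).re = r ^ q := by norm_cast
    rw [e, smul_eq_mul, inv_mul_eq_iff_eq_mul₀ (by positivity)] at h2
    exact h2
  -- The integrand is even about `π`, so the integral over `[0, π]` is half that over `[0, 2 π]`.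
  have hrefl : ∫ t in Real.pi..2 * Real.pi, g t = ∫ t in (0 : ℝ)..Real.pi, g t := by
    have : ∀ t, g (2 * Real.pi - t) = g t := by
      intro t
      simp only [hg, Real.cos_two_pi_sub, mul_sub]
      congr 1
      rw [← Real.cos_nat_mul_two_pi_sub (q * t) q]
    have h3 := intervalIntegral.integral_comp_sub_left (a := 0) (b := Real.pi) g (2 * Real.pi)
    simp only [this] at h3
    rw [h3]
    congr 1 <;> ring
  have hadd := intervalIntegral.integral_add_adjacent_intervals
    (hcont.intervalIntegrable (μ := MeasureTheory.volume) 0 Real.pi)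
    (hcont.intervalIntegrable Real.pi (2 * Real.pi))
  rw [hrefl, hfull] at hadd
  linarith

/-- The half-angle formulas, with the range of `tan (a / 2)`. -/
theorem poisson_denominator {a : ℝ} (ha : a ∈ Set.Ioo 0 (Real.pi / 2)) :
    let τ := Real.tan (a / 2)
    0 < τ ∧ τ < 1 ∧ Real.cos a = (1 - τ ^ 2) / (1 + τ ^ 2) ∧
      Real.sin a = 2 * τ / (1 + τ ^ 2) := by
  intro τ
  have hc : 0 < Real.cos (a / 2) :=
    Real.cos_pos_of_mem_Ioo ⟨by linarith [ha.1, Real.pi_pos], by linarith [ha.2, Real.pi_pos]⟩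
  have hs := Real.sin_sq_add_cos_sq (a / 2)
  have hτ : τ = Real.sin (a / 2) / Real.cos (a / 2) := Real.tan_eq_sin_div_cos _
  have h1 : 1 + τ ^ 2 = 1 / Real.cos (a / 2) ^ 2 := by
    rw [hτ]; field_simp; linarith
  refine ⟨Real.tan_pos_of_pos_of_lt_pi_div_two (by linarith [ha.1]) (by linarith [ha.2, Real.pi_pos]),
    ?_, ?_, ?_⟩
  · rw [← Real.tan_pi_div_four]
    exact Real.tan_lt_tan_of_lt_of_lt_pi_div_two (by linarith [ha.1, Real.pi_pos])
      (by linarith [Real.pi_pos]) (by linarith [ha.2])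
  · rw [h1, hτ]
    have := Real.cos_two_mul' (a / 2)
    rw [mul_div_cancel₀ a two_ne_zero] at this
    rw [this]; field_simp
  · rw [h1, hτ]
    have := Real.sin_two_mul (a / 2)
    rw [mul_div_cancel₀ a two_ne_zero] at this
    rw [this]; field_simp

open MeasureTheory in
/-- The inner Fourier integral, evaluated by the Poisson kernel. -/
theorem integral_potentialKernel_snd (z : ℤ × ℤ) {a : ℝ} (ha : a ∈ Set.Ioo 0 (Real.pi / 2)) :
    ∫ b in Set.Ioc 0 Real.pi, potentialKernel z (a, b) =
      Real.pi * ((1 - Real.cos ((z.1 + z.2 : ℤ) * a) *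
        ((1 - Real.tan (a / 2)) / (1 + Real.tan (a / 2))) ^ (z.1 - z.2).natAbs) / Real.sin a) := by
  obtain ⟨h0, h1, hcos, hsin⟩ := poisson_denominator ha
  set τ := Real.tan (a / 2)
  -- This `r` satisfies `cos a = 2 r / (1 + r ^ 2)`, so that `1 - cos a cos b` is a multiple of the
  -- denominator of the Poisson kernel at `r`.
  set r := (1 - τ) / (1 + τ) with hr
  have hr0 : 0 ≤ r := div_nonneg (by linarith) (by linarith)
  have hr1 : r < 1 := by rw [hr, div_lt_one (by linarith)]; linarith
  have hden : ∀ t : ℝ, 1 - 2 * r * Real.cos t + r ^ 2 ≠ 0 := by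
    intro t
    have h1 := Real.cos_le_one t
    have : 0 < (1 - r) ^ 2 := by nlinarith
    nlinarith
  have hcr : Real.cos a = 2 * r / (1 + r ^ 2) := by
    rw [hcos, hr]; field_simp; ring
  have hsr : Real.sin a = (1 - r ^ 2) / (1 + r ^ 2) := by
    rw [hsin, hr]; field_simp; ring
  have hr2 : (1 - r ^ 2) ≠ 0 := by nlinarith
  have hcosq : ∀ b : ℝ, Real.cos ((z.1 - z.2 : ℤ) * b) = Real.cos ((z.1 - z.2).natAbs * b) := by
    intro b
    rcases Int.natAbs_eq (z.1 - z.2) with h | h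
    · conv_lhs => rw [h]
      simp only [Int.cast_natCast]
    · conv_lhs => rw [h]
      simp only [Int.cast_neg, Int.cast_natCast, neg_mul, Real.cos_neg]
  have hint : ∀ q : ℕ, IntervalIntegrable (fun t => (1 - r ^ 2) / (1 - 2 * r * Real.cos t + r ^ 2) *
      Real.cos (q * t)) volume 0 Real.pi := fun q =>
    Continuous.intervalIntegrable ((continuous_const.div (by fun_prop) hden).mul (by fun_prop)) _ _
  have key : ∀ b, potentialKernel z (a, b) = (Real.sin a)⁻¹ *
      ((1 - r ^ 2) / (1 - 2 * r * Real.cos b + r ^ 2) * Real.cos ((0 : ℕ) * b) -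
        Real.cos ((z.1 + z.2 : ℤ) * a) * ((1 - r ^ 2) / (1 - 2 * r * Real.cos b + r ^ 2) *
          Real.cos ((z.1 - z.2).natAbs * b))) := by
    intro b
    have hd := hden b
    have hd2 : 1 - 2 * r / (1 + r ^ 2) * Real.cos b = (1 - 2 * r * Real.cos b + r ^ 2) / (1 + r ^ 2) := by
      field_simp; ring
    simp only [potentialKernel, hcosq, hcr, hsr, Nat.cast_zero, zero_mul, Real.cos_zero, hd2]
    field_simp
  rw [← intervalIntegral.integral_of_le Real.pi_pos.le]
  simp only [key]
  rw [intervalIntegral.integral_const_mul, intervalIntegral.integral_sub (hint 0)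
    ((hint _).const_mul _), intervalIntegral.integral_const_mul,
    integral_poissonKernel_mul_cos hr0 hr1, integral_poissonKernel_mul_cos hr0 hr1]
  field_simp

open MeasureTheory in
theorem harmonicPotential_eq_setIntegral (z : ℤ × ℤ) :
    harmonicPotential z = 2 / Real.pi * ∫ a in Set.Ioo 0 (Real.pi / 2),
      (1 - Real.cos ((z.1 + z.2 : ℤ) * a) *
        ((1 - Real.tan (a / 2)) / (1 + Real.tan (a / 2))) ^ (z.1 - z.2).natAbs) / Real.sin a := by
  have h := integrable_potentialKernel z
  rw [harmonicPotential_eq_integral]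
  unfold rectangleMeasure at h ⊢
  rw [integral_prod _ h, integral_Ioc_eq_integral_Ioo,
    setIntegral_congr_fun measurableSet_Ioo fun a ha => integral_potentialKernel_snd z ha,
    integral_const_mul]
  field_simp

theorem one_sub_cos_eq_sum (m : ℕ) (a : ℝ) :
    1 - Real.cos (2 * m * a) =
      2 * Real.sin a * ∑ j ∈ Finset.range m, Real.sin ((2 * j + 1) * a) := by
  induction m with
  | zero => simp
  | succ m ih =>
    rw [Finset.sum_range_succ, mul_add, ← ih]
    have h1 : 2 * ((m + 1 : ℕ) : ℝ) * a = (2 * m + 1) * a + a := by push_cast; ring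
    have h2 : 2 * (m : ℝ) * a = (2 * m + 1) * a - a := by ring
    rw [h1, h2, Real.cos_add, Real.cos_sub]
    ring

open MeasureTheory in
theorem harmonicPotential_diagonal (m : ℕ) :
    harmonicPotential ((m : ℤ), (m : ℤ)) = diagonalValue m := by
  rw [harmonicPotential_eq_setIntegral, diagonalValue]
  have h1 : ∀ a ∈ Set.Ioo 0 (Real.pi / 2), (1 - Real.cos (((m : ℤ) + (m : ℤ) : ℤ) * a) *
        ((1 - Real.tan (a / 2)) / (1 + Real.tan (a / 2))) ^ ((m : ℤ) - (m : ℤ)).natAbs) / Real.sin a =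
        2 * ∑ j ∈ Finset.range m, Real.sin ((2 * j + 1) * a) := by
    intro a ha
    have hs : 0 < Real.sin a := Real.sin_pos_of_pos_of_lt_pi ha.1 (by linarith [ha.2, Real.pi_pos])
    rw [sub_self, Int.natAbs_zero, pow_zero, mul_one, div_eq_iff hs.ne']
    have := one_sub_cos_eq_sum m a
    push_cast
    rw [← two_mul]
    linarith
  rw [setIntegral_congr_fun measurableSet_Ioo h1, ← integral_Ioc_eq_integral_Ioo,
    ← intervalIntegral.integral_of_le (by positivity), intervalIntegral.integral_const_mul,
    intervalIntegral.integral_finsetSum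
      fun j _ => Continuous.intervalIntegrable (by fun_prop) _ _]
  have h2 : ∀ j : ℕ, ∫ a in (0 : ℝ)..(Real.pi / 2), Real.sin ((2 * j + 1) * a) =
      1 / (2 * (j : ℝ) + 1) := by
    intro j
    have hj : (2 * (j : ℝ) + 1) ≠ 0 := by positivity
    rw [intervalIntegral.integral_comp_mul_left (fun a => Real.sin a) hj, integral_sin]
    have : (2 * (j : ℝ) + 1) * (Real.pi / 2) = Real.pi / 2 + j * Real.pi := by ring
    rw [this, Real.cos_add_nat_mul_pi]
    simp
  simp only [h2]
  ring

open MeasureTheory in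
/-- The potential as an integral in the variable `t = tan (α / 2)`. -/
theorem harmonicPotential_eq_integral_tan (z : ℤ × ℤ) :
    harmonicPotential z = 2 / Real.pi * ∫ t in Set.Ioo (0 : ℝ) 1,
      (1 - Real.cos (2 * (z.1 + z.2 : ℤ) * Real.arctan t) *
        ((1 - t) / (1 + t)) ^ (z.1 - z.2).natAbs) / t := by
  have himage : (fun t => 2 * Real.arctan t) '' Set.Ioo (0 : ℝ) 1 = Set.Ioo 0 (Real.pi / 2) := by
    ext a
    constructor
    · rintro ⟨t, ht, rfl⟩
      have h1 : Real.arctan t < Real.pi / 4 := by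
        rw [← Real.arctan_one]; exact Real.arctan_strictMono ht.2
      exact ⟨by have := Real.arctan_pos.2 ht.1; positivity, by simp only; linarith⟩
    · intro ha
      obtain ⟨h0, h1, -, -⟩ := poisson_denominator ha
      refine ⟨Real.tan (a / 2), ⟨h0, h1⟩, ?_⟩
      simp only
      rw [Real.arctan_tan (by linarith [ha.1, Real.pi_pos]) (by linarith [ha.2, Real.pi_pos])]
      ring
  rw [harmonicPotential_eq_setIntegral, ← himage,
    integral_image_eq_integral_abs_deriv_smul measurableSet_Ioo
      (f' := fun t => 2 * (1 / (1 + t ^ 2)))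
      (fun t _ => ((Real.hasDerivAt_arctan t).const_mul 2).hasDerivWithinAt)
      (fun s _ t _ h => Real.arctan_injective (by simpa using h))]
  congr 1
  refine setIntegral_congr_fun measurableSet_Ioo fun t ht => ?_
  have ht0 : t ≠ 0 := ht.1.ne'
  have hmem : 2 * Real.arctan t ∈ Set.Ioo 0 (Real.pi / 2) := by
    rw [← himage]; exact ⟨t, ht, rfl⟩
  obtain ⟨-, -, -, hs⟩ := poisson_denominator hmem
  have e : 2 * Real.arctan t / 2 = Real.arctan t := by ring
  rw [e, Real.tan_arctan] at hs
  simp only [e, Real.tan_arctan, hs, smul_eq_mul]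
  rw [abs_of_pos (by positivity)]
  have e2 : ((z.1 + z.2 : ℤ) : ℝ) * (2 * Real.arctan t) = 2 * (z.1 + z.2 : ℤ) * Real.arctan t := by
    ring
  rw [e2]
  field_simp

/-! ### Harmonicity and symmetries of the potential -/

open MeasureTheory in
/-- The potential is discrete harmonic off the origin. -/
theorem sum_harmonicPotential_add (z : ℤ × ℤ) (hz : z ≠ 0) :
    ∑ v ∈ srwSteps, 1 / 4 * harmonicPotential (z + v) = harmonicPotential z := by
  obtain ⟨x, y⟩ := z
  have hI := integrable_potentialKernel
  -- The numerator of the averaged kernel minus the kernel is the denominator times the integrand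
  -- of `srwProb 0 (x, y)`.
  have h0 : ∫ t : ℝ × ℝ, (Real.cos ((x + y : ℤ) * t.1) * Real.cos ((x - y : ℤ) * t.2))
      ∂rectangleMeasure = 0 := by
    have h := srwProb_eq_integral 0 x y
    rw [srwProb_zero, if_neg hz] at h
    simp only [pow_zero, one_mul] at h
    have hpi : (2 / Real.pi ^ 2) ≠ 0 := by positivity
    exact (mul_eq_zero.1 h.symm).resolve_left hpi
  have h1 : ∫ t, (∑ v ∈ srwSteps, 1 / 4 * potentialKernel ((x, y) + v) t - potentialKernel (x, y) t)
      ∂rectangleMeasure = 0 := by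
    rw [← h0]
    refine integral_congr_ae (ae_rectangleMeasure fun a ha b _ => ?_)
    have hlt := abs_cos_mul_cos_lt_one (b := b) ha
    have hpos : 1 - Real.cos a * Real.cos b ≠ 0 := by linarith [(abs_lt.1 hlt).2]
    have a1 : ((x + 1 + (y + 0) : ℤ) : ℝ) * a = (x + y : ℤ) * a + a := by push_cast; ring
    have a2 : ((x + -1 + (y + 0) : ℤ) : ℝ) * a = (x + y : ℤ) * a - a := by push_cast; ring
    have a3 : ((x + 0 + (y + 1) : ℤ) : ℝ) * a = (x + y : ℤ) * a + a := by push_cast; ring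
    have a4 : ((x + 0 + (y + -1) : ℤ) : ℝ) * a = (x + y : ℤ) * a - a := by push_cast; ring
    have b1 : ((x + 1 - (y + 0) : ℤ) : ℝ) * b = (x - y : ℤ) * b + b := by push_cast; ring
    have b2 : ((x + -1 - (y + 0) : ℤ) : ℝ) * b = (x - y : ℤ) * b - b := by push_cast; ring
    have b3 : ((x + 0 - (y + 1) : ℤ) : ℝ) * b = (x - y : ℤ) * b - b := by push_cast; ring
    have b4 : ((x + 0 - (y + -1) : ℤ) : ℝ) * b = (x - y : ℤ) * b + b := by push_cast; ring
    simp only [sum_srwSteps, potentialKernel, Prod.mk_add_mk, a1, a2, a3, a4, b1, b2, b3, b4,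
      Real.cos_add, Real.cos_sub]
    field_simp
    ring
  rw [integral_sub (integrable_finsetSum _ fun v _ => (hI _).const_mul _) (hI _),
    integral_finsetSum _ fun v _ => (hI _).const_mul _] at h1
  simp only [integral_const_mul] at h1
  simp only [harmonicPotential_eq_integral]
  rw [← sub_eq_zero.1 h1, Finset.mul_sum]
  exact Finset.sum_congr rfl fun v _ => by ring

theorem srwProb_rotate (n : ℕ) (x y : ℤ) : srwProb n (-y, x) = srwProb n (x, y) := by
  induction n generalizing x y with
  | zero =>
    simp only [srwProb_zero, Prod.mk_eq_zero]
    congr 1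
    simp only [neg_eq_zero, eq_iff_iff]
    tauto
  | succ n ih =>
    simp only [srwProb_succ, sum_srwSteps, Prod.mk_sub_mk]
    have h1 := ih x (y + 1)
    have h2 := ih x (y - 1)
    have h3 := ih (x - 1) y
    have h4 := ih (x + 1) y
    simp only [neg_add, neg_sub', sub_zero, sub_neg_eq_add] at h1 h2 h3 h4 ⊢
    rw [← h1, ← h2, ← h3, ← h4]
    ring_nf

theorem srwProb_reflect (n : ℕ) (x y : ℤ) : srwProb n (x, -y) = srwProb n (x, y) := by
  induction n generalizing x y with
  | zero => simp [srwProb_zero]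
  | succ n ih =>
    simp only [srwProb_succ, sum_srwSteps, Prod.mk_sub_mk]
    have h1 := ih x (y + 1)
    have h2 := ih x (y - 1)
    have h3 := ih (x - 1) y
    have h4 := ih (x + 1) y
    simp only [neg_add, neg_sub', sub_zero, sub_neg_eq_add] at h1 h2 h3 h4 ⊢
    rw [← h1, ← h2, ← h3, ← h4]
    ring_nf

theorem harmonicPotential_rotate (x y : ℤ) :
    harmonicPotential (-y, x) = harmonicPotential (x, y) := by
  unfold harmonicPotential
  congr 1
  funext N
  simp only [srwPartialSum, srwProb_rotate]

theorem harmonicPotential_reflect (x y : ℤ) :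
    harmonicPotential (x, -y) = harmonicPotential (x, y) := by
  unfold harmonicPotential
  congr 1
  funext N
  simp only [srwPartialSum, srwProb_reflect]

/-! ### Uniqueness of formal expansions -/

/-- The function `z ^ m |z| ^ (-(n + m))`, homogeneous of degree `-n`. -/
noncomputable def homogeneousTerm (n : ℕ) (m : ℤ) (z : ℂ) : ℂ :=
  z ^ m * (‖z‖ : ℂ) ^ (-((n : ℤ) + m))

namespace PotentialExpansion

@[ext]
theorem ext' {E F : PotentialExpansion} (h : E.logCoeff = F.logCoeff)
    (h' : ∀ n, E.coeff n = F.coeff n) : E = F := by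
  cases E; cases F
  simp only [mk.injEq]
  exact ⟨h, funext h'⟩

/-- The part of order `n` of a formal expansion. -/
noncomputable def part (E : PotentialExpansion) (n : ℕ) (z : ℂ) : ℂ :=
  (E.coeff n).sum fun m c => c * homogeneousTerm n m z

theorem trunc_eq (E : PotentialExpansion) (K : ℕ) (z : ℂ) :
    E.trunc K z = E.logCoeff * (Real.log ‖z‖ : ℂ) + ∑ n ∈ Finset.range K, E.part n z := by
  simp only [trunc, part, homogeneousTerm, mul_assoc]

noncomputable instance : Sub PotentialExpansion :=
  ⟨fun E F => ⟨E.logCoeff - F.logCoeff, fun n => E.coeff n - F.coeff n⟩⟩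

theorem sub_logCoeff (E F : PotentialExpansion) : (E - F).logCoeff = E.logCoeff - F.logCoeff := rfl

theorem sub_coeff (E F : PotentialExpansion) (n : ℕ) : (E - F).coeff n = E.coeff n - F.coeff n :=
  rfl

theorem part_sub (E F : PotentialExpansion) (n : ℕ) (z : ℂ) :
    (E - F).part n z = E.part n z - F.part n z := by
  unfold part
  rw [sub_coeff, Finsupp.sum_sub_index]
  intros; ring

theorem trunc_sub (E F : PotentialExpansion) (K : ℕ) (z : ℂ) :
    (E - F).trunc K z = E.trunc K z - F.trunc K z := by
  simp only [trunc_eq, part_sub, sub_logCoeff, Finset.sum_sub_distrib]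
  ring

theorem part_ofReal_mul (E : PotentialExpansion) (n : ℕ) {t : ℝ} (ht : 0 < t) (z : ℂ) :
    E.part n (t * z) = (t : ℂ) ^ (-(n : ℤ)) * E.part n z := by
  have ht' : (t : ℂ) ≠ 0 := by exact_mod_cast ht.ne'
  unfold part
  rw [Finsupp.mul_sum]
  refine Finsupp.sum_congr fun m _ => ?_
  have e : (t : ℂ) ^ (-(n : ℤ)) = (t : ℂ) ^ m * (t : ℂ) ^ (-((n : ℤ) + m)) := by
    rw [← zpow_add₀ ht']; congr 1; ring
  rw [e, homogeneousTerm, homogeneousTerm, norm_mul, Complex.norm_real, Real.norm_of_nonneg ht.le,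
    Complex.ofReal_mul, mul_zpow, mul_zpow]
  ring

end PotentialExpansion

/-- An expansion of a sequence in `log m` and the powers `m ^ (-n)` is unique. -/
theorem log_zpow_coeff_eq_zero (α : ℂ) (c : ℕ → ℂ) {N : ℕ} (hN : 1 ≤ N)
    (h : ∀ K : ℕ, 1 ≤ K → K ≤ N → (fun m : ℕ => α * (Real.log m : ℂ) +
      ∑ n ∈ Finset.range K, (m : ℂ) ^ (-(n : ℤ)) * c n) =O[atTop] fun m : ℕ => (m : ℝ) ^ (-(K : ℤ))) :
    α = 0 ∧ ∀ n < N, c n = 0 := by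
  have hcast : Tendsto (fun m : ℕ => (m : ℝ)) atTop atTop := tendsto_natCast_atTop_atTop
  have hinv : Tendsto (fun m : ℕ => (m : ℝ) ^ (-1 : ℤ)) atTop (𝓝 0) := by
    simpa [Function.comp_def] using tendsto_inv_atTop_zero.comp hcast
  have hα : α = 0 := by
    have h1 := h 1 le_rfl hN
    simp only [Finset.sum_range_one, Nat.cast_zero, neg_zero, zpow_zero, one_mul, Nat.cast_one] at h1
    have h2 := h1.trans_tendsto hinv
    have hlog : Tendsto (fun m : ℕ => Real.log m) atTop atTop := Real.tendsto_log_atTop.comp hcast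
    have h3 : Tendsto (fun m : ℕ => (Real.log m)⁻¹) atTop (𝓝 0) :=
      tendsto_inv_atTop_zero.comp hlog
    have h3' : Tendsto (fun m : ℕ => ((Real.log m : ℂ))⁻¹) atTop (𝓝 0) := by
      have := (Complex.continuous_ofReal.tendsto 0).comp h3
      simpa [Function.comp_def] using this
    -- Division by `log m` isolates `α`.
    have h4 : Tendsto (fun m : ℕ => (α * (Real.log m : ℂ) + c 0) * ((Real.log m : ℂ))⁻¹
        - c 0 * ((Real.log m : ℂ))⁻¹) atTop (𝓝 (0 * 0 - c 0 * 0)) :=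
      (h2.mul h3').sub (h3'.const_mul _)
    have h5 : Tendsto (fun _ : ℕ => α) atTop (𝓝 (0 * 0 - c 0 * 0)) := by
      refine h4.congr' ?_
      filter_upwards [hlog.eventually_gt_atTop 0] with m hm
      have : (Real.log m : ℂ) ≠ 0 := by exact_mod_cast hm.ne'
      field_simp
      ring
    simpa using tendsto_nhds_unique tendsto_const_nhds h5
  refine ⟨hα, fun n hnN => ?_⟩
  induction n using Nat.strong_induction_on with
  | _ n ih =>
    have h1 := h (n + 1) (by omega) (by omega)
    have h2 : (fun m : ℕ => (m : ℂ) ^ (-(n : ℤ)) * c n) =O[atTop]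
        fun m : ℕ => (m : ℝ) ^ (-((n + 1 : ℕ) : ℤ)) := by
      refine h1.congr_left fun m => ?_
      rw [hα, zero_mul, zero_add, Finset.sum_range_succ, Finset.sum_eq_zero, zero_add]
      intro k hk
      rw [ih k (Finset.mem_range.1 hk) ((Finset.mem_range.1 hk).trans hnN), mul_zero]
    have h3 : (fun _ : ℕ => c n) =O[atTop] fun m : ℕ => (m : ℝ) ^ (-1 : ℤ) := by
      have h4a : (fun m : ℕ => (m : ℂ) ^ (n : ℤ)) =O[atTop] fun m : ℕ => (m : ℝ) ^ (n : ℤ) :=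
        IsBigO.of_bound 1 (Eventually.of_forall fun m => by simp)
      have h4 := h4a.mul h2
      refine (h4.congr' ?_ (EventuallyEq.rfl)).trans (IsBigO.of_bound 1 ?_)
      · filter_upwards [eventually_ge_atTop 1] with m hm
        have : (m : ℂ) ≠ 0 := by exact_mod_cast (by omega : m ≠ 0)
        rw [← mul_assoc, ← zpow_add₀ this]
        simp
      · filter_upwards [eventually_ge_atTop 1] with m hm
        have : (m : ℝ) ≠ 0 := by exact_mod_cast (by omega : m ≠ 0)
        rw [← zpow_add₀ this, one_mul]
        apply le_of_eq
        congr 2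
        push_cast
        ring
    exact tendsto_nhds_unique tendsto_const_nhds (h3.trans_tendsto hinv)

/-- A Laurent polynomial with infinitely many roots vanishes. -/
theorem finsupp_eq_zero_of_infinite_roots (c : ℤ →₀ ℂ) {T : Set ℂ} (hT : T.Infinite)
    (h0 : ∀ w ∈ T, w ≠ 0) (h : ∀ w ∈ T, (c.sum fun m a => a * w ^ m) = 0) : c = 0 := by
  obtain ⟨M, hM⟩ : ∃ M : ℕ, ∀ m ∈ c.support, 0 ≤ m + M := by
    refine ⟨c.support.sup Int.natAbs, fun m hm => ?_⟩
    have : m.natAbs ≤ c.support.sup Int.natAbs := Finset.le_sup (f := Int.natAbs) hm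
    omega
  -- Multiplication by `w ^ M` clears the negative powers.
  set P : Polynomial ℂ := ∑ m ∈ c.support, Polynomial.monomial (m + M).toNat (c m) with hP
  have hP0 : P = 0 := by
    refine Polynomial.eq_zero_of_infinite_isRoot P (hT.mono fun w hw => ?_)
    have e : P.eval w = w ^ (M : ℤ) * c.sum fun m a => a * w ^ m := by
      rw [hP, Polynomial.eval_finsetSum, Finsupp.sum, Finset.mul_sum]
      refine Finset.sum_congr rfl fun m hm => ?_
      rw [Polynomial.eval_monomial, ← zpow_natCast, Int.toNat_of_nonneg (hM m hm),
        zpow_add₀ (h0 w hw)]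
      ring
    show P.eval w = 0
    rw [e, h w hw, mul_zero]
  ext m
  by_contra hm
  have hms : m ∈ c.support := Finsupp.mem_support_iff.2 hm
  have : P.coeff (m + M).toNat = c m := by
    rw [hP, Polynomial.finsetSum_coeff, Finset.sum_eq_single m]
    · simp
    · intro k hk hkm
      rw [Polynomial.coeff_monomial, if_neg]
      have := hM k hk
      have := hM m hms
      omega
    · intro h; exact absurd hms h
  rw [hP0, Polynomial.coeff_zero] at this
  exact hm (by simpa using this.symm)

theorem norm_latticeToComplex_ge (z : ℤ × ℤ) : max |(z.1 : ℝ)| |(z.2 : ℝ)| ≤ ‖latticeToComplex z‖ :=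
  max_le (Complex.abs_re_le_norm (latticeToComplex z)) (Complex.abs_im_le_norm (latticeToComplex z))

theorem latticeToComplex_add (z w : ℤ × ℤ) :
    latticeToComplex (z + w) = latticeToComplex z + latticeToComplex w := by
  simp [latticeToComplex, Complex.ext_iff]

/-- A set of lattice points is *ample* if it contains the positive multiples of `N + i` for all
large `N`; an expansion is determined by its values on such a set. -/
def IsAmple (S : Set (ℤ × ℤ)) : Prop :=
  ∃ N₀ : ℕ, ∀ N : ℕ, N₀ ≤ N → ∀ m : ℕ, 1 ≤ m → ((m : ℤ) * N, (m : ℤ)) ∈ S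

/-- On each ray through `N + i` the expansion is one in `log m` and powers of `m`, so each part
vanishes at `N + i`; on the unit circle a part is a Laurent polynomial, which has only finitely
many zeros. The bounds up to order `M` suffice for the coefficients of order less than `M`. -/
theorem PotentialExpansion.coeff_eq_zero_of_isBigO (E : PotentialExpansion) {S : Set (ℤ × ℤ)}
    (hS : IsAmple S) {M : ℕ} (hM : 1 ≤ M)
    (h : ∀ K : ℕ, K ≤ M → (fun z : ℤ × ℤ => E.trunc K (latticeToComplex z)) =O[cofinite ⊓ 𝓟 S]
      fun z : ℤ × ℤ => ‖latticeToComplex z‖ ^ (-(K : ℤ))) :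
    E.logCoeff = 0 ∧ ∀ n < M, E.coeff n = 0 := by
  obtain ⟨N₀, hN₀⟩ := hS
  -- `log |m u| = log m + log |u|`, so `α log |u|` joins the part of order `0`.
  have key : ∀ N : ℕ, N₀ ≤ N → E.logCoeff = 0 ∧ ∀ n < M, E.part n (N + Complex.I) +
      (if n = 0 then E.logCoeff * (Real.log ‖(N : ℂ) + Complex.I‖ : ℂ) else 0) = 0 := by
    intro N hN
    set u : ℂ := (N : ℂ) + Complex.I with hu
    have hu0 : u ≠ 0 := by
      intro h0
      have := congrArg Complex.im h0
      simp [hu] at this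
    have hun : ‖u‖ ≠ 0 := norm_ne_zero_iff.2 hu0
    have hmu : ∀ m : ℕ, latticeToComplex ((m : ℤ) * N, (m : ℤ)) = ((m : ℝ) : ℂ) * u := by
      intro m
      apply Complex.ext <;> simp [latticeToComplex, hu]
    have htend : Tendsto (fun m : ℕ => (((m : ℤ) * N, (m : ℤ)) : ℤ × ℤ)) atTop
        (cofinite ⊓ 𝓟 S) := by
      rw [tendsto_inf, tendsto_principal]
      constructor
      · have : Function.Injective (fun m : ℕ => (((m : ℤ) * N, (m : ℤ)) : ℤ × ℤ)) := by
          intro a b hab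
          simpa using (Prod.ext_iff.1 hab).2
        rw [← Nat.cofinite_eq_atTop]
        exact this.tendsto_cofinite
      · filter_upwards [eventually_ge_atTop 1] with m hm using hN₀ N hN m hm
    refine log_zpow_coeff_eq_zero _ _ hM fun K hK hKM => ?_
    have h1 := (h K hKM).comp_tendsto htend
    have h2 : ((fun z : ℤ × ℤ => ‖latticeToComplex z‖ ^ (-(K : ℤ))) ∘
        fun m : ℕ => (((m : ℤ) * N, (m : ℤ)) : ℤ × ℤ)) =O[atTop]
        fun m : ℕ => (m : ℝ) ^ (-(K : ℤ)) := by
      refine IsBigO.of_bound (‖u‖ ^ (-(K : ℤ))) (Eventually.of_forall fun m => ?_)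
      simp only [Function.comp_apply, hmu, norm_mul, Complex.norm_real, mul_zpow, norm_zpow,
        norm_norm]
      rw [mul_comm]
    refine (h1.trans h2).congr' ?_ EventuallyEq.rfl
    filter_upwards [eventually_ge_atTop 1] with m hm
    have hm0 : (0 : ℝ) < m := by exact_mod_cast hm
    simp only [Function.comp_apply, hmu, PotentialExpansion.trunc_eq,
      PotentialExpansion.part_ofReal_mul _ _ hm0]
    rw [norm_mul, Complex.norm_real, Real.norm_of_nonneg hm0.le, Real.log_mul hm0.ne' hun]
    simp only [mul_add, Finset.sum_add_distrib, Complex.ofReal_natCast, Complex.ofReal_add]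
    have : ∑ n ∈ Finset.range K, (m : ℂ) ^ (-(n : ℤ)) *
        (if n = 0 then E.logCoeff * (Real.log ‖u‖ : ℂ) else 0) =
        E.logCoeff * (Real.log ‖u‖ : ℂ) := by
      rw [Finset.sum_eq_single 0]
      · simp
      · intro n _ hn; simp [hn]
      · intro h0; exact absurd (Finset.mem_range.2 hK) h0
    rw [this]
    ring
  have hα := (key N₀ le_rfl).1
  refine ⟨hα, fun n hn => ?_⟩
  refine finsupp_eq_zero_of_infinite_roots _
    (T := (fun N : ℕ => ((N : ℂ) + Complex.I) / (‖(N : ℂ) + Complex.I‖ : ℂ)) '' Set.Ici N₀) ?_ ?_ ?_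
  -- Different points `N + i` have different directions.
  · refine Set.Infinite.image ?_ (Set.Ici_infinite N₀)
    intro a _ b _ hab
    have hpos : ∀ N : ℕ, 0 < ‖(N : ℂ) + Complex.I‖ := by
      intro N
      rw [norm_pos_iff]
      intro h0
      have := congrArg Complex.im h0
      simp at this
    simp only at hab
    have him := congrArg Complex.im hab
    have hre := congrArg Complex.re hab
    simp only [Complex.div_ofReal_im, Complex.div_ofReal_re, Complex.add_im, Complex.add_re,
      Complex.natCast_re, Complex.natCast_im, Complex.I_re, Complex.I_im, zero_add, add_zero] at him hre
    have hnorm : ‖(a : ℂ) + Complex.I‖ = ‖(b : ℂ) + Complex.I‖ := by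
      have := hpos a
      have := hpos b
      field_simp at him
      linarith
    rw [hnorm] at hre
    have := hpos b
    field_simp at hre
    exact_mod_cast hre
  · rintro _ ⟨N, _, rfl⟩
    have h0 : (N : ℂ) + Complex.I ≠ 0 := by
      intro h0
      have := congrArg Complex.im h0
      simp at this
    exact div_ne_zero h0 (by exact_mod_cast norm_ne_zero_iff.2 h0)
  · rintro _ ⟨N, hN, rfl⟩
    have h0 : (N : ℂ) + Complex.I ≠ 0 := by
      intro h0
      have := congrArg Complex.im h0
      simp at this
    have h1 := (key N hN).2 n hn
    rw [hα] at h1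
    simp only [zero_mul, ite_self, add_zero] at h1
    set u : ℂ := (N : ℂ) + Complex.I
    have hun : (‖u‖ : ℂ) ≠ 0 := by exact_mod_cast norm_ne_zero_iff.2 h0
    have h2 : E.part n u = (‖u‖ : ℂ) ^ (-(n : ℤ)) *
        (E.coeff n).sum fun m a => a * (u / (‖u‖ : ℂ)) ^ m := by
      rw [PotentialExpansion.part, Finsupp.mul_sum]
      refine Finsupp.sum_congr fun m _ => ?_
      rw [homogeneousTerm, div_zpow, neg_add, zpow_add₀ hun, zpow_neg (‖u‖ : ℂ) m]
      ring
    rw [h2] at h1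
    exact (mul_eq_zero.1 h1).resolve_left (zpow_ne_zero _ hun)

theorem PotentialExpansion.eq_zero_of_isBigO (E : PotentialExpansion) {S : Set (ℤ × ℤ)}
    (hS : IsAmple S)
    (h : ∀ K : ℕ, (fun z : ℤ × ℤ => E.trunc K (latticeToComplex z)) =O[cofinite ⊓ 𝓟 S]
      fun z : ℤ × ℤ => ‖latticeToComplex z‖ ^ (-(K : ℤ))) :
    E.logCoeff = 0 ∧ ∀ n, E.coeff n = 0 :=
  ⟨(E.coeff_eq_zero_of_isBigO hS le_rfl fun K _ => h K).1, fun n =>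
    (E.coeff_eq_zero_of_isBigO hS (M := n + 1) (by omega) fun K _ => h K).2 n (by omega)⟩

theorem PotentialExpansion.eq_of_isBigO_sub {E F : PotentialExpansion} {S : Set (ℤ × ℤ)}
    (hS : IsAmple S)
    (h : ∀ K : ℕ, (fun z : ℤ × ℤ => E.trunc K (latticeToComplex z) - F.trunc K (latticeToComplex z))
      =O[cofinite ⊓ 𝓟 S] fun z : ℤ × ℤ => ‖latticeToComplex z‖ ^ (-(K : ℤ))) :
    E = F := by
  obtain ⟨h1, h2⟩ := (E - F).eq_zero_of_isBigO hS (by simpa only [trunc_sub] using h)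
  exact PotentialExpansion.ext' (sub_eq_zero.1 h1) fun n => sub_eq_zero.1 (h2 n)

/-! ### Taylor expansion of homogeneous functions -/

open scoped ComplexConjugate in
/-- `g` is smooth along lines through `0` and has the Taylor expansion `∑ c i j h ^ i (conj h) ^ j`
at `0`. -/
structure HasTaylorExpansion (g : ℂ → ℂ) (c : ℕ → ℕ → ℂ) : Prop where
  isBigO : ∀ K : ℕ, (fun h : ℂ => g h - ∑ d ∈ Finset.range K, ∑ p ∈ Finset.HasAntidiagonal.antidiagonal d,
    c p.1 p.2 * (h ^ p.1 * (conj h) ^ p.2)) =O[𝓝 0] fun h : ℂ => ‖h‖ ^ K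
  contDiffAt : ∀ (w : ℂ) (d : ℕ), ContDiffAt ℝ d (fun t : ℝ => g (t * w)) 0
  iteratedDeriv_eq : ∀ (w : ℂ) (d : ℕ), iteratedDeriv d (fun t : ℝ => g (t * w)) 0 =
    d.factorial * ∑ p ∈ Finset.HasAntidiagonal.antidiagonal d, c p.1 p.2 * (w ^ p.1 * (conj w) ^ p.2)

section PowerSeries

variable {φ : ℂ → ℂ} {a : ℕ → ℂ}

theorem ofScalars_isBigO (hφ : HasFPowerSeriesAt φ (FormalMultilinearSeries.ofScalars ℂ a) 0)
    (K : ℕ) : (fun h : ℂ => φ h - ∑ i ∈ Finset.range K, a i * h ^ i) =O[𝓝 0]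
      fun h : ℂ => ‖h‖ ^ K := by
  refine (hφ.isBigO_sub_partialSum_pow K).congr_left fun h => ?_
  simp [FormalMultilinearSeries.partialSum, FormalMultilinearSeries.ofScalars]

/-- A holomorphic function restricted to a real line through `0` is analytic, with the derivatives
given by its power series. -/
theorem ofScalars_line (hφ : HasFPowerSeriesAt φ (FormalMultilinearSeries.ofScalars ℂ a) 0)
    (w : ℂ) : AnalyticAt ℝ (fun t : ℝ => φ (t * w)) 0 ∧
      ∀ d, iteratedDeriv d (fun t : ℝ => φ (t * w)) 0 = d.factorial * (a d * w ^ d) := by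
  let u : ℝ →L[ℝ] ℂ := (1 : ℝ →L[ℝ] ℝ).smulRight w
  obtain ⟨r, hr⟩ := hφ
  have h1 : HasFPowerSeriesOnBall φ
      ((FormalMultilinearSeries.ofScalars ℂ a).restrictScalars ℝ) 0 r := hr.restrictScalars
  have h2 : HasFPowerSeriesOnBall φ
      ((FormalMultilinearSeries.ofScalars ℂ a).restrictScalars ℝ) (u 0) r := by simpa using h1
  have h3 := h2.compContinuousLinearMap (u := u) (x := (0 : ℝ))
  have hu : φ ∘ u = fun t : ℝ => φ (t * w) := by
    funext t; simp [u]
  rw [hu] at h3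
  refine ⟨h3.analyticAt, fun d => ?_⟩
  have h4 := h3.factorial_smul 1 d
  rw [iteratedDeriv_eq_iteratedFDeriv, ← h4]
  simp [FormalMultilinearSeries.compContinuousLinearMap, FormalMultilinearSeries.restrictScalars, u,
    FormalMultilinearSeries.ofScalars]

end PowerSeries

theorem isBigO_sum_mul_sub {K : ℕ} {φ ψ : ℂ → ℂ} {a b : ℕ → ℂ}
    (hφ : (fun h : ℂ => φ h - ∑ i ∈ Finset.range K, a i * h ^ i) =O[𝓝 0] fun h : ℂ => ‖h‖ ^ K)
    (hψ : (fun h : ℂ => ψ h - ∑ i ∈ Finset.range K, b i * h ^ i) =O[𝓝 0] fun h : ℂ => ‖h‖ ^ K)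
    (hψ0 : ψ =O[𝓝 0] fun _ => (1 : ℝ)) :
    (fun h : ℂ => φ h * ψ ((starRingEnd ℂ) h) - ∑ d ∈ Finset.range K,
      ∑ p ∈ Finset.HasAntidiagonal.antidiagonal d, (a p.1 * b p.2) * (h ^ p.1 * ((starRingEnd ℂ) h) ^ p.2)) =O[𝓝 0]
      fun h : ℂ => ‖h‖ ^ K := by
  have hconj : Tendsto (fun h : ℂ => (starRingEnd ℂ) h) (𝓝 0) (𝓝 0) := by
    have := Complex.continuous_conj.tendsto (0 : ℂ)
    rwa [map_zero] at this
  have hψ' : (fun h : ℂ => ψ ((starRingEnd ℂ) h) - ∑ i ∈ Finset.range K,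
      b i * ((starRingEnd ℂ) h) ^ i) =O[𝓝 0] fun h : ℂ => ‖h‖ ^ K := by
    refine (hψ.comp_tendsto hconj).trans (IsBigO.of_bound 1 (Eventually.of_forall fun h => ?_))
    simp
  have hψ0' : (fun h : ℂ => ψ ((starRingEnd ℂ) h)) =O[𝓝 0] fun _ => (1 : ℝ) :=
    hψ0.comp_tendsto hconj
  have hTφ : (fun h : ℂ => ∑ i ∈ Finset.range K, a i * h ^ i) =O[𝓝 0] fun _ => (1 : ℝ) := by
    have : Continuous fun h : ℂ => ∑ i ∈ Finset.range K, a i * h ^ i := by fun_prop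
    exact this.continuousAt.isBigO_one ℝ
  have h1 : (fun h : ℂ => φ h * ψ ((starRingEnd ℂ) h) -
      (∑ i ∈ Finset.range K, a i * h ^ i) *
        ∑ i ∈ Finset.range K, b i * ((starRingEnd ℂ) h) ^ i) =O[𝓝 0] fun h : ℂ => ‖h‖ ^ K := by
    have e1 := hφ.mul hψ0'
    have e2 := hTφ.mul hψ'
    simp only [mul_one, one_mul] at e1 e2
    refine (e1.add e2).congr_left fun h => by ring
  have h2 : (fun h : ℂ => (∑ i ∈ Finset.range K, a i * h ^ i) *
        (∑ i ∈ Finset.range K, b i * ((starRingEnd ℂ) h) ^ i) - ∑ d ∈ Finset.range K,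
      ∑ p ∈ Finset.HasAntidiagonal.antidiagonal d, (a p.1 * b p.2) * (h ^ p.1 * ((starRingEnd ℂ) h) ^ p.2)) =O[𝓝 0]
      fun h : ℂ => ‖h‖ ^ K := by
    -- The product of the truncated series differs from the truncated product by terms of degree at
    -- least `K`.
    have e : ∀ h : ℂ, (∑ i ∈ Finset.range K, a i * h ^ i) *
        (∑ i ∈ Finset.range K, b i * ((starRingEnd ℂ) h) ^ i) - ∑ d ∈ Finset.range K,
      ∑ p ∈ Finset.HasAntidiagonal.antidiagonal d, (a p.1 * b p.2) * (h ^ p.1 * ((starRingEnd ℂ) h) ^ p.2) =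
        ∑ p ∈ (Finset.range K ×ˢ Finset.range K).filter (fun p => ¬ p.1 + p.2 < K),
          (a p.1 * b p.2) * (h ^ p.1 * ((starRingEnd ℂ) h) ^ p.2) := by
      intro h
      rw [Finset.sum_mul_sum, ← Finset.sum_product', sub_eq_iff_eq_add', Finset.sum_sigma',
        ← Finset.sum_filter_add_sum_filter_not (Finset.range K ×ˢ Finset.range K)
          (fun p => p.1 + p.2 < K)]
      congr 1
      · refine Finset.sum_bij' (fun p _ => ⟨p.1 + p.2, p⟩) (fun s _ => s.2) ?_ ?_ ?_ ?_ ?_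
        · intro p hp
          simp only [Finset.mem_filter, Finset.mem_product, Finset.mem_range] at hp
          simp [hp.2]
        · rintro ⟨d, p⟩ hp
          simp only [Finset.mem_sigma, Finset.mem_range, Finset.HasAntidiagonal.mem_antidiagonal] at hp
          simp only [Finset.mem_filter, Finset.mem_product, Finset.mem_range]
          omega
        · intro p _; rfl
        · rintro ⟨d, p⟩ hp
          simp only [Finset.mem_sigma, Finset.mem_range, Finset.HasAntidiagonal.mem_antidiagonal] at hp
          obtain ⟨-, rfl⟩ := hp
          rfl
        · intro p _; ring
      · exact Finset.sum_congr rfl fun p _ => by ring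
    simp only [e]
    refine IsBigO.fun_sum fun p hp => ?_
    simp only [Finset.mem_filter, not_lt] at hp
    refine IsBigO.of_bound ‖a p.1 * b p.2‖ ?_
    filter_upwards [Metric.ball_mem_nhds (0 : ℂ) one_pos] with h hh
    rw [mem_ball_zero_iff] at hh
    rw [norm_mul, norm_mul (h ^ _), norm_pow, norm_pow, RCLike.norm_conj, ← pow_add, norm_pow,
      norm_norm]
    exact mul_le_mul_of_nonneg_left (pow_le_pow_of_le_one (norm_nonneg _) hh.le hp.2) (norm_nonneg _)
  refine (h1.add h2).congr_left fun h => by ring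

/-- A product of a holomorphic and an antiholomorphic function has the product of their power series
as Taylor expansion. -/
theorem HasTaylorExpansion.of_powerSeries {φ ψ : ℂ → ℂ} {a b : ℕ → ℂ}
    (hφ : HasFPowerSeriesAt φ (FormalMultilinearSeries.ofScalars ℂ a) 0)
    (hψ : HasFPowerSeriesAt ψ (FormalMultilinearSeries.ofScalars ℂ b) 0) :
    HasTaylorExpansion (fun h => φ h * ψ ((starRingEnd ℂ) h)) (fun i j => a i * b j) := by
  have hline : ∀ (w : ℂ) (t : ℝ), (starRingEnd ℂ) (t * w) = t * (starRingEnd ℂ) w := by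
    intro w t; simp
  refine ⟨fun K => ?_, fun w d => ?_, fun w d => ?_⟩
  · exact isBigO_sum_mul_sub (ofScalars_isBigO hφ K) (ofScalars_isBigO hψ K)
      (hψ.analyticAt.continuousAt.isBigO_one ℝ)
  · simp only [hline]
    exact ((ofScalars_line hφ w).1.contDiffAt).mul ((ofScalars_line hψ _).1.contDiffAt)
  · simp only [hline]
    rw [iteratedDeriv_fun_mul ((ofScalars_line hφ w).1.contDiffAt)
      ((ofScalars_line hψ _).1.contDiffAt), Finset.Nat.sum_antidiagonal_eq_sum_range_succ
      (fun i j => a i * b j * (w ^ i * ((starRingEnd ℂ) w) ^ j)), Finset.mul_sum]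
    refine Finset.sum_congr rfl fun i hi => ?_
    have hid : i ≤ d := Nat.lt_succ_iff.1 (Finset.mem_range.1 hi)
    rw [(ofScalars_line hφ w).2, (ofScalars_line hψ _).2, ← Nat.choose_mul_factorial_mul_factorial hid]
    push_cast
    ring

theorem HasTaylorExpansion.add {g g' : ℂ → ℂ} {c c' : ℕ → ℕ → ℂ} (h : HasTaylorExpansion g c)
    (h' : HasTaylorExpansion g' c') :
    HasTaylorExpansion (fun x => g x + g' x) (fun i j => c i j + c' i j) := by
  refine ⟨fun K => ?_, fun w d => (h.contDiffAt w d).add (h'.contDiffAt w d), fun w d => ?_⟩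
  · refine ((h.isBigO K).add (h'.isBigO K)).congr_left fun x => ?_
    simp only [add_mul, Finset.sum_add_distrib]
    ring
  · rw [iteratedDeriv_fun_add (h.contDiffAt w d) (h'.contDiffAt w d), h.iteratedDeriv_eq,
      h'.iteratedDeriv_eq, ← mul_add, ← Finset.sum_add_distrib]
    simp only [add_mul]

theorem HasTaylorExpansion.const_mul {g : ℂ → ℂ} {c : ℕ → ℕ → ℂ} (h : HasTaylorExpansion g c)
    (r : ℂ) : HasTaylorExpansion (fun x => r * g x) (fun i j => r * c i j) := by
  refine ⟨fun K => ?_, fun w d => contDiffAt_const.mul (h.contDiffAt w d), fun w d => ?_⟩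
  · refine ((h.isBigO K).const_mul_left r).congr_left fun x => ?_
    simp only [mul_sub, Finset.mul_sum, mul_assoc]
  · rw [iteratedDeriv_const_mul_field, h.iteratedDeriv_eq]
    simp only [Finset.mul_sum]
    exact Finset.sum_congr rfl fun p _ => by ring

/-- The generalized binomial coefficient with complex argument. -/
noncomputable def complexBinomial (x : ℂ) (i : ℕ) : ℂ :=
  ∏ t ∈ Finset.range i, (x - t) / (t + 1)

theorem ratCast_rationalBinomial (x : ℚ) (i : ℕ) :
    ((rationalBinomial x i : ℚ) : ℂ) = complexBinomial x i := by
  simp [rationalBinomial, complexBinomial]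

theorem ring_choose_eq_complexBinomial (x : ℂ) (i : ℕ) : Ring.choose x i = complexBinomial x i := by
  induction i with
  | zero => simp [complexBinomial]
  | succ i ih =>
    rw [complexBinomial, Finset.prod_range_succ, ← complexBinomial, ← ih, Ring.choose_eq_smul,
      Ring.choose_eq_smul, descPochhammer_succ_right, Polynomial.smeval_mul, Nat.factorial_succ]
    simp [Polynomial.smeval_natCast]
    field_simp

theorem hasFPowerSeriesAt_one_add_cpow (k : ℂ) :
    HasFPowerSeriesAt (fun h : ℂ => (1 + h) ^ k)
      (FormalMultilinearSeries.ofScalars ℂ (complexBinomial k)) 0 := by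
  have := Complex.one_add_cpow_hasFPowerSeriesAt_zero (a := k)
  unfold binomialSeries at this
  simpa only [ring_choose_eq_complexBinomial] using this

theorem hasFPowerSeriesAt_one : HasFPowerSeriesAt (fun _ : ℂ => (1 : ℂ))
      (FormalMultilinearSeries.ofScalars ℂ (complexBinomial 0)) 0 := by
  have := hasFPowerSeriesAt_one_add_cpow 0
  simpa using this

theorem one_add_ne_zero_of_norm_lt_one {h : ℂ} (hh : ‖h‖ < 1) : 1 + h ≠ 0 :=
  Complex.slitPlane_ne_zero (Complex.mem_slitPlane_of_norm_lt_one hh)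

/-- With `|1 + h| ^ 2 = (1 + h) (1 + conj h)` a homogeneous term is a product of a holomorphic and
an antiholomorphic function of `h`. The summand `0` gives the equation the form shared with the
logarithm in `laplaceTaylorTerm_eq`. -/
theorem homogeneousTerm_mul_one_add (n : ℕ) (m : ℤ) (z : ℂ) {h : ℂ} (hh : ‖h‖ < 1) :
    homogeneousTerm n m (z * (1 + h)) = 0 + homogeneousTerm n m z *
      ((1 + h) ^ (((m : ℂ) - n) / 2) * (1 + (starRingEnd ℂ) h) ^ ((-(m : ℂ) - n) / 2)) := by
  set u := 1 + h with hu
  have hu0 : u ≠ 0 := one_add_ne_zero_of_norm_lt_one hh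
  have hpos : 0 < ‖u‖ := norm_pos_iff.2 hu0
  have harg : u.arg ≠ Real.pi :=
    Complex.slitPlane_arg_ne_pi (Complex.mem_slitPlane_of_norm_lt_one hh)
  have hconj : 1 + (starRingEnd ℂ) h = (starRingEnd ℂ) u := by simp [hu]
  set s : ℝ := (-(m : ℝ) - n) / 2 with hs
  have hs' : (-(m : ℂ) - n) / 2 = (s : ℂ) := by rw [hs]; push_cast; ring
  have hk : ((m : ℂ) - n) / 2 = (m : ℤ) + (s : ℂ) := by rw [hs]; push_cast; ring
  have hmod : u ^ (s : ℂ) * (starRingEnd ℂ) u ^ (s : ℂ) = (‖u‖ : ℂ) ^ (-((n : ℤ) + m)) := by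
    rw [Complex.conj_cpow _ _ harg, Complex.conj_ofReal, Complex.mul_conj,
      Complex.normSq_eq_norm_sq, Complex.norm_cpow_real, ← Real.rpow_natCast, ← Real.rpow_mul hpos.le]
    have : s * (2 : ℕ) = ((-((n : ℤ) + m) : ℤ) : ℝ) := by rw [hs]; push_cast; ring
    rw [this, Real.rpow_intCast]
    push_cast
    rfl
  rw [zero_add, hconj, hk, hs', Complex.cpow_add _ _ hu0, Complex.cpow_intCast, mul_assoc (u ^ m),
    hmod, homogeneousTerm, homogeneousTerm, norm_mul, Complex.ofReal_mul, mul_zpow, mul_zpow]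
  ring

/-- The Taylor coefficients of `h ↦ (1 + h) ^ k (1 + conj h) ^ l` with `k = (m - n) / 2` and
`l = (-m - n) / 2`. -/
noncomputable def homogeneousTaylorCoeff (n : ℕ) (m : ℤ) (i j : ℕ) : ℂ :=
  complexBinomial (((m : ℂ) - n) / 2) i * complexBinomial ((-(m : ℂ) - n) / 2) j

theorem hasTaylorExpansion_homogeneous (n : ℕ) (m : ℤ) :
    HasTaylorExpansion (fun h => (1 + h) ^ (((m : ℂ) - n) / 2) *
      (1 + (starRingEnd ℂ) h) ^ ((-(m : ℂ) - n) / 2)) (homogeneousTaylorCoeff n m) :=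
  HasTaylorExpansion.of_powerSeries (hasFPowerSeriesAt_one_add_cpow _)
    (hasFPowerSeriesAt_one_add_cpow _)

/-- The Taylor coefficients of `log |1 + h|`. -/
noncomputable def logTaylorCoeff (i j : ℕ) : ℂ :=
  1 / 2 * (-(-1 : ℂ) ^ i / i * complexBinomial 0 j) +
    1 / 2 * (complexBinomial 0 i * (-(-1 : ℂ) ^ j / j))

/-- `log |1 + h|` for `|h| < 1`, written as the sum of a holomorphic and an antiholomorphic
function. -/
noncomputable def logOneAdd (h : ℂ) : ℂ :=
  1 / 2 * (Complex.log (1 + h) * 1) + 1 / 2 * (1 * Complex.log (1 + (starRingEnd ℂ) h))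

theorem hasTaylorExpansion_log : HasTaylorExpansion logOneAdd logTaylorCoeff :=
  ((HasTaylorExpansion.of_powerSeries hasFPowerSeriesAt_clog_one_add
    hasFPowerSeriesAt_one).const_mul _).add ((HasTaylorExpansion.of_powerSeries
      hasFPowerSeriesAt_one hasFPowerSeriesAt_clog_one_add).const_mul _)

theorem log_norm_mul_one_add {z h : ℂ} (hz : z ≠ 0) (hh : ‖h‖ < 1) :
    (Real.log ‖z * (1 + h)‖ : ℂ) = (Real.log ‖z‖ : ℂ) + 1 * logOneAdd h := by
  have hu0 : 1 + h ≠ 0 := one_add_ne_zero_of_norm_lt_one hh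
  have harg : (1 + h).arg ≠ Real.pi :=
    Complex.slitPlane_arg_ne_pi (Complex.mem_slitPlane_of_norm_lt_one hh)
  have hconj : 1 + (starRingEnd ℂ) h = (starRingEnd ℂ) (1 + h) := by simp
  rw [logOneAdd, norm_mul, Real.log_mul (norm_ne_zero_iff.2 hz) (norm_ne_zero_iff.2 hu0), hconj,
    Complex.log_conj _ harg, ← Complex.log_re (1 + h)]
  have := Complex.add_conj (Complex.log (1 + h))
  push_cast at this ⊢
  linear_combination (-1 / 2 : ℂ) * this

/-! ### The Taylor terms of the discrete Laplacian -/

/-- The fourth roots of unity detect divisibility by `4`. -/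
theorem I_zpow_average (m : ℤ) :
    (1 : ℂ) / 4 * (1 + (-1) ^ m + Complex.I ^ m + (-Complex.I) ^ m) =
      if (4 : ℤ) ∣ m then 1 else 0 := by
  have h4 : Complex.I ^ (4 : ℤ) = 1 := by exact_mod_cast Complex.I_pow_four
  have h4' : (-Complex.I) ^ (4 : ℤ) = 1 := by
    have : (-Complex.I) ^ (4 : ℕ) = 1 := by rw [neg_pow, Complex.I_pow_four]; norm_num
    exact_mod_cast this
  have hm := Int.mul_ediv_add_emod m 4
  set q := m / 4
  have hI : ∀ (r : ℤ), Complex.I ^ (4 * q + r) = Complex.I ^ r := by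
    intro r; rw [zpow_add₀ Complex.I_ne_zero, zpow_mul, h4, one_zpow, one_mul]
  have hI' : ∀ (r : ℤ), (-Complex.I) ^ (4 * q + r) = (-Complex.I) ^ r := by
    intro r
    rw [zpow_add₀ (neg_ne_zero.2 Complex.I_ne_zero), zpow_mul, h4', one_zpow, one_mul]
  have hn : ∀ (r : ℤ), (-1 : ℂ) ^ (4 * q + r) = (-1) ^ r := by
    intro r
    rw [zpow_add₀ (by norm_num), zpow_mul]
    norm_num
  have hr : m % 4 = 0 ∨ m % 4 = 1 ∨ m % 4 = 2 ∨ m % 4 = 3 := by omega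
  have h3 : Complex.I ^ (3 : ℤ) = -Complex.I := by exact_mod_cast Complex.I_pow_three
  have h3' : (-Complex.I) ^ (3 : ℤ) = Complex.I := by
    have : (-Complex.I) ^ (3 : ℕ) = Complex.I := by rw [neg_pow, Complex.I_pow_three]; norm_num
    exact_mod_cast this
  have h2 : Complex.I ^ (2 : ℤ) = -1 := by exact_mod_cast Complex.I_sq
  have h2' : (-Complex.I) ^ (2 : ℤ) = -1 := by
    have : (-Complex.I) ^ (2 : ℕ) = -1 := by rw [neg_sq, Complex.I_sq]
    exact_mod_cast this
  have hm1 : (-1 : ℂ) ^ (3 : ℤ) = -1 := by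
    have : (-1 : ℂ) ^ (3 : ℕ) = -1 := by norm_num
    exact_mod_cast this
  have hm2 : (-1 : ℂ) ^ (2 : ℤ) = 1 := by
    have : (-1 : ℂ) ^ (2 : ℕ) = 1 := by norm_num
    exact_mod_cast this
  rw [← hm, hI, hI', hn]
  rcases hr with hr | hr | hr | hr <;> rw [hr]
  · rw [if_pos ⟨q, by ring⟩]; norm_num
  · rw [if_neg (by omega)]; simp
  · rw [if_neg (by omega), h2, h2', hm2]; norm_num
  · rw [if_neg (by omega), h3, h3', hm1]; norm_num

/-- Averaging `v ^ i (conj v) ^ j` over the four steps keeps the terms with `4 ∣ i - j`. -/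
theorem sum_srwSteps_pow (i j : ℕ) :
    ∑ v ∈ srwSteps, (1 / 4 : ℂ) * (latticeToComplex v ^ i *
      ((starRingEnd ℂ) (latticeToComplex v)) ^ j) = if (4 : ℤ) ∣ (i : ℤ) - j then 1 else 0 := by
  rw [← I_zpow_average, sum_srwSteps]
  have e1 : latticeToComplex (1, 0) = 1 := by simp [latticeToComplex, Complex.ext_iff]
  have e2 : latticeToComplex (-1, 0) = -1 := by simp [latticeToComplex, Complex.ext_iff]
  have e3 : latticeToComplex (0, 1) = Complex.I := by simp [latticeToComplex, Complex.ext_iff]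
  have e4 : latticeToComplex (0, -1) = -Complex.I := by simp [latticeToComplex, Complex.ext_iff]
  have key : ∀ u : ℂ, u ≠ 0 → (starRingEnd ℂ) u = u⁻¹ →
      u ^ i * ((starRingEnd ℂ) u) ^ j = u ^ ((i : ℤ) - j) := by
    intro u hu h
    rw [h, zpow_sub₀ hu, zpow_natCast, zpow_natCast, inv_pow]
    rfl
  have k1 := key 1 one_ne_zero (by simp)
  have k2 := key (-1) (by norm_num) (by norm_num)
  have k3 := key Complex.I Complex.I_ne_zero (by simp)
  have k4 := key (-Complex.I) (neg_ne_zero.2 Complex.I_ne_zero) (by simp)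
  rw [e1, e2, e3, e4, k1, k2, k3, k4, one_zpow]
  ring

theorem norm_latticeToComplex_step {v : ℤ × ℤ} (hv : v ∈ srwSteps) : ‖latticeToComplex v‖ = 1 := by
  simp only [srwSteps, Finset.mem_insert, Finset.mem_singleton] at hv
  rw [← sq_eq_sq₀ (norm_nonneg _) zero_le_one, ← Complex.normSq_eq_norm_sq]
  rcases hv with rfl | rfl | rfl | rfl <;> simp [latticeToComplex, Complex.normSq_apply]

section Taylor

variable {f A B g : ℂ → ℂ} {c : ℕ → ℕ → ℂ}

theorem HasTaylorExpansion.apply_zero (hg : HasTaylorExpansion g c) : g 0 = c 0 0 := by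
  have := hg.iteratedDeriv_eq 0 0
  simpa using this

/-- The directional derivatives of `f` at `z` are those of `g` at `0` in the direction `v / z`. The
form `A z + B z * g h` covers the homogeneous terms (`A = 0`) and the logarithm (`B = 1`). -/
theorem laplaceTaylorTerm_line {z : ℂ} (hz : z ≠ 0)
    (hf : ∀ h : ℂ, ‖h‖ < 1 → f (z * (1 + h)) = A z + B z * g h) (v : ℂ) :
    (fun t : ℝ => f (z + t * v)) =ᶠ[𝓝 0] fun t : ℝ => A z + B z * g (t * (v / z)) := by
  have hcont : Tendsto (fun t : ℝ => ‖(t : ℂ) * (v / z)‖) (𝓝 0) (𝓝 0) := by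
    have : Continuous fun t : ℝ => ‖(t : ℂ) * (v / z)‖ := by fun_prop
    simpa using this.tendsto 0
  filter_upwards [hcont.eventually_lt_const one_pos] with t ht
  rw [← hf _ ht]
  congr 1
  field_simp

theorem laplaceTaylorTerm_contDiffAt (hg : HasTaylorExpansion g c) {z : ℂ} (hz : z ≠ 0)
    (hf : ∀ h : ℂ, ‖h‖ < 1 → f (z * (1 + h)) = A z + B z * g h) (v : ℂ) (d : ℕ) :
    ContDiffAt ℝ d (fun t : ℝ => f (z + t * v)) 0 :=
  (contDiffAt_const.add (contDiffAt_const.mul (hg.contDiffAt (v / z) d))).congr_of_eventuallyEq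
    (laplaceTaylorTerm_line hz hf v)

open Finset.HasAntidiagonal in
theorem laplaceTaylorTerm_eq (hg : HasTaylorExpansion g c) {z : ℂ} (hz : z ≠ 0)
    (hf : ∀ h : ℂ, ‖h‖ < 1 → f (z * (1 + h)) = A z + B z * g h) {d : ℕ} (hd : 1 ≤ d) :
    laplaceTaylorTerm d f z = ∑ v ∈ srwSteps, (1 / 4 : ℂ) * (B z * ∑ p ∈ antidiagonal d,
      c p.1 p.2 * ((latticeToComplex v / z) ^ p.1 *
        ((starRingEnd ℂ) (latticeToComplex v / z)) ^ p.2)) := by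
  unfold laplaceTaylorTerm
  rw [Finset.mul_sum]
  refine Finset.sum_congr rfl fun v _ => ?_
  rw [(laplaceTaylorTerm_line hz hf _).iteratedDeriv_eq, iteratedDeriv_const_add (by omega),
    iteratedDeriv_const_mul_field, hg.iteratedDeriv_eq]
  have : (d.factorial : ℂ) ≠ 0 := by exact_mod_cast d.factorial_ne_zero
  field_simp

open Finset.HasAntidiagonal in
theorem laplaceTaylorTerm_eq' (hg : HasTaylorExpansion g c) {z : ℂ} (hz : z ≠ 0)
    (hf : ∀ h : ℂ, ‖h‖ < 1 → f (z * (1 + h)) = A z + B z * g h) {d : ℕ} (hd : 1 ≤ d) :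
    laplaceTaylorTerm d f z = ∑ p ∈ antidiagonal d, (if (4 : ℤ) ∣ (p.1 : ℤ) - p.2 then
      c p.1 p.2 else 0) * (B z * (z⁻¹ ^ p.1 * ((starRingEnd ℂ) z)⁻¹ ^ p.2)) := by
  rw [laplaceTaylorTerm_eq hg hz hf hd]
  simp only [Finset.mul_sum]
  rw [Finset.sum_comm]
  refine Finset.sum_congr rfl fun p _ => ?_
  have h := sum_srwSteps_pow p.1 p.2
  have e : (if (4 : ℤ) ∣ (p.1 : ℤ) - p.2 then c p.1 p.2 else 0) =
      c p.1 p.2 * if (4 : ℤ) ∣ (p.1 : ℤ) - p.2 then 1 else 0 := by split_ifs <;> simp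
  rw [e, ← h, Finset.mul_sum, Finset.sum_mul]
  refine Finset.sum_congr rfl fun v _ => ?_
  rw [map_div₀, div_pow, div_pow, inv_pow, inv_pow]
  ring

/-- The discrete Laplacian is approximated by its Taylor terms. -/
theorem laplacian_sub_sum_isBigO (hg : HasTaylorExpansion g c)
    (hf : ∀ z : ℂ, z ≠ 0 → ∀ h : ℂ, ‖h‖ < 1 → f (z * (1 + h)) = A z + B z * g h)
    (hB : B =O[Bornology.cobounded ℂ] fun _ => (1 : ℝ)) {K : ℕ} (hK : 1 ≤ K) :
    (fun z : ℂ => ∑ v ∈ srwSteps, (1 / 4 : ℂ) * f (z + latticeToComplex v) - f z -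
      ∑ d ∈ Finset.Icc 1 (K - 1), laplaceTaylorTerm d f z) =O[Bornology.cobounded ℂ]
      fun z : ℂ => ‖z‖ ^ (-(K : ℤ)) := by
  have hcob : ∀ᶠ z : ℂ in Bornology.cobounded ℂ, 1 < ‖z‖ :=
    tendsto_norm_cobounded_atTop.eventually_gt_atTop 1
  have hmain : (fun z : ℂ => ∑ v ∈ srwSteps, (1 / 4 : ℂ) * (B z * (g (latticeToComplex v / z) -
      ∑ d ∈ Finset.range K, ∑ p ∈ Finset.HasAntidiagonal.antidiagonal d, c p.1 p.2 *
        ((latticeToComplex v / z) ^ p.1 * ((starRingEnd ℂ) (latticeToComplex v / z)) ^ p.2))))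
      =O[Bornology.cobounded ℂ] fun z : ℂ => ‖z‖ ^ (-(K : ℤ)) := by
    refine IsBigO.fun_sum fun v hv => IsBigO.const_mul_left ?_ _
    have ht : Tendsto (fun z : ℂ => latticeToComplex v / z) (Bornology.cobounded ℂ) (𝓝 0) := by
      have := (tendsto_inv₀_cobounded (α := ℂ)).const_mul (latticeToComplex v)
      simpa [div_eq_mul_inv] using this
    have h1 := hB.mul ((hg.isBigO K).comp_tendsto ht)
    refine h1.congr_right fun z => ?_
    simp only [Function.comp_apply, norm_div, norm_latticeToComplex_step hv, one_mul]
    rw [one_div, inv_pow, zpow_neg, zpow_natCast]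
  refine hmain.congr' ?_ EventuallyEq.rfl
  filter_upwards [hcob] with z hz
  have hz0 : z ≠ 0 := norm_pos_iff.1 (one_pos.trans hz)
  have hfv : ∀ v ∈ srwSteps, f (z + latticeToComplex v) = A z + B z * g (latticeToComplex v / z) := by
    intro v hv
    rw [← hf z hz0 _ (by rw [norm_div, norm_latticeToComplex_step hv, div_lt_one (by linarith)]
                         exact hz)]
    congr 1
    field_simp
  have hf0 : f z = A z + B z * c 0 0 := by
    have := hf z hz0 0 (by simp)
    rwa [add_zero, mul_one, hg.apply_zero] at this
  have hT : ∑ d ∈ Finset.Icc 1 (K - 1), laplaceTaylorTerm d f z = ∑ v ∈ srwSteps, (1 / 4 : ℂ) *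
      (B z * ∑ d ∈ Finset.Icc 1 (K - 1), ∑ p ∈ Finset.HasAntidiagonal.antidiagonal d, c p.1 p.2 *
        ((latticeToComplex v / z) ^ p.1 * ((starRingEnd ℂ) (latticeToComplex v / z)) ^ p.2)) := by
    rw [Finset.sum_congr rfl fun d hd => laplaceTaylorTerm_eq hg hz0 (hf z hz0)
      (Finset.mem_Icc.1 hd).1, Finset.sum_comm]
    simp only [Finset.mul_sum]
  have hrange : ∀ F : ℕ → ℂ, ∑ d ∈ Finset.range K, F d =
      F 0 + ∑ d ∈ Finset.Icc 1 (K - 1), F d := by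
    intro F
    have : Finset.range K = insert 0 (Finset.Icc 1 (K - 1)) := by
      ext d; simp only [Finset.mem_range, Finset.mem_insert, Finset.mem_Icc]; omega
    rw [this, Finset.sum_insert (by simp)]
  have h4 : ∀ x : ℂ, ∑ v ∈ srwSteps, (1 / 4 : ℂ) * x = x := by
    intro x; rw [sum_srwSteps]; ring
  have hsum : ∑ v ∈ srwSteps, (1 / 4 : ℂ) * f (z + latticeToComplex v) =
      ∑ v ∈ srwSteps, (1 / 4 : ℂ) * (A z + B z * g (latticeToComplex v / z)) :=
    Finset.sum_congr rfl fun v hv => by rw [hfv v hv]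
  rw [hsum, hT, hf0, ← h4 (A z + B z * c 0 0)]
  rw [← Finset.sum_sub_distrib, ← Finset.sum_sub_distrib]
  refine Finset.sum_congr rfl fun v _ => ?_
  rw [hrange]
  simp
  ring

end Taylor

theorem norm_homogeneousTerm (n : ℕ) (m : ℤ) {z : ℂ} (hz : z ≠ 0) :
    ‖homogeneousTerm n m z‖ = ‖z‖ ^ (-(n : ℤ)) := by
  have h : ‖z‖ ≠ 0 := norm_ne_zero_iff.2 hz
  rw [homogeneousTerm, norm_mul, norm_zpow, norm_zpow, Complex.norm_real, norm_norm, ← zpow_add₀ h]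
  congr 1
  ring

/-- A Taylor monomial of degree `i + j` in the step raises the order by `i + j` and changes the
frequency by `j - i`. -/
theorem homogeneousTerm_mul_inv_pow (n : ℕ) (m : ℤ) {z : ℂ} (hz : z ≠ 0) (i j : ℕ) :
    homogeneousTerm n m z * (z⁻¹ ^ i * ((starRingEnd ℂ) z)⁻¹ ^ j) =
      homogeneousTerm (n + (i + j)) (m - i + j) z := by
  have hn : (‖z‖ : ℂ) ≠ 0 := by exact_mod_cast norm_ne_zero_iff.2 hz
  have hconj : ((starRingEnd ℂ) z)⁻¹ = z * (‖z‖ : ℂ) ^ (-2 : ℤ) := by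
    have h1 : z * (starRingEnd ℂ) z = (‖z‖ : ℂ) ^ 2 := by
      rw [Complex.mul_conj, Complex.normSq_eq_norm_sq]; push_cast; rfl
    have hc : (starRingEnd ℂ) z ≠ 0 := by simpa using hz
    rw [zpow_neg, eq_mul_inv_iff_mul_eq₀ (zpow_ne_zero _ hn)]
    field_simp
    rw [mul_comm] at h1
    exact_mod_cast h1.symm
  rw [hconj, homogeneousTerm, homogeneousTerm, mul_pow, inv_pow, ← zpow_natCast z i,
    ← zpow_natCast z j, ← zpow_neg, ← zpow_natCast _ j, ← zpow_mul]
  have e1 : z ^ (m - i + j) = z ^ m * z ^ (-(i : ℤ)) * z ^ (j : ℤ) := by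
    rw [← zpow_add₀ hz, ← zpow_add₀ hz]; congr 1
  have e2 : (‖z‖ : ℂ) ^ (-(((n + (i + j) : ℕ) : ℤ) + (m - i + j))) =
      (‖z‖ : ℂ) ^ (-((n : ℤ) + m)) * (‖z‖ : ℂ) ^ ((-2 : ℤ) * j) := by
    rw [← zpow_add₀ hn]; congr 1; push_cast; ring
  rw [e1, e2]
  ring

/-- The functions to which the Taylor expansion of the discrete Laplacian applies, with an error of
order `|z| ^ (-K)` after the terms of order `< K`. -/
structure HasLaplaceExpansion (f : ℂ → ℂ) : Prop where
  contDiffAt : ∀ z : ℂ, z ≠ 0 → ∀ (v : ℂ) (d : ℕ), ContDiffAt ℝ d (fun t : ℝ => f (z + t * v)) 0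
  isBigO : ∀ K : ℕ, 1 ≤ K →
    (fun z : ℂ => ∑ v ∈ srwSteps, (1 / 4 : ℂ) * f (z + latticeToComplex v) - f z -
      ∑ d ∈ Finset.Icc 1 (K - 1), laplaceTaylorTerm d f z) =O[Bornology.cobounded ℂ]
      fun z : ℂ => ‖z‖ ^ (-(K : ℤ))

theorem eventually_ne_zero_cobounded : ∀ᶠ z : ℂ in Bornology.cobounded ℂ, z ≠ 0 := by
  filter_upwards [(tendsto_norm_cobounded_atTop (E := ℂ)).eventually_gt_atTop 0] with z hz
  exact norm_pos_iff.1 hz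

section Linear

variable {f f' : ℂ → ℂ} {z : ℂ} {d : ℕ}

theorem laplaceTaylorTerm_const_mul (r : ℂ) :
    laplaceTaylorTerm d (fun z => r * f z) z = r * laplaceTaylorTerm d f z := by
  simp only [laplaceTaylorTerm, iteratedDeriv_const_mul_field, Finset.mul_sum]
  exact Finset.sum_congr rfl fun v _ => by ring

theorem laplaceTaylorTerm_add
    (h : ∀ v : ℂ, ContDiffAt ℝ d (fun t : ℝ => f (z + t * v)) 0)
    (h' : ∀ v : ℂ, ContDiffAt ℝ d (fun t : ℝ => f' (z + t * v)) 0) :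
    laplaceTaylorTerm d (fun z => f z + f' z) z =
      laplaceTaylorTerm d f z + laplaceTaylorTerm d f' z := by
  simp only [laplaceTaylorTerm, iteratedDeriv_fun_add (h _) (h' _), mul_add,
    Finset.sum_add_distrib]

theorem laplaceTaylorTerm_sum {ι : Type*} (s : Finset ι) {F : ι → ℂ → ℂ}
    (h : ∀ i ∈ s, ∀ v : ℂ, ContDiffAt ℝ d (fun t : ℝ => F i (z + t * v)) 0) :
    laplaceTaylorTerm d (fun z => ∑ i ∈ s, F i z) z = ∑ i ∈ s, laplaceTaylorTerm d (F i) z := by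
  simp only [laplaceTaylorTerm, iteratedDeriv_fun_sum (fun i hi => h i hi _), Finset.mul_sum]
  rw [Finset.sum_comm]

theorem HasLaplaceExpansion.add (h : HasLaplaceExpansion f) (h' : HasLaplaceExpansion f') :
    HasLaplaceExpansion (fun z => f z + f' z) := by
  refine ⟨fun z hz v d => (h.contDiffAt z hz v d).add (h'.contDiffAt z hz v d), fun K hK => ?_⟩
  refine ((h.isBigO K hK).add (h'.isBigO K hK)).congr' ?_ EventuallyEq.rfl
  filter_upwards [eventually_ne_zero_cobounded] with z hz
  simp only [laplaceTaylorTerm_add (fun v => h.contDiffAt z hz v _)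
    (fun v => h'.contDiffAt z hz v _), mul_add, Finset.sum_add_distrib]
  ring

theorem HasLaplaceExpansion.const_mul (h : HasLaplaceExpansion f) (r : ℂ) :
    HasLaplaceExpansion (fun z => r * f z) := by
  refine ⟨fun z hz v d => contDiffAt_const.mul (h.contDiffAt z hz v d), fun K hK => ?_⟩
  refine ((h.isBigO K hK).const_mul_left r).congr_left fun z => ?_
  simp only [laplaceTaylorTerm_const_mul, mul_sub, Finset.mul_sum]
  congr 2
  exact Finset.sum_congr rfl fun v _ => by ring

theorem HasLaplaceExpansion.zero : HasLaplaceExpansion (fun _ => 0) := by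
  refine ⟨fun z hz v d => contDiffAt_const, fun K hK => ?_⟩
  have : ∀ d (z : ℂ), laplaceTaylorTerm d (fun _ : ℂ => (0 : ℂ)) z = 0 := by
    intro d z
    have := laplaceTaylorTerm_const_mul (d := d) (f := fun _ => (0 : ℂ)) (z := z) 0
    simpa using this
  simp only [this, mul_zero, Finset.sum_const_zero, sub_zero]
  exact isBigO_zero _ _

theorem HasLaplaceExpansion.sum {ι : Type*} (s : Finset ι) {F : ι → ℂ → ℂ}
    (h : ∀ i ∈ s, HasLaplaceExpansion (F i)) : HasLaplaceExpansion (fun z => ∑ i ∈ s, F i z) := by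
  classical
  induction s using Finset.induction_on with
  | empty => simpa using HasLaplaceExpansion.zero
  | insert a s ha ih =>
    simp only [Finset.sum_insert ha]
    exact (h a (Finset.mem_insert_self _ _)).add (ih fun i hi => h i (Finset.mem_insert_of_mem hi))

end Linear

theorem hasLaplaceExpansion_homogeneousTerm (n : ℕ) (m : ℤ) :
    HasLaplaceExpansion (homogeneousTerm n m) := by
  have hg := hasTaylorExpansion_homogeneous n m
  refine ⟨fun z hz v d => laplaceTaylorTerm_contDiffAt hg (A := fun _ => 0) hz
    (fun h hh => homogeneousTerm_mul_one_add n m z hh) v d, fun K hK =>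
      laplacian_sub_sum_isBigO hg (A := fun _ => 0)
        (fun z _ h hh => homogeneousTerm_mul_one_add n m z hh) ?_ hK⟩
  refine IsBigO.of_bound 1 ?_
  filter_upwards [(tendsto_norm_cobounded_atTop (E := ℂ)).eventually_ge_atTop 1] with z hz
  rw [norm_homogeneousTerm n m (norm_pos_iff.1 (by linarith)), zpow_neg, zpow_natCast, norm_one,
    mul_one]
  exact inv_le_one_of_one_le₀ (one_le_pow₀ hz)

theorem hasLaplaceExpansion_log : HasLaplaceExpansion (fun z => (Real.log ‖z‖ : ℂ)) := by
  let L : ℂ → ℂ := fun z => (Real.log ‖z‖ : ℂ)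
  let B : ℂ → ℂ := fun _ => 1
  have hf : ∀ z : ℂ, z ≠ 0 → ∀ h : ℂ, ‖h‖ < 1 → L (z * (1 + h)) = L z + B z * logOneAdd h :=
    fun z hz h hh => log_norm_mul_one_add hz hh
  have hB : B =O[Bornology.cobounded ℂ] fun _ => (1 : ℝ) := isBigO_const_const _ one_ne_zero _
  exact ⟨fun z hz v d => laplaceTaylorTerm_contDiffAt (f := L) (A := L) (B := B)
    hasTaylorExpansion_log hz (hf z hz) v d, fun K hK => laplacian_sub_sum_isBigO (f := L) (A := L)
      (B := B) hasTaylorExpansion_log hf hB hK⟩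

/-! ### The formal discrete Laplacian -/

/-- The value at `z` of `∑ m, c m * z ^ m |z| ^ (-(n + m))`, as a linear function of `c`. -/
noncomputable def evalOrder (n : ℕ) (z : ℂ) : (ℤ →₀ ℂ) →ₗ[ℂ] ℂ :=
  Finsupp.linearCombination ℂ fun m => homogeneousTerm n m z

theorem evalOrder_apply (n : ℕ) (z : ℂ) (c : ℤ →₀ ℂ) :
    evalOrder n z c = c.sum fun m a => a * homogeneousTerm n m z := rfl

theorem evalOrder_single (n : ℕ) (z : ℂ) (m : ℤ) (a : ℂ) :
    evalOrder n z (Finsupp.single m a) = a * homogeneousTerm n m z :=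
  Finsupp.linearCombination_single ℂ a m

theorem PotentialExpansion.part_eq_evalOrder (E : PotentialExpansion) (n : ℕ) (z : ℂ) :
    E.part n z = evalOrder n z (E.coeff n) := rfl

theorem isBigO_evalOrder (n : ℕ) (c : ℤ →₀ ℂ) {K : ℕ} (hK : K ≤ n) :
    (fun z => evalOrder n z c) =O[Bornology.cobounded ℂ] fun z : ℂ => ‖z‖ ^ (-(K : ℤ)) := by
  simp only [evalOrder_apply, Finsupp.sum]
  refine IsBigO.fun_sum fun m _ => IsBigO.const_mul_left (IsBigO.of_bound 1 ?_) _
  filter_upwards [(tendsto_norm_cobounded_atTop (E := ℂ)).eventually_ge_atTop 1] with z hz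
  rw [norm_homogeneousTerm n m (norm_pos_iff.1 (by linarith)), norm_zpow, norm_norm, one_mul]
  exact zpow_le_zpow_right₀ hz (by omega)

/-- The coefficients of the term of order `d` of the discrete Laplacian of a function with Taylor
coefficients `c` and frequency `m`. -/
noncomputable def stepLaplacian (c : ℕ → ℕ → ℂ) (m : ℤ) (d : ℕ) : ℤ →₀ ℂ :=
  ∑ p ∈ Finset.HasAntidiagonal.antidiagonal d, Finsupp.single (m - p.1 + p.2)
    (if (4 : ℤ) ∣ (p.1 : ℤ) - p.2 then c p.1 p.2 else 0)

theorem laplaceTaylorTerm_homogeneousTerm (n : ℕ) (m : ℤ) {z : ℂ} (hz : z ≠ 0) {d : ℕ}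
    (hd : 1 ≤ d) : laplaceTaylorTerm d (homogeneousTerm n m) z =
      evalOrder (n + d) z (stepLaplacian (homogeneousTaylorCoeff n m) m d) := by
  rw [laplaceTaylorTerm_eq' (hasTaylorExpansion_homogeneous n m) (A := fun _ => 0) hz
    (fun h hh => homogeneousTerm_mul_one_add n m z hh) hd, stepLaplacian, map_sum]
  refine Finset.sum_congr rfl fun p hp => ?_
  rw [evalOrder_single, homogeneousTerm_mul_inv_pow n m hz,
    Finset.HasAntidiagonal.mem_antidiagonal.1 hp]

theorem laplaceTaylorTerm_log {z : ℂ} (hz : z ≠ 0) {d : ℕ} (hd : 1 ≤ d) :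
    laplaceTaylorTerm d (fun z => (Real.log ‖z‖ : ℂ)) z =
      evalOrder d z (stepLaplacian logTaylorCoeff 0 d) := by
  rw [laplaceTaylorTerm_eq' hasTaylorExpansion_log (A := fun z => (Real.log ‖z‖ : ℂ))
    (B := fun _ => 1) hz (fun h hh => log_norm_mul_one_add hz hh) hd, stepLaplacian, map_sum]
  refine Finset.sum_congr rfl fun p hp => ?_
  have h1 : (1 : ℂ) = homogeneousTerm 0 0 z := by simp [homogeneousTerm]
  rw [evalOrder_single, h1, homogeneousTerm_mul_inv_pow 0 0 hz,
    Finset.HasAntidiagonal.mem_antidiagonal.1 hp, zero_add]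

namespace PotentialExpansion

variable (E : PotentialExpansion)

theorem hasLaplaceExpansion_trunc (K : ℕ) : HasLaplaceExpansion (E.trunc K) := by
  have h : E.trunc K = fun z => E.logCoeff * (Real.log ‖z‖ : ℂ) +
      ∑ n ∈ Finset.range K, ∑ m ∈ (E.coeff n).support, E.coeff n m * homogeneousTerm n m z := by
    funext z
    rw [trunc_eq]
    rfl
  rw [h]
  exact (hasLaplaceExpansion_log.const_mul _).add (HasLaplaceExpansion.sum _ fun n _ =>
    HasLaplaceExpansion.sum _ fun m _ => (hasLaplaceExpansion_homogeneousTerm n m).const_mul _)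

/-- The contribution to the discrete Laplacian of the coefficients of order `n` through the Taylor
term of order `d`. -/
noncomputable def laplacianPiece (n d : ℕ) : ℤ →₀ ℂ :=
  (E.coeff n).sum fun m a => a • stepLaplacian (homogeneousTaylorCoeff n m) m d

theorem laplaceTaylorTerm_trunc (K : ℕ) {z : ℂ} (hz : z ≠ 0) {d : ℕ} (hd : 1 ≤ d) :
    laplaceTaylorTerm d (E.trunc K) z =
      evalOrder d z (E.logCoeff • stepLaplacian logTaylorCoeff 0 d) +
        ∑ n ∈ Finset.range K, evalOrder (n + d) z (E.laplacianPiece n d) := by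
  have h : E.trunc K = fun z => E.logCoeff * (Real.log ‖z‖ : ℂ) +
      ∑ n ∈ Finset.range K, ∑ m ∈ (E.coeff n).support, E.coeff n m * homogeneousTerm n m z := by
    funext z
    rw [trunc_eq]
    rfl
  have h1 : ∀ n m, HasLaplaceExpansion fun z => E.coeff n m * homogeneousTerm n m z :=
    fun n m => (hasLaplaceExpansion_homogeneousTerm n m).const_mul _
  have h2 : ∀ n, HasLaplaceExpansion fun z =>
      ∑ m ∈ (E.coeff n).support, E.coeff n m * homogeneousTerm n m z :=
    fun n => HasLaplaceExpansion.sum _ fun m _ => h1 n m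
  rw [h, laplaceTaylorTerm_add (fun v => (hasLaplaceExpansion_log.const_mul _).contDiffAt z hz v d)
    (fun v => (HasLaplaceExpansion.sum _ fun n _ => h2 n).contDiffAt z hz v d),
    laplaceTaylorTerm_const_mul, laplaceTaylorTerm_log hz hd, map_smul, smul_eq_mul,
    laplaceTaylorTerm_sum _ (fun n _ v => (h2 n).contDiffAt z hz v d)]
  congr 1
  refine Finset.sum_congr rfl fun n _ => ?_
  rw [laplaceTaylorTerm_sum _ (fun m _ v => (h1 n m).contDiffAt z hz v d), laplacianPiece,
    Finsupp.sum, map_sum]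
  refine Finset.sum_congr rfl fun m _ => ?_
  rw [laplaceTaylorTerm_const_mul, laplaceTaylorTerm_homogeneousTerm n m hz hd, map_smul,
    smul_eq_mul]

/-- The formal discrete Laplacian of a formal expansion. -/
noncomputable def laplacian : PotentialExpansion where
  logCoeff := 0
  coeff N := if N = 0 then 0 else E.logCoeff • stepLaplacian logTaylorCoeff 0 N +
    ∑ n ∈ Finset.range N, E.laplacianPiece n (N - n)

/-- The Taylor terms of order `d < K` applied to the orders `n < K` give the formal Laplacian up to
order `K`, and finitely many further terms with `n + d ≥ K`. -/
theorem sum_laplaceTaylorTerm_trunc_sub_isBigO (K : ℕ) :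
    (fun z : ℂ => ∑ d ∈ Finset.Icc 1 (K - 1), laplaceTaylorTerm d (E.trunc K) z -
      E.laplacian.trunc K z) =O[Bornology.cobounded ℂ] fun z : ℂ => ‖z‖ ^ (-(K : ℤ)) := by
  have h : (fun z : ℂ => ∑ p ∈ (Finset.range K ×ˢ Finset.Icc 1 (K - 1)).filter
      (fun p => ¬ p.1 + p.2 < K), evalOrder (p.1 + p.2) z (E.laplacianPiece p.1 p.2))
      =O[Bornology.cobounded ℂ] fun z : ℂ => ‖z‖ ^ (-(K : ℤ)) := by
    refine IsBigO.fun_sum fun p hp => ?_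
    rw [Finset.mem_filter, not_lt] at hp
    exact isBigO_evalOrder _ _ hp.2
  refine h.congr' ?_ EventuallyEq.rfl
  filter_upwards [eventually_ne_zero_cobounded] with z hz
  rw [Finset.sum_congr rfl fun d hd => E.laplaceTaylorTerm_trunc K hz (Finset.mem_Icc.1 hd).1,
    Finset.sum_add_distrib, trunc_eq, laplacian, zero_mul, zero_add]
  simp only [part_eq_evalOrder]
  have hsub : Finset.Icc 1 (K - 1) ⊆ Finset.range K := by
    intro d hd
    rw [Finset.mem_Icc] at hd
    rw [Finset.mem_range]; omega
  rw [← Finset.sum_subset hsub (f := fun N => evalOrder N z (if N = 0 then 0 else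
    E.logCoeff • stepLaplacian logTaylorCoeff 0 N +
      ∑ n ∈ Finset.range N, E.laplacianPiece n (N - n)))]
  · have e1 : ∀ N ∈ Finset.Icc 1 (K - 1), evalOrder N z (if N = 0 then 0 else
        E.logCoeff • stepLaplacian logTaylorCoeff 0 N +
          ∑ n ∈ Finset.range N, E.laplacianPiece n (N - n)) =
        evalOrder N z (E.logCoeff • stepLaplacian logTaylorCoeff 0 N) +
          ∑ n ∈ Finset.range N, evalOrder N z (E.laplacianPiece n (N - n)) := by
      intro N hN
      rw [if_neg (by have := (Finset.mem_Icc.1 hN).1; omega), map_add, map_sum]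
    rw [Finset.sum_congr rfl e1, Finset.sum_add_distrib, add_sub_add_left_eq_sub, Finset.sum_comm,
      ← Finset.sum_product', ← Finset.sum_filter_add_sum_filter_not
        (Finset.range K ×ˢ Finset.Icc 1 (K - 1)) (fun p => p.1 + p.2 < K), Finset.sum_sigma',
      eq_comm, sub_eq_iff_eq_add, add_comm]
    congr 1
    refine Finset.sum_bij' (fun p _ => ⟨p.1 + p.2, p.1⟩) (fun s _ => (s.2, s.1 - s.2)) ?_ ?_ ?_ ?_ ?_
    · intro p hp
      simp only [Finset.mem_filter, Finset.mem_product, Finset.mem_range, Finset.mem_Icc] at hp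
      simp only [Finset.mem_sigma, Finset.mem_range, Finset.mem_Icc]
      omega
    · rintro ⟨N, n⟩ hp
      simp only [Finset.mem_sigma, Finset.mem_range, Finset.mem_Icc] at hp
      simp only [Finset.mem_filter, Finset.mem_product, Finset.mem_range, Finset.mem_Icc]
      omega
    · intro p hp
      simp
    · rintro ⟨N, n⟩ hp
      simp only [Finset.mem_sigma, Finset.mem_range, Finset.mem_Icc] at hp
      have : n + (N - n) = N := by omega
      simp [this]
    · intro p hp
      simp
  · intro N hN hN'
    have : N = 0 := by
      rw [Finset.mem_range] at hN
      rw [Finset.mem_Icc] at hN'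
      omega
    simp [this]

end PotentialExpansion

theorem tendsto_latticeToComplex : Tendsto latticeToComplex cofinite (Bornology.cobounded ℂ) := by
  rw [← tendsto_norm_atTop_iff_cobounded, tendsto_atTop]
  intro b
  rw [eventually_cofinite]
  refine (((Set.finite_Icc (-⌈b⌉) ⌈b⌉).prod (Set.finite_Icc (-⌈b⌉) ⌈b⌉))).subset fun z hz => ?_
  have h := norm_latticeToComplex_ge z
  have hz' : ‖latticeToComplex z‖ < b := not_le.1 hz
  have h1 := (le_max_left _ _).trans h
  have h2 := (le_max_right _ _).trans h
  have hb := Int.le_ceil b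
  have key : ∀ x : ℤ, |(x : ℝ)| ≤ ‖latticeToComplex z‖ → x ∈ Set.Icc (-⌈b⌉) ⌈b⌉ := by
    intro x hx
    have : |(x : ℝ)| ≤ (⌈b⌉ : ℝ) := by linarith
    rw [abs_le] at this
    exact ⟨by exact_mod_cast this.1, by exact_mod_cast this.2⟩
  exact ⟨key _ h1, key _ h2⟩

theorem isAmple_univ : IsAmple Set.univ := ⟨0, fun _ _ _ _ => trivial⟩

namespace PotentialExpansion

variable (E : PotentialExpansion)

/-- Bounds on the lattice suffice for the differential equations, as they determine the
coefficients of a formal expansion. -/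
theorem laplacian_coeff_eq_zero_of_isBigO
    (h : ∀ K : ℕ, 1 ≤ K → (fun z : ℤ × ℤ => ∑ d ∈ Finset.Icc 1 (K - 1),
      laplaceTaylorTerm d (E.trunc K) (latticeToComplex z)) =O[cofinite]
      fun z : ℤ × ℤ => ‖latticeToComplex z‖ ^ (-(K : ℤ))) (n : ℕ) :
    E.laplacian.coeff n = 0 := by
  refine (E.laplacian.eq_zero_of_isBigO isAmple_univ fun K => ?_).2 n
  rw [principal_univ, inf_top_eq]
  rcases Nat.eq_zero_or_pos K with rfl | hK
  · simp only [trunc_eq, laplacian, zero_mul, Finset.range_zero, Finset.sum_empty, add_zero]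
    exact isBigO_zero _ _
  · have h1 := (E.sum_laplaceTaylorTerm_trunc_sub_isBigO K).comp_tendsto tendsto_latticeToComplex
    refine ((h K hK).sub h1).congr_left fun z => ?_
    simp

/-- The differential equations say that the formal discrete Laplacian vanishes. -/
theorem satisfiesDifferentialEquations_iff :
    E.SatisfiesDifferentialEquations ↔ ∀ n, E.laplacian.coeff n = 0 := by
  constructor
  · intro h
    exact E.laplacian_coeff_eq_zero_of_isBigO fun K _ => (h K).comp_tendsto tendsto_latticeToComplex
  · intro h K
    refine (E.sum_laplaceTaylorTerm_trunc_sub_isBigO K).congr_left fun z => ?_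
    have : E.laplacian.trunc K z = 0 := by
      rw [trunc_eq]
      simp only [part, h, Finsupp.sum_zero_index, Finset.sum_const_zero, add_zero]
      exact zero_mul _
    rw [this, sub_zero]

end PotentialExpansion

/-! ### The expansion of the potential solves the differential equations -/

/-- Error terms are stable under translation, so the discrete Laplacian may be applied to them. -/
theorem isBigO_shift {r : ℤ × ℤ → ℂ} {K : ℕ}
    (hr : r =O[cofinite] fun z => ‖latticeToComplex z‖ ^ (-(K : ℤ))) (v : ℤ × ℤ) :
    (fun z => r (z + v)) =O[cofinite] fun z => ‖latticeToComplex z‖ ^ (-(K : ℤ)) := by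
  have h1 : Tendsto (fun z : ℤ × ℤ => z + v) cofinite cofinite :=
    (add_left_injective v).tendsto_cofinite
  refine (hr.comp_tendsto h1).trans (IsBigO.of_bound (2 ^ K) ?_)
  have hnorm : Tendsto (fun z => ‖latticeToComplex z‖) cofinite atTop :=
    tendsto_norm_cobounded_atTop.comp tendsto_latticeToComplex
  filter_upwards [hnorm.eventually_ge_atTop (2 * ‖latticeToComplex v‖), hnorm.eventually_gt_atTop 0]
    with z hz hz0
  simp only [Function.comp_apply, latticeToComplex_add, zpow_neg, zpow_natCast, norm_inv, norm_pow,
    norm_norm]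
  have h2 : ‖latticeToComplex z‖ / 2 ≤ ‖latticeToComplex z + latticeToComplex v‖ := by
    have := norm_sub_le (latticeToComplex z + latticeToComplex v) (latticeToComplex v)
    rw [add_sub_cancel_right] at this
    linarith
  calc (‖latticeToComplex z + latticeToComplex v‖ ^ K)⁻¹
      ≤ ((‖latticeToComplex z‖ / 2) ^ K)⁻¹ := by gcongr
    _ = 2 ^ K * (‖latticeToComplex z‖ ^ K)⁻¹ := by rw [div_pow, inv_div, div_eq_mul_inv]

/-- An expansion of the potential solves the differential equations, as the potential is discrete
harmonic off the origin. -/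
theorem PotentialExpansion.IsExpansionOf.satisfiesDifferentialEquations {E : PotentialExpansion}
    (hE : E.IsExpansionOf harmonicPotential) : E.SatisfiesDifferentialEquations := by
  rw [E.satisfiesDifferentialEquations_iff]
  refine E.laplacian_coeff_eq_zero_of_isBigO fun K hK => ?_
  -- The discrete Laplacian of the truncation is that of the error term, up to sign, and is also
  -- approximated by the Taylor terms.
  have h1 := ((E.hasLaplaceExpansion_trunc K).isBigO K hK).comp_tendsto tendsto_latticeToComplex
  have h2 : (fun z : ℤ × ℤ => ∑ v ∈ srwSteps, (1 / 4 : ℂ) * ((harmonicPotential (z + v) : ℂ) -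
      E.trunc K (latticeToComplex (z + v))) -
        ((harmonicPotential z : ℂ) - E.trunc K (latticeToComplex z)))
      =O[cofinite] fun z => ‖latticeToComplex z‖ ^ (-(K : ℤ)) :=
    (IsBigO.fun_sum fun v _ => (isBigO_shift (hE K) v).const_mul_left _).sub (hE K)
  refine ((h1.add h2).neg_left).congr' ?_ EventuallyEq.rfl
  have h0 : ∀ᶠ z : ℤ × ℤ in cofinite, z ≠ 0 := by
    rw [eventually_cofinite]; simp
  filter_upwards [h0] with z hz
  have h3 : ∑ v ∈ srwSteps, (1 / 4 : ℂ) * (harmonicPotential (z + v) : ℂ) = harmonicPotential z := by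
    rw [← sum_harmonicPotential_add z hz]
    push_cast
    rfl
  simp only [Function.comp_apply, mul_sub, Finset.sum_sub_distrib, h3, latticeToComplex_add]
  ring

/-! ### Asymptotics of the diagonal values -/

/-- The expansion of `(m - 1) ^ (-n)` in powers of `x = 1 / m`. -/
theorem inv_one_sub_pow_isBigO {n K : ℕ} (hn : 1 ≤ n) (hnK : n < K) :
    (fun x : ℂ => x ^ n * ((1 - x) ^ n)⁻¹ - ∑ r ∈ Finset.Ico n K,
      ((r - 1).choose (n - 1) : ℂ) * x ^ r) =O[𝓝 0] fun x : ℂ => ‖x‖ ^ K := by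
  obtain ⟨a, rfl⟩ : ∃ a, n = a + 1 := ⟨n - 1, by omega⟩
  have h := ofScalars_isBigO
    (Complex.one_div_one_sub_pow_hasFPowerSeriesOnBall_zero a).hasFPowerSeriesAt (K - (a + 1))
  have h2 : (fun x : ℂ => x ^ (a + 1)) =O[𝓝 0] fun x : ℂ => ‖x‖ ^ (a + 1) :=
    IsBigO.of_bound 1 (Eventually.of_forall fun x => by simp)
  refine (h2.mul h).congr (fun x => ?_) fun x => ?_
  · rw [mul_sub, one_div, Finset.sum_Ico_eq_sum_range, Finset.mul_sum]
    congr 1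
    refine Finset.sum_congr rfl fun j _ => ?_
    have : a + 1 + j - 1 = a + j := by omega
    rw [this, Nat.add_sub_cancel, pow_add]
    ring
  · rw [← pow_add]
    congr 1
    omega

theorem log_one_sub_isBigO (K : ℕ) :
    (fun x : ℂ => Complex.log (1 - x) + ∑ r ∈ Finset.range K, (1 / (r : ℂ)) * x ^ r) =O[𝓝 0]
      fun x : ℂ => ‖x‖ ^ K := by
  have h := ofScalars_isBigO hasFPowerSeriesAt_clog_one_add K
  have hneg : Tendsto (fun x : ℂ => -x) (𝓝 0) (𝓝 0) := by
    simpa using (continuous_neg (G := ℂ)).tendsto 0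
  refine (h.comp_tendsto hneg).congr (fun x => ?_) fun x => by simp
  simp only [Function.comp_apply, ← sub_eq_add_neg, sub_eq_add_neg (Complex.log (1 - x)),
    ← Finset.sum_neg_distrib]
  congr 1
  refine Finset.sum_congr rfl fun r _ => ?_
  rw [neg_pow x, neg_div, neg_mul, neg_neg, div_mul_eq_mul_div, ← mul_assoc, ← mul_pow]
  norm_num
  ring

/-- The recursion of the Bernoulli numbers in the form used for the harmonic numbers. -/
theorem sum_bernoulli_div_mul_choose {r : ℕ} (hr : 1 ≤ r) :
    ∑ n ∈ Finset.Icc 1 r, ((bernoulli n : ℚ) : ℂ) / n * ((r - 1).choose (n - 1) : ℂ) =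
      (bernoulli r : ℚ) / r + (if r = 1 then 1 else 0) - 1 / r := by
  have hr0 : (r : ℂ) ≠ 0 := by exact_mod_cast (by omega : r ≠ 0)
  have h := sum_bernoulli r
  have h' : ∑ k ∈ Finset.range r, (r.choose k : ℂ) * ((bernoulli k : ℚ) : ℂ) =
      if r = 1 then 1 else 0 := by
    have := congrArg (fun q : ℚ => (q : ℂ)) h
    push_cast at this
    rw [this]
    split_ifs <;> simp
  have hsplit : Finset.range r = insert 0 (Finset.Icc 1 (r - 1)) := by
    ext d; simp only [Finset.mem_range, Finset.mem_insert, Finset.mem_Icc]; omega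
  have hIcc : Finset.Icc 1 r = insert r (Finset.Icc 1 (r - 1)) := by
    ext d; simp only [Finset.mem_insert, Finset.mem_Icc]; omega
  rw [hsplit, Finset.sum_insert (by simp)] at h'
  rw [hIcc, Finset.sum_insert (by simp; omega)]
  have hterm : ∀ n ∈ Finset.Icc 1 (r - 1), ((bernoulli n : ℚ) : ℂ) / n *
      ((r - 1).choose (n - 1) : ℂ) = (1 / r) * ((r.choose n : ℂ) * ((bernoulli n : ℚ) : ℂ)) := by
    intro n hn
    rw [Finset.mem_Icc] at hn
    obtain ⟨s, rfl⟩ : ∃ s, r = s + 1 := ⟨r - 1, by omega⟩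
    obtain ⟨k, rfl⟩ : ∃ k, n = k + 1 := ⟨n - 1, by omega⟩
    have hc := Nat.add_one_mul_choose_eq s k
    have hc' : ((s + 1 : ℕ) : ℂ) * (s.choose k : ℂ) =
        ((s + 1).choose (k + 1) : ℂ) * ((k + 1 : ℕ) : ℂ) := by exact_mod_cast hc
    have hk : ((k + 1 : ℕ) : ℂ) ≠ 0 := by exact_mod_cast Nat.succ_ne_zero k
    simp only [Nat.add_sub_cancel]
    field_simp
    linear_combination ((bernoulli (k + 1) : ℚ) : ℂ) * hc'
  rw [Finset.sum_congr rfl hterm, ← Finset.mul_sum]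
  simp only [Nat.choose_zero_right, Nat.cast_one, bernoulli_zero, Rat.cast_one, mul_one] at h'
  rw [eq_sub_of_add_eq' h', Nat.choose_self, Nat.cast_one]
  by_cases h1 : r = 1
  · subst h1; simp
  · simp only [h1, if_false]; ring

/-- The formal increment `x + log (1 - x) + ∑ (B_n / n) (x ^ n - (x / (1 - x)) ^ n)` of the
asymptotic series of the harmonic numbers vanishes. -/
theorem harmonic_increment_isBigO (K : ℕ) (hK : 2 ≤ K) :
    (fun x : ℂ => x + Complex.log (1 - x) + ∑ n ∈ Finset.Icc 1 (K - 1),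
      ((bernoulli n : ℚ) : ℂ) / n * (x ^ n - x ^ n * ((1 - x) ^ n)⁻¹)) =O[𝓝 0]
      fun x : ℂ => ‖x‖ ^ K := by
  have h1 := log_one_sub_isBigO K
  have h2 : (fun x : ℂ => ∑ n ∈ Finset.Icc 1 (K - 1), ((bernoulli n : ℚ) : ℂ) / n *
      (x ^ n * ((1 - x) ^ n)⁻¹ - ∑ r ∈ Finset.Ico n K, ((r - 1).choose (n - 1) : ℂ) * x ^ r))
      =O[𝓝 0] fun x : ℂ => ‖x‖ ^ K := by
    refine IsBigO.fun_sum fun n hn => IsBigO.const_mul_left ?_ _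
    rw [Finset.mem_Icc] at hn
    exact inv_one_sub_pow_isBigO hn.1 (by omega)
  refine (h1.sub h2).congr_left fun x => ?_
  have hswap : ∑ n ∈ Finset.Icc 1 (K - 1), ((bernoulli n : ℚ) : ℂ) / n *
      ∑ r ∈ Finset.Ico n K, ((r - 1).choose (n - 1) : ℂ) * x ^ r =
      ∑ r ∈ Finset.Icc 1 (K - 1), ((bernoulli r : ℚ) / r + (if r = 1 then 1 else 0) - 1 / r) *
        x ^ r := by
    simp only [Finset.mul_sum]
    rw [Finset.sum_comm' (t' := Finset.Icc 1 (K - 1)) (s' := fun r => Finset.Icc 1 r)]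
    · refine Finset.sum_congr rfl fun r hr => ?_
      rw [← sum_bernoulli_div_mul_choose (Finset.mem_Icc.1 hr).1, Finset.sum_mul]
      exact Finset.sum_congr rfl fun n _ => by ring
    · intro n r
      simp only [Finset.mem_Icc, Finset.mem_Ico]
      omega
  have hrange : ∑ r ∈ Finset.range K, 1 / (r : ℂ) * x ^ r =
      ∑ r ∈ Finset.Icc 1 (K - 1), 1 / (r : ℂ) * x ^ r := by
    have : Finset.range K = insert 0 (Finset.Icc 1 (K - 1)) := by
      ext d; simp only [Finset.mem_range, Finset.mem_insert, Finset.mem_Icc]; omega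
    rw [this, Finset.sum_insert (by simp)]
    simp
  have hone : ∑ r ∈ Finset.Icc 1 (K - 1), (if r = 1 then 1 else 0) * x ^ r = x := by
    rw [Finset.sum_eq_single 1]
    · simp
    · intro b _ hb; simp [hb]
    · intro h; exact absurd (Finset.mem_Icc.2 ⟨le_rfl, by omega⟩) h
  simp only [mul_sub, Finset.sum_sub_distrib]
  rw [hswap, hrange]
  simp only [sub_mul, add_mul, Finset.sum_sub_distrib, Finset.sum_add_distrib]
  rw [hone]
  ring

/-- A null sequence with increments `O((m + 1) ^ (-(K + 1)))` is `O(m ^ (-K))`. -/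
theorem isBigO_of_increment {D : ℕ → ℂ} {K : ℕ} (hK : 1 ≤ K) (h0 : Tendsto D atTop (𝓝 0))
    (h : (fun m => D (m + 1) - D m) =O[atTop] fun m : ℕ => ((m : ℝ) + 1) ^ (-((K : ℤ) + 1))) :
    D =O[atTop] fun m : ℕ => (m : ℝ) ^ (-(K : ℤ)) := by
  obtain ⟨C, hC0, hC⟩ := h.exists_pos
  obtain ⟨m₀, hm₀⟩ := eventually_atTop.1 hC.bound
  -- The bounds of the increments telescope.
  have hstep : ∀ m : ℕ, 1 ≤ m → ((m : ℝ) + 1) ^ (-((K : ℤ) + 1)) ≤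
      (m : ℝ) ^ (-(K : ℤ)) - ((m : ℝ) + 1) ^ (-(K : ℤ)) := by
    intro m hm
    have hm' : (0 : ℝ) < m := by exact_mod_cast hm
    have hM : (0 : ℝ) < (m : ℝ) + 1 := by linarith
    have e1 : ((m : ℝ) + 1) ^ (-((K : ℤ) + 1)) = ((m : ℝ) + 1) ^ (-(K : ℤ)) * ((m : ℝ) + 1)⁻¹ := by
      rw [neg_add, zpow_add₀ hM.ne', zpow_neg_one]
    have e2 : (m : ℝ) ^ (-(K : ℤ)) = ((m : ℝ) + 1) ^ (-(K : ℤ)) * (((m : ℝ) + 1) / m) ^ K := by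
      rw [zpow_neg, zpow_neg, zpow_natCast, zpow_natCast, div_pow]
      field_simp
    have h1 : 1 ≤ ((m : ℝ) + 1) / m := by rw [le_div_iff₀ hm']; linarith
    have h2 : ((m : ℝ) + 1) / m ≤ (((m : ℝ) + 1) / m) ^ K := le_self_pow₀ h1 (by omega)
    have h3 : 1 + ((m : ℝ) + 1)⁻¹ ≤ ((m : ℝ) + 1) / m := by
      rw [add_div, div_self hm'.ne', add_le_add_iff_left, one_div]
      exact inv_anti₀ hm' (by linarith)
    have hp : 0 < ((m : ℝ) + 1) ^ (-(K : ℤ)) := zpow_pos hM _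
    rw [e1, e2]
    nlinarith
  have hbound : ∀ m : ℕ, max m₀ 1 ≤ m → ∀ j : ℕ, ‖D (m + j) - D m‖ ≤
      C * ((m : ℝ) ^ (-(K : ℤ)) - ((m + j : ℕ) : ℝ) ^ (-(K : ℤ))) := by
    intro m hm j
    induction j with
    | zero => simp
    | succ j ih =>
      have h1 := hm₀ (m + j) (le_trans (le_max_left _ _) (hm.trans (Nat.le_add_right _ _)))
      have h2 := hstep (m + j) (le_trans (le_max_right _ _) (hm.trans (Nat.le_add_right _ _)))
      have hpos : (0 : ℝ) ≤ (((m + j : ℕ) : ℝ) + 1) ^ (-((K : ℤ) + 1)) := by positivity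
      rw [Real.norm_of_nonneg hpos] at h1
      have h3 : ‖D (m + (j + 1)) - D m‖ ≤ ‖D (m + j + 1) - D (m + j)‖ + ‖D (m + j) - D m‖ := by
        have := norm_add_le (D (m + j + 1) - D (m + j)) (D (m + j) - D m)
        rw [sub_add_sub_cancel] at this
        exact this
      have h4 : ((m + (j + 1) : ℕ) : ℝ) = ((m + j : ℕ) : ℝ) + 1 := by push_cast; ring
      rw [h4]
      nlinarith
  refine IsBigO.of_bound C ?_
  filter_upwards [eventually_ge_atTop (max m₀ 1)] with m hm
  have hlim : Tendsto (fun j : ℕ => ‖D (m + j) - D m‖) atTop (𝓝 ‖0 - D m‖) :=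
    ((h0.comp (tendsto_add_atTop_nat m |>.congr fun j => Nat.add_comm j m)).sub_const (D m)).norm
  have := le_of_tendsto hlim (Eventually.of_forall fun j => (hbound m hm j).trans
    (mul_le_mul_of_nonneg_left (sub_le_self _ (by positivity)) hC0.le))
  rw [zero_sub, norm_neg] at this
  rwa [Real.norm_of_nonneg (by positivity)]

/-- The error of the asymptotic series of the harmonic numbers, stopped before order `K`. -/
noncomputable def harmonicError (K m : ℕ) : ℂ :=
  (harmonic m : ℂ) - (Real.log m : ℂ) - (Real.eulerMascheroniConstant : ℂ) +
    ∑ n ∈ Finset.Icc 1 (K - 1), ((bernoulli n : ℚ) : ℂ) / n * (m : ℂ) ^ (-(n : ℤ))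

theorem harmonicError_isBigO {K : ℕ} (hK : 1 ≤ K) :
    harmonicError K =O[atTop] fun m : ℕ => (m : ℝ) ^ (-(K : ℤ)) := by
  have hnat : Tendsto (fun m : ℕ => (m : ℂ)⁻¹) atTop (𝓝 0) :=
    tendsto_inv_atTop_nhds_zero_nat
  have hpow : ∀ n : ℕ, 1 ≤ n → Tendsto (fun m : ℕ => (m : ℂ) ^ (-(n : ℤ))) atTop (𝓝 0) := by
    intro n hn
    have := hnat.pow n
    rw [zero_pow (by omega)] at this
    refine this.congr fun m => ?_
    rw [zpow_neg, zpow_natCast, inv_pow]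
  -- Stopped one order later, the error still tends to `0`, and its increments are of order `K +
  -- 1`.
  have hlim : Tendsto (harmonicError (K + 1)) atTop (𝓝 0) := by
    have h1 : Tendsto (fun m : ℕ => (harmonic m : ℂ) - (Real.log m : ℂ) -
        (Real.eulerMascheroniConstant : ℂ)) atTop (𝓝 0) := by
      have h2 := (Complex.continuous_ofReal.tendsto _).comp
        (Real.tendsto_harmonic_sub_log.sub_const Real.eulerMascheroniConstant)
      rw [sub_self, Complex.ofReal_zero] at h2
      refine h2.congr fun m => ?_
      simp
    have h3 : Tendsto (fun m : ℕ => ∑ n ∈ Finset.Icc 1 (K + 1 - 1), ((bernoulli n : ℚ) : ℂ) / n *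
        (m : ℂ) ^ (-(n : ℤ))) atTop (𝓝 (∑ n ∈ Finset.Icc 1 (K + 1 - 1),
          ((bernoulli n : ℚ) : ℂ) / n * 0)) :=
      tendsto_finsetSum _ fun n hn => (hpow n (Finset.mem_Icc.1 hn).1).const_mul _
    have h4 := h1.add h3
    simp only [mul_zero, Finset.sum_const_zero, add_zero] at h4
    exact h4
  have hinc : (fun m => harmonicError (K + 1) (m + 1) - harmonicError (K + 1) m) =O[atTop]
      fun m : ℕ => ((m : ℝ) + 1) ^ (-((K : ℤ) + 1)) := by
    have hx : Tendsto (fun m : ℕ => ((m + 1 : ℕ) : ℂ)⁻¹) atTop (𝓝 0) :=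
      hnat.comp (tendsto_add_atTop_nat 1)
    refine ((harmonic_increment_isBigO (K + 1) (by omega)).comp_tendsto hx).congr' ?_ ?_
    · filter_upwards [eventually_ge_atTop 1] with m hm
      have hm0 : (m : ℂ) ≠ 0 := by exact_mod_cast (by omega : m ≠ 0)
      have hM0 : ((m + 1 : ℕ) : ℂ) ≠ 0 := by exact_mod_cast Nat.succ_ne_zero m
      have hmr : (0 : ℝ) < m := by exact_mod_cast hm
      -- With `x = 1 / (m + 1)` one has `1 / m = x / (1 - x)`.
      have e1 : 1 - ((m + 1 : ℕ) : ℂ)⁻¹ = (m : ℂ) / ((m + 1 : ℕ) : ℂ) := by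
        field_simp; push_cast; ring
      have elog : Complex.log (1 - ((m + 1 : ℕ) : ℂ)⁻¹) =
          (Real.log m : ℂ) - (Real.log (m + 1 : ℕ) : ℂ) := by
        rw [e1, ← Complex.ofReal_natCast, ← Complex.ofReal_natCast, ← Complex.ofReal_div,
          ← Complex.ofReal_log (by positivity), Real.log_div hmr.ne' (by positivity)]
        push_cast; rfl
      simp only [Function.comp_apply, harmonicError, harmonic_succ]
      rw [elog, e1]
      have hs : ∀ n : ℕ, (((m + 1 : ℕ) : ℂ)⁻¹ ^ n - ((m + 1 : ℕ) : ℂ)⁻¹ ^ n *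
          (((m : ℂ) / ((m + 1 : ℕ) : ℂ)) ^ n)⁻¹) =
          ((m + 1 : ℕ) : ℂ) ^ (-(n : ℤ)) - (m : ℂ) ^ (-(n : ℤ)) := by
        intro n
        rw [zpow_neg, zpow_neg, zpow_natCast, zpow_natCast, div_pow, inv_pow]
        congr 1
        field_simp
      simp only [hs, mul_sub, Finset.sum_sub_distrib]
      push_cast
      ring
    · filter_upwards with m
      simp only [Function.comp_apply]
      rw [norm_inv, Complex.norm_natCast, inv_pow, zpow_neg]
      push_cast
      norm_cast
  have h := isBigO_of_increment hK hlim hinc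
  have hlast : (fun m : ℕ => ((bernoulli K : ℚ) : ℂ) / K * (m : ℂ) ^ (-(K : ℤ))) =O[atTop]
      fun m : ℕ => (m : ℝ) ^ (-(K : ℤ)) :=
    IsBigO.const_mul_left (IsBigO.of_bound 1 (Eventually.of_forall fun m => by simp)) _
  refine (h.sub hlast).congr_left fun m => ?_
  have hIcc : Finset.Icc 1 (K + 1 - 1) = insert K (Finset.Icc 1 (K - 1)) := by
    ext d; simp only [Finset.mem_insert, Finset.mem_Icc]; omega
  rw [harmonicError, harmonicError, hIcc, Finset.sum_insert (by simp; omega)]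
  ring

theorem sum_inv_odd (m : ℕ) : (∑ j ∈ Finset.range m, 1 / (2 * (j : ℝ) + 1) : ℝ) =
    (harmonic (2 * m) : ℝ) - (harmonic m : ℝ) / 2 := by
  induction m with
  | zero => simp
  | succ m ih =>
    rw [Finset.sum_range_succ, ih, show 2 * (m + 1) = 2 * m + 1 + 1 by ring, harmonic_succ,
      harmonic_succ, harmonic_succ]
    push_cast
    field_simp
    ring

/-- `π / 4` times the coefficient of `m ^ (-n)` in the expansion of the diagonal values. -/
noncomputable def diagonalSeriesCoeff (n : ℕ) : ℂ :=
  ((bernoulli n : ℚ) : ℂ) / n * (1 / 2 - 1 / 2 ^ n)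

/-- The sum of the reciprocals of the odd numbers is `H_{2m} - H_m / 2`, so the expansion of the
harmonic numbers gives that of the diagonal values. -/
theorem diagonalValue_isBigO {K : ℕ} (hK : 1 ≤ K) :
    (fun m : ℕ => (diagonalValue m : ℂ) - 4 / Real.pi * (1 / 2 * (Real.log m : ℂ) +
      (Real.log 2 + Real.eulerMascheroniConstant / 2 : ℝ) +
      ∑ n ∈ Finset.Icc 1 (K - 1), diagonalSeriesCoeff n * (m : ℂ) ^ (-(n : ℤ)))) =O[atTop]
      fun m : ℕ => (m : ℝ) ^ (-(K : ℤ)) := by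
  have h1 := harmonicError_isBigO hK
  have hdouble : Tendsto (fun m : ℕ => 2 * m) atTop atTop :=
    tendsto_id.const_mul_atTop' (by norm_num)
  have h2 : (fun m : ℕ => harmonicError K (2 * m)) =O[atTop] fun m : ℕ => (m : ℝ) ^ (-(K : ℤ)) := by
    refine (h1.comp_tendsto hdouble).trans (IsBigO.of_bound ((2 : ℝ) ^ (-(K : ℤ)))
      (Eventually.of_forall fun m => ?_))
    simp only [Function.comp_apply, Nat.cast_mul, Nat.cast_ofNat, mul_zpow, norm_mul]
    rw [Real.norm_of_nonneg (by positivity)]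
  refine ((h2.sub (h1.const_mul_left (1 / 2))).const_mul_left (4 / Real.pi : ℂ)).congr' ?_
    EventuallyEq.rfl
  filter_upwards [eventually_ge_atTop 1] with m hm
  have hmr : (0 : ℝ) < m := by exact_mod_cast hm
  have hlog : Real.log ((2 * m : ℕ) : ℝ) = Real.log 2 + Real.log m := by
    push_cast
    exact Real.log_mul two_ne_zero hmr.ne'
  rw [diagonalValue, sum_inv_odd, harmonicError, harmonicError, hlog]
  have hs : ∀ n : ℕ, diagonalSeriesCoeff n * (m : ℂ) ^ (-(n : ℤ)) =
      1 / 2 * (((bernoulli n : ℚ) : ℂ) / n * (m : ℂ) ^ (-(n : ℤ))) -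
        ((bernoulli n : ℚ) : ℂ) / n * ((2 * m : ℕ) : ℂ) ^ (-(n : ℤ)) := by
    intro n
    rw [diagonalSeriesCoeff, Nat.cast_mul, mul_zpow, zpow_neg (((2 : ℕ) : ℂ)), zpow_natCast]
    push_cast
    ring
  simp only [hs, Finset.sum_sub_distrib, ← Finset.mul_sum]
  push_cast
  ring

/-! ### The integrand in a sector -/

/-- The logarithm of `exp (2 i p arctan t) * ((1 - t) / (1 + t)) ^ q` as a function of `t`, with
`w = 2 (q - i p)`. -/
noncomputable def tanExponent (w : ℂ) (t : ℝ) : ℂ :=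
  -(Complex.I * w.im * Real.arctan t) - w.re * (1 / 2 * (Real.log (1 + t) - Real.log (1 - t)) : ℝ)

/-- The coefficient of `-t ^ (2 k + 1) / (2 k + 1)` in `tanExponent w t`: alternately `w` and its
conjugate. -/
noncomputable def tanExponentCoeff (w : ℂ) (k : ℕ) : ℂ :=
  if Even k then w else (starRingEnd ℂ) w

theorem norm_tanExponentCoeff (w : ℂ) (k : ℕ) : ‖tanExponentCoeff w k‖ = ‖w‖ := by
  rw [tanExponentCoeff]; split_ifs <;> simp

theorem tanExponentCoeff_eq (w : ℂ) (k : ℕ) :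
    tanExponentCoeff w k = w.re + Complex.I * w.im * (-1) ^ k := by
  rw [tanExponentCoeff]
  split_ifs with h
  · rw [h.neg_one_pow]
    apply Complex.ext <;> simp
  · rw [(Nat.not_even_iff_odd.1 h).neg_one_pow]
    apply Complex.ext <;> simp

/-- The remainder of the power series of the exponent, from those of the arctangent and of `log (1
+ t) - log (1 - t)`. -/
theorem norm_tanExponent_add_sum_le (w : ℂ) (K : ℕ) {t : ℝ} (ht : 0 ≤ t) (ht' : t ≤ 1 / 2) :
    ‖tanExponent w t + ∑ k ∈ Finset.range K,
      tanExponentCoeff w k * (t : ℂ) ^ (2 * k + 1) / (2 * k + 1)‖ ≤ 2 * ‖w‖ * t ^ (2 * K + 1) := by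
  have ht1 : |t| < 1 := by rw [abs_of_nonneg ht]; linarith
  have h1 := (Complex.hasSum_ofReal.2 (Real.hasSum_arctan (x := t) ht1)).mul_left
    (Complex.I * w.im)
  have h2 := (Complex.hasSum_ofReal.2 ((Real.hasSum_log_sub_log_of_abs_lt_one ht1).mul_left
    (1 / 2))).mul_left (w.re : ℂ)
  have h3 : HasSum (fun k : ℕ => tanExponentCoeff w k * (t : ℂ) ^ (2 * k + 1) / (2 * k + 1))
      (-tanExponent w t) := by
    have e : -tanExponent w t = Complex.I * w.im * Real.arctan t +
        w.re * (1 / 2 * (Real.log (1 + t) - Real.log (1 - t)) : ℝ) := by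
      rw [tanExponent]; ring
    rw [e]
    refine (h1.add h2).congr_fun fun k => ?_
    rw [tanExponentCoeff_eq]
    push_cast
    ring
  rw [← norm_neg, neg_add']
  have h4 := (hasSum_nat_add_iff' K).2 h3
  have hg : HasSum (fun k : ℕ => ‖w‖ * t ^ (2 * K + 1) * (1 / 2) ^ k)
      (‖w‖ * t ^ (2 * K + 1) * 2) := hasSum_geometric_two.mul_left _
  refine (h4.norm_le_of_bounded hg fun k => ?_).trans (le_of_eq (by ring))
  · rw [norm_div, norm_mul, norm_tanExponentCoeff, norm_pow, Complex.norm_real,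
      Real.norm_of_nonneg ht]
    have hd : (1 : ℝ) ≤ ‖(2 * ((k + K : ℕ) : ℂ) + 1)‖ := by
      have : (2 * ((k + K : ℕ) : ℂ) + 1) = ((2 * (k + K) + 1 : ℕ) : ℂ) := by push_cast; ring
      rw [this, Complex.norm_natCast]
      exact_mod_cast Nat.le_add_left 1 _
    have e : t ^ (2 * (k + K) + 1) = t ^ (2 * K + 1) * (t ^ 2) ^ k := by
      rw [← pow_mul, ← pow_add]; congr 1; ring
    rw [e, mul_assoc]
    have hp : (t ^ 2) ^ k ≤ (1 / 2) ^ k := pow_le_pow_left₀ (by positivity) (by nlinarith) k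
    refine (div_le_self (by positivity) hd).trans ?_
    gcongr

theorem norm_exp_sub_exp_le {a b : ℂ} {s : ℝ} (ha : a.re ≤ s) (hb : b.re ≤ s) :
    ‖Complex.exp a - Complex.exp b‖ ≤ Real.exp s * ‖a - b‖ :=
  (convex_halfSpace_re_le s).norm_image_sub_le_of_norm_hasDerivWithin_le
    (fun x _ => (Complex.hasDerivAt_exp x).hasDerivWithinAt)
    (fun x hx => by rw [Complex.norm_exp]; exact Real.exp_le_exp.2 hx) hb ha

/-- The part of orders `3, 5, …, 2 K - 1` in `t` of `tanExponent w t`. -/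
noncomputable def exponentCorrection (K : ℕ) (w : ℂ) (t : ℝ) : ℂ :=
  -∑ k ∈ Finset.Ico 1 K, tanExponentCoeff w k * (t : ℂ) ^ (2 * k + 1) / (2 * k + 1)

theorem norm_exponentCorrection_le (K : ℕ) (w : ℂ) {t : ℝ} (ht : 0 ≤ t) (ht' : t ≤ 1) :
    ‖exponentCorrection K w t‖ ≤ K * (‖w‖ * t ^ 3) := by
  rw [exponentCorrection, norm_neg]
  refine (norm_sum_le_of_le (f := fun k : ℕ =>
    tanExponentCoeff w k * (t : ℂ) ^ (2 * k + 1) / (2 * k + 1)) _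
    (n := fun _ => ‖w‖ * t ^ 3) fun k hk => ?_).trans ?_
  · rw [norm_div, norm_mul, norm_tanExponentCoeff, norm_pow, Complex.norm_real,
      Real.norm_of_nonneg ht]
    have hd : (1 : ℝ) ≤ ‖(2 * (k : ℂ) + 1)‖ := by
      have : (2 * (k : ℂ) + 1) = ((2 * k + 1 : ℕ) : ℂ) := by push_cast; ring
      rw [this, Complex.norm_natCast]
      exact_mod_cast Nat.le_add_left 1 _
    refine (div_le_self (by positivity) hd).trans ?_
    have := (Finset.mem_Ico.1 hk).1
    exact mul_le_mul_of_nonneg_left (pow_le_pow_of_le_one ht ht' (by omega)) (norm_nonneg _)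
  · rw [Finset.sum_const, nsmul_eq_mul, Nat.card_Ico]
    gcongr
    omega

theorem tanExponent_re_le {w : ℂ} (hw : 0 ≤ w.re) {t : ℝ} (ht : 0 ≤ t) (ht' : t < 1) :
    (tanExponent w t).re ≤ -(w.re * t) := by
  have h : (tanExponent w t).re = -(w.re * (1 / 2 * (Real.log (1 + t) - Real.log (1 - t)))) := by
    have : tanExponent w t = ((-(w.re * (1 / 2 * (Real.log (1 + t) - Real.log (1 - t)))) : ℝ) : ℂ) +
      ((-(w.im * Real.arctan t) : ℝ) : ℂ) * Complex.I := by
      rw [tanExponent]; push_cast; ring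
    rw [this, Complex.add_re, Complex.ofReal_re, Complex.re_ofReal_mul, Complex.I_re]
    ring
  rw [h]
  have hs := Real.hasSum_log_sub_log_of_abs_lt_one (x := t) (by rwa [abs_of_nonneg ht])
  have := sum_le_hasSum {0} (fun k _ => by positivity) hs
  norm_num at this
  nlinarith

/-- Uniformly in `0 < t < 1` and for `w` in a sector around the positive axis,
`exp (tanExponent w t)` is `exp (-w t)` times a polynomial in `w`, its conjugate and `t`, up to an
error that is small after integration because it has twice as many powers of `t` as of `w`. -/
theorem exists_norm_exp_tanExponent_sub_le {K : ℕ} (hK : 1 ≤ K) :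
    ∃ C : ℝ, ∀ w : ℂ, 1 ≤ ‖w‖ → ‖w‖ ≤ 4 * w.re → ∀ t ∈ Set.Ioo (0 : ℝ) 1,
      ‖Complex.exp (tanExponent w t) - Complex.exp (-(w * t)) *
        ∑ j ∈ Finset.range K, exponentCorrection K w t ^ j / (j.factorial : ℂ)‖ ≤
      C * (‖w‖ ^ K * (t ^ (2 * K) * Real.exp (-(‖w‖ / 8 * t)))) := by
  have hK' : (1 : ℝ) ≤ K := by exact_mod_cast hK
  refine ⟨(2 + (K : ℝ) ^ K) + (1 + (K : ℝ) ^ (K + 1)) * (4 * K) ^ (2 * K), ?_⟩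
  rintro w hr hsec t ⟨ht0, ht1⟩
  set u := exponentCorrection K w t
  set r := ‖w‖
  set P := ∑ j ∈ Finset.range K, u ^ j / (j.factorial : ℂ)
  have hu : ‖u‖ ≤ K * (r * t ^ 3) := norm_exponentCorrection_le K w ht0.le ht1.le
  have hre : (tanExponent w t).re ≤ -(r / 4 * t) :=
    (tanExponent_re_le (by linarith) ht0.le ht1).trans (by nlinarith)
  have hre' : (-(w * t)).re ≤ -(r / 4 * t) := by
    rw [Complex.neg_re, Complex.re_mul_ofReal]; nlinarith
  have hrt : 0 ≤ r * t := by positivity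
  have hrK : r ≤ r ^ K := le_self_pow₀ hr (by omega)
  have he8 : Real.exp (-(r / 4 * t)) ≤ Real.exp (-(r / 8 * t)) :=
    Real.exp_le_exp.2 (by nlinarith)
  have hC1 : (0 : ℝ) ≤ (2 + (K : ℝ) ^ K) := by positivity
  have hC2 : (0 : ℝ) ≤ (1 + (K : ℝ) ^ (K + 1)) * (4 * K) ^ (2 * K) := by positivity
  have hQ : 0 ≤ r ^ K * (t ^ (2 * K) * Real.exp (-(r / 8 * t))) := by positivity
  -- For small `t` the correction `u` is dominated by half of the decay `exp (-‖w‖ t / 4)`; for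
  -- other `t` the power `t ^ (2 K)` is bounded below.
  rcases le_total t (1 / (4 * K)) with ht | ht
  · refine le_trans ?_ (mul_le_mul_of_nonneg_right (le_add_of_nonneg_right hC2) hQ)
    have ht4 : t ≤ 1 / 4 := ht.trans (by
      apply one_div_le_one_div_of_le <;> linarith)
    have htK : K * t ≤ 1 / 4 := by
      have := mul_le_mul_of_nonneg_left ht (by positivity : (0 : ℝ) ≤ K)
      refine this.trans (le_of_eq ?_)
      field_simp
    have hu8 : ‖u‖ ≤ r / 8 * t := by
      refine hu.trans ?_
      have : K * (r * t ^ 3) = (r * t) * ((K * t) * t) := by ring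
      rw [this]
      nlinarith [mul_le_mul htK ht4 ht0.le (by norm_num)]
    have hb : (-(w * t) + u).re ≤ -(r / 8 * t) := by
      rw [Complex.add_re]
      have := (Complex.re_le_norm u).trans hu8
      linarith
    -- The linear term of the exponent is `-w t`, and `u` consists of the other terms of degree at
    -- most `2 K - 1`.
    have hsum : tanExponent w t - (-(w * t) + u) = tanExponent w t + ∑ k ∈ Finset.range K,
        tanExponentCoeff w k * (t : ℂ) ^ (2 * k + 1) / (2 * k + 1) := by
      rw [Finset.range_eq_Ico, Finset.sum_eq_sum_Ico_succ_bot (by omega)]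
      simp only [u, exponentCorrection, tanExponentCoeff]
      simp
      ring
    have h1 : ‖Complex.exp (tanExponent w t) - Complex.exp (-(w * t) + u)‖ ≤
        Real.exp (-(r / 8 * t)) * (2 * r * t ^ (2 * K + 1)) := by
      refine (norm_exp_sub_exp_le (hre.trans ?_) hb).trans ?_
      · nlinarith
      · rw [hsum]
        gcongr
        exact norm_tanExponent_add_sum_le w K ht0.le (by linarith)
    have h2 : ‖Complex.exp (-(w * t)) * (Complex.exp u - P)‖ ≤
        Real.exp (-(r / 8 * t)) * (K * (r * t ^ 3)) ^ K := by
      rw [norm_mul, Complex.norm_exp]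
      calc _ ≤ Real.exp (-(r / 4 * t)) * ((K * (r * t ^ 3)) ^ K * Real.exp (r / 8 * t)) := by
            gcongr
            exact (Complex.norm_exp_sub_sum_le_norm_mul_exp u K).trans (by gcongr)
        _ = _ := by
            have : Real.exp (-(r / 8 * t)) = Real.exp (-(r / 4 * t)) * Real.exp (r / 8 * t) := by
              rw [← Real.exp_add]; congr 1; ring
            rw [this]; ring
    have e : Complex.exp (tanExponent w t) - Complex.exp (-(w * t)) * P =
        (Complex.exp (tanExponent w t) - Complex.exp (-(w * t) + u)) +
          Complex.exp (-(w * t)) * (Complex.exp u - P) := by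
      rw [Complex.exp_add]; ring
    rw [e]
    refine (norm_add_le_of_le h1 h2).trans ?_
    have h3 : 2 * r * t ^ (2 * K + 1) ≤ 2 * (r ^ K * t ^ (2 * K)) := by
      rw [mul_assoc]
      have := pow_le_pow_of_le_one ht0.le ht1.le (by omega : 2 * K ≤ 2 * K + 1)
      gcongr
    have h4 : (K * (r * t ^ 3)) ^ K ≤ (K : ℝ) ^ K * (r ^ K * t ^ (2 * K)) := by
      rw [mul_pow, mul_pow, ← pow_mul]
      gcongr _ * (_ * ?_)
      exact pow_le_pow_of_le_one ht0.le ht1.le (by omega)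
    calc _ ≤ Real.exp (-(r / 8 * t)) * (2 * (r ^ K * t ^ (2 * K))) +
          Real.exp (-(r / 8 * t)) * ((K : ℝ) ^ K * (r ^ K * t ^ (2 * K))) := by gcongr
      _ = _ := by ring
  · refine le_trans ?_ (mul_le_mul_of_nonneg_right (le_add_of_nonneg_left hC1) hQ)
    have hP : ‖P‖ ≤ K * (K * r) ^ K := by
      refine (norm_sum_le_of_le (f := fun j : ℕ => u ^ j / (j.factorial : ℂ)) _
        (n := fun _ => (K * r) ^ K) fun j hj => ?_).trans ?_
      · rw [norm_div, norm_pow, Complex.norm_natCast]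
        have hf : (1 : ℝ) ≤ (j.factorial : ℝ) := by exact_mod_cast j.factorial_pos
        refine (div_le_self (by positivity) hf).trans ?_
        have hu' : ‖u‖ ≤ K * r := hu.trans (by
          gcongr
          exact mul_le_of_le_one_right (by positivity) (pow_le_one₀ ht0.le ht1.le))
        refine (pow_le_pow_left₀ (norm_nonneg _) hu' j).trans ?_
        exact pow_le_pow_right₀ (by nlinarith) (Finset.mem_range.1 hj).le
      · rw [Finset.sum_const, nsmul_eq_mul, Finset.card_range]
    have hf : ‖Complex.exp (tanExponent w t)‖ ≤ Real.exp (-(r / 8 * t)) * r ^ K := by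
      rw [Complex.norm_exp]
      refine ((Real.exp_le_exp.2 hre).trans he8).trans ?_
      exact le_mul_of_one_le_right (by positivity) (one_le_pow₀ hr)
    have hg : ‖Complex.exp (-(w * t)) * P‖ ≤ Real.exp (-(r / 8 * t)) * (K * (K * r) ^ K) := by
      rw [norm_mul, Complex.norm_exp]
      gcongr
      linarith [hre', mul_nonneg (by linarith : 0 ≤ r / 8) ht0.le]
    refine (norm_sub_le_of_le hf hg).trans ?_
    have ht2 : 1 ≤ (4 * K) ^ (2 * K) * t ^ (2 * K) := by
      rw [← mul_pow]
      refine one_le_pow₀ ?_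
      rw [div_le_iff₀ (by positivity)] at ht
      linarith
    calc _ = Real.exp (-(r / 8 * t)) * ((1 + (K : ℝ) ^ (K + 1)) * r ^ K) * 1 := by
          rw [mul_pow]; ring
      _ ≤ Real.exp (-(r / 8 * t)) * ((1 + (K : ℝ) ^ (K + 1)) * r ^ K) *
          ((4 * K) ^ (2 * K) * t ^ (2 * K)) := by gcongr
      _ = _ := by ring

/-! ### Expansions in a sector -/

/-- The filter `w → ∞` in the sector `‖w‖ ≤ 4 Re w`. -/
noncomputable def sectorFilter : Filter ℂ := Bornology.cobounded ℂ ⊓ 𝓟 {w : ℂ | ‖w‖ ≤ 4 * w.re}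

theorem eventually_sectorFilter (R : ℝ) : ∀ᶠ w in sectorFilter, R ≤ ‖w‖ ∧ ‖w‖ ≤ 4 * w.re := by
  have h1 : ∀ᶠ w in sectorFilter, R ≤ ‖w‖ :=
    ((tendsto_norm_cobounded_atTop (E := ℂ)).eventually_ge_atTop R).filter_mono inf_le_left
  have h2 : ∀ᶠ w in sectorFilter, ‖w‖ ≤ 4 * w.re :=
    (eventually_principal.2 fun w hw => hw : ∀ᶠ w in 𝓟 {w : ℂ | ‖w‖ ≤ 4 * w.re}, _).filter_mono
      inf_le_right
  exact h1.and h2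

theorem exp_neg_mul_norm_isBigO {c : ℝ} (hc : 0 < c) (K : ℤ) :
    (fun w : ℂ => Real.exp (-(c * ‖w‖))) =O[sectorFilter] fun w : ℂ => ‖w‖ ^ K := by
  have h := ((isLittleO_exp_neg_mul_rpow_atTop hc (K : ℝ)).isBigO.comp_tendsto
    (tendsto_norm_cobounded_atTop (E := ℂ))).mono (inf_le_left : sectorFilter ≤ _)
  refine h.congr (fun w => ?_) (fun w => ?_)
  · simp
  · simp [Real.rpow_intCast]

/-- The function `f` has an expansion without logarithm up to order `K` in the sector. -/
def HasOrderExpansion (K : ℕ) (f : ℂ → ℂ) : Prop :=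
  ∃ c : ℕ → ℤ →₀ ℂ, (fun w => f w - ∑ n ∈ Finset.range K, evalOrder n w (c n))
    =O[sectorFilter] fun w => ‖w‖ ^ (-(K : ℤ))

namespace HasOrderExpansion

variable {K : ℕ} {f g : ℂ → ℂ}

theorem of_isBigO (h : f =O[sectorFilter] fun w => ‖w‖ ^ (-(K : ℤ))) : HasOrderExpansion K f :=
  ⟨0, by simpa using h⟩

theorem add (hf : HasOrderExpansion K f) (hg : HasOrderExpansion K g) :
    HasOrderExpansion K (fun w => f w + g w) := by
  obtain ⟨c, hc⟩ := hf
  obtain ⟨d, hd⟩ := hg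
  refine ⟨c + d, (hc.add hd).congr_left fun w => ?_⟩
  simp only [Pi.add_apply, map_add, Finset.sum_add_distrib]
  ring

theorem const_mul (hf : HasOrderExpansion K f) (a : ℂ) :
    HasOrderExpansion K (fun w => a * f w) := by
  obtain ⟨c, hc⟩ := hf
  refine ⟨a • c, (hc.const_mul_left a).congr_left fun w => ?_⟩
  simp only [Pi.smul_apply, map_smul, smul_eq_mul, mul_sub, Finset.mul_sum]

theorem congr' (hf : HasOrderExpansion K f) (h : f =ᶠ[sectorFilter] g) :
    HasOrderExpansion K g := by
  obtain ⟨c, hc⟩ := hf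
  exact ⟨c, hc.congr' (h.mono fun w hw => by simp only [hw]) EventuallyEq.rfl⟩

theorem add_isBigO (hf : HasOrderExpansion K f)
    (h : (fun w => g w - f w) =O[sectorFilter] fun w => ‖w‖ ^ (-(K : ℤ))) :
    HasOrderExpansion K g :=
  (hf.add (of_isBigO h)).congr' (Eventually.of_forall fun w => by simp)

theorem homogeneousTerm (n : ℕ) (m : ℤ) :
    HasOrderExpansion K (homogeneousTerm n m) := by
  by_cases hn : n < K
  · refine ⟨fun k => if k = n then Finsupp.single m 1 else 0, ?_⟩
    refine (isBigO_zero _ _).congr_left fun w => ?_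
    rw [Finset.sum_eq_single_of_mem n (Finset.mem_range.2 hn) fun b _ hb => by simp [hb]]
    simp [evalOrder_single]
  · refine of_isBigO (((isBigO_evalOrder n (Finsupp.single m 1) (not_lt.1 hn)).mono
      inf_le_left).congr_left fun w => ?_)
    simp [evalOrder_single]

theorem const (a : ℂ) : HasOrderExpansion K (fun _ => a) :=
  ((homogeneousTerm 0 0).const_mul a).congr' (Eventually.of_forall fun w => by
    simp [_root_.homogeneousTerm])

end HasOrderExpansion

theorem conj_homogeneousTerm (n : ℕ) (m : ℤ) {w : ℂ} (hw : w ≠ 0) :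
    (starRingEnd ℂ) (homogeneousTerm n m w) = homogeneousTerm n (-m) w := by
  have hn : (‖w‖ : ℂ) ≠ 0 := by exact_mod_cast norm_ne_zero_iff.2 hw
  have hc : (starRingEnd ℂ) w = w⁻¹ * (‖w‖ : ℂ) ^ (2 : ℤ) := by
    rw [eq_inv_mul_iff_mul_eq₀ hw, Complex.mul_conj, Complex.normSq_eq_norm_sq]; push_cast; rfl
  rw [homogeneousTerm, homogeneousTerm, map_mul, map_zpow₀, map_zpow₀, Complex.conj_ofReal, hc,
    mul_zpow, inv_zpow', ← zpow_mul, mul_assoc, ← zpow_add₀ hn]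
  congr 2
  ring

theorem exists_conj_evalOrder (n : ℕ) (c : ℤ →₀ ℂ) : ∃ d : ℤ →₀ ℂ, ∀ w : ℂ, w ≠ 0 →
    (starRingEnd ℂ) (evalOrder n w c) = evalOrder n w d := by
  induction c using Finsupp.induction_linear with
  | zero => exact ⟨0, by simp⟩
  | add f g hf hg =>
    obtain ⟨d, hd⟩ := hf
    obtain ⟨e, he⟩ := hg
    exact ⟨d + e, fun w hw => by rw [map_add, map_add, hd w hw, he w hw, map_add]⟩
  | single m a =>
    refine ⟨Finsupp.single (-m) ((starRingEnd ℂ) a), fun w hw => ?_⟩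
    rw [evalOrder_single, evalOrder_single, map_mul, conj_homogeneousTerm n m hw]

theorem HasOrderExpansion.conj {K : ℕ} {f : ℂ → ℂ} (hf : HasOrderExpansion K f) :
    HasOrderExpansion K (fun w => (starRingEnd ℂ) (f w)) := by
  obtain ⟨c, hc⟩ := hf
  choose d hd using fun n => exists_conj_evalOrder n (c n)
  refine ⟨d, IsBigO.congr' (f₁ := fun w => (starRingEnd ℂ)
    (f w - ∑ n ∈ Finset.range K, evalOrder n w (c n))) ?_ ?_ EventuallyEq.rfl⟩
  · exact (isBigO_of_le _ fun w => (RCLike.norm_conj _).le).trans hc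
  · filter_upwards [eventually_sectorFilter 1] with w hw
    have hw0 : w ≠ 0 := norm_pos_iff.1 (by linarith [hw.1])
    rw [map_sub, map_sum]
    exact congrArg _ (Finset.sum_congr rfl fun n _ => hd n w hw0)

theorem HasOrderExpansion.re {K : ℕ} {f : ℂ → ℂ} (hf : HasOrderExpansion K f) :
    HasOrderExpansion K (fun w => ((f w).re : ℂ)) :=
  ((hf.add hf.conj).const_mul (1 / 2)).congr' (Eventually.of_forall fun w => by
    simp only [Complex.re_eq_add_conj]; ring)

/-- The Laplace integrals of monomials are homogeneous terms. -/
theorem pow_mul_conj_pow_div_pow {w : ℂ} (hw : w ≠ 0) {i j b : ℕ} (h : i + j ≤ b) :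
    w ^ i * (starRingEnd ℂ) w ^ j / w ^ b =
      homogeneousTerm (b - (i + j)) ((i : ℤ) - j - b) w := by
  have hn : (‖w‖ : ℂ) ≠ 0 := by exact_mod_cast norm_ne_zero_iff.2 hw
  have hc : (starRingEnd ℂ) w = w⁻¹ * (‖w‖ : ℂ) ^ (2 : ℤ) := by
    rw [eq_inv_mul_iff_mul_eq₀ hw, Complex.mul_conj, Complex.normSq_eq_norm_sq]; push_cast; rfl
  rw [hc, homogeneousTerm, mul_pow, ← zpow_natCast, ← zpow_natCast, ← zpow_natCast,
    ← zpow_natCast, inv_zpow', ← zpow_mul, ← mul_assoc, ← zpow_add₀ hw, mul_div_right_comm,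
    ← zpow_sub₀ hw]
  congr 2
  push_cast [h]
  ring

/-! ### Laplace integrals of monomials -/

/-- The integral over `[0, 1]` agrees with that over `[0, ∞)` up to an exponentially small error;
by induction on `b`, with integration by parts. -/
theorem exists_norm_integral_pow_mul_exp_sub_le (b : ℕ) : ∃ C : ℝ, ∀ w : ℂ, 1 ≤ ‖w‖ →
    ‖w‖ ≤ 4 * w.re → ‖(∫ t in (0 : ℝ)..1, (t : ℂ) ^ b * Complex.exp (-(w * t))) -
      b.factorial / w ^ (b + 1)‖ ≤ C * Real.exp (-(1 / 4 * ‖w‖)) := by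
  have hexp : ∀ w : ℂ, ‖w‖ ≤ 4 * w.re → ‖Complex.exp (-w)‖ ≤ Real.exp (-(1 / 4 * ‖w‖)) :=
    fun w hw => by
      rw [Complex.norm_exp, Complex.neg_re]
      exact Real.exp_le_exp.2 (by linarith)
  have hint : ∀ (b : ℕ) (w : ℂ), IntervalIntegrable
      (fun t : ℝ => (t : ℂ) ^ b * Complex.exp (-(w * t))) MeasureTheory.volume 0 1 :=
    fun b w => Continuous.intervalIntegrable (by fun_prop) _ _
  have hder : ∀ (b : ℕ) (w : ℂ) (t : ℝ),
      HasDerivAt (fun t : ℝ => (t : ℂ) ^ b * Complex.exp (-(w * t)))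
        (b * (t : ℂ) ^ (b - 1) * Complex.exp (-(w * t)) -
          w * ((t : ℂ) ^ b * Complex.exp (-(w * t)))) t := by
    intro b w t
    have h1 : HasDerivAt (fun z : ℂ => z ^ b * Complex.exp (-(w * z)))
        (b * (t : ℂ) ^ (b - 1) * Complex.exp (-(w * t)) +
          (t : ℂ) ^ b * (Complex.exp (-(w * t)) * -(w * 1))) (t : ℂ) :=
      (hasDerivAt_pow b (t : ℂ)).mul ((((hasDerivAt_id (t : ℂ)).const_mul w).neg).cexp)
    convert h1.comp_ofReal using 1
    ring
  induction b with
  | zero =>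
    refine ⟨1, fun w hw hs => ?_⟩
    have hw0 : w ≠ 0 := norm_pos_iff.1 (by linarith)
    have h := intervalIntegral.integral_eq_sub_of_hasDerivAt (a := 0) (b := 1)
      (fun t _ => hder 0 w t) (Continuous.intervalIntegrable (by fun_prop) _ _)
    simp only [Nat.cast_zero, zero_mul, zero_sub, intervalIntegral.integral_neg,
      intervalIntegral.integral_const_mul] at h
    simp only [pow_zero, one_mul, Complex.ofReal_one, mul_one, Complex.ofReal_zero, mul_zero,
      neg_zero, Complex.exp_zero] at h
    have e : (∫ t in (0 : ℝ)..1, (t : ℂ) ^ 0 * Complex.exp (-(w * t))) -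
        (0 : ℕ).factorial / w ^ (0 + 1) = -Complex.exp (-w) / w := by
      simp only [pow_zero, one_mul, zero_add, pow_one, Nat.factorial_zero, Nat.cast_one]
      field_simp
      linear_combination -h
    rw [e, norm_div, norm_neg, one_mul]
    exact (div_le_self (norm_nonneg _) hw).trans (hexp w hs)
  | succ b ih =>
    obtain ⟨C, hC⟩ := ih
    refine ⟨(b + 1) * C + 1, fun w hw hs => ?_⟩
    have hw0 : w ≠ 0 := norm_pos_iff.1 (by linarith)
    have h := intervalIntegral.integral_eq_sub_of_hasDerivAt (a := 0) (b := 1)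
      (fun t _ => hder (b + 1) w t) (Continuous.intervalIntegrable (by fun_prop) _ _)
    rw [intervalIntegral.integral_sub (Continuous.intervalIntegrable (by fun_prop) _ _)
      (Continuous.intervalIntegrable (by fun_prop) _ _)] at h
    simp only [mul_assoc, intervalIntegral.integral_const_mul, Nat.add_sub_cancel] at h
    simp only [one_pow, one_mul, Complex.ofReal_one, mul_one, Complex.ofReal_zero, mul_zero,
      neg_zero, Complex.exp_zero, ne_eq, Nat.add_eq_zero_iff, one_ne_zero, and_false,
      not_false_eq_true, zero_pow, sub_zero] at h
    set I := ∫ t in (0 : ℝ)..1, (t : ℂ) ^ b * Complex.exp (-(w * t))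
    set J := ∫ t in (0 : ℝ)..1, (t : ℂ) ^ (b + 1) * Complex.exp (-(w * t))
    have e : J - (b + 1).factorial / w ^ (b + 1 + 1) =
        ((b + 1) * (I - b.factorial / w ^ (b + 1)) - Complex.exp (-w)) / w := by
      rw [eq_div_iff hw0, Nat.factorial_succ]
      push_cast at h ⊢
      have : w ^ (b + 1 + 1) = w ^ (b + 1) * w := pow_succ _ _
      rw [this]
      field_simp
      linear_combination (-w ^ (b + 1)) * h
    rw [e, norm_div]
    refine (div_le_self (norm_nonneg _) hw).trans ((norm_sub_le _ _).trans ?_)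
    rw [norm_mul, add_mul, one_mul, mul_assoc]
    refine add_le_add ?_ (hexp w hs)
    have hb : ‖((b : ℂ) + 1)‖ = b + 1 := by
      have : ((b : ℂ) + 1) = ((b + 1 : ℕ) : ℂ) := by push_cast; rfl
      rw [this, Complex.norm_natCast]; push_cast; rfl
    rw [hb]
    exact mul_le_mul_of_nonneg_left (hC w hw hs) (by positivity)

theorem isBigO_of_le_exp {f : ℂ → ℂ} {C c : ℝ} (hc : 0 < c) (K : ℤ)
    (h : ∀ w : ℂ, 1 ≤ ‖w‖ → ‖w‖ ≤ 4 * w.re → ‖f w‖ ≤ C * Real.exp (-(c * ‖w‖))) :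
    f =O[sectorFilter] fun w => ‖w‖ ^ K := by
  refine (IsBigO.of_bound C ?_ : f =O[sectorFilter] fun w => Real.exp (-(c * ‖w‖))).trans
    (exp_neg_mul_norm_isBigO hc K)
  filter_upwards [eventually_sectorFilter 1] with w hw
  rw [Real.norm_of_nonneg (Real.exp_pos _).le]
  exact h w hw.1 hw.2

/-- The functions `w ^ i * conj w ^ j * t ^ b` with at least two more powers of `t` than of `w` and
`conj w`, as in the exponent after its linear term. Their span is closed under products, and
contains no constant, so that the division by `t` in the Laplace integrals is harmless. -/
def laplaceMonomials : Set (ℂ → ℝ → ℂ) :=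
  {g | ∃ i j b : ℕ, i + j + 2 ≤ b ∧
    g = fun w (t : ℝ) => w ^ i * (starRingEnd ℂ) w ^ j * (t : ℂ) ^ b}

theorem mul_mem_span_laplaceMonomials {f g : ℂ → ℝ → ℂ}
    (hf : f ∈ Submodule.span ℂ laplaceMonomials) (hg : g ∈ Submodule.span ℂ laplaceMonomials) :
    f * g ∈ Submodule.span ℂ laplaceMonomials := by
  have h := Submodule.mul_mem_mul hf hg
  rw [Submodule.span_mul_span] at h
  refine Submodule.span_mono ?_ h
  rintro _ ⟨f, ⟨i, j, b, hb, rfl⟩, g, ⟨i', j', b', hb', rfl⟩, rfl⟩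
  refine ⟨i + i', j + j', b + b', by omega, ?_⟩
  funext w t
  simp only [Pi.mul_apply, pow_add]
  ring

/-- By linearity from the monomials, where the power of `t` exceeds that of `w` so that the
resulting homogeneous term has nonnegative order. -/
theorem laplace_of_mem_span (K : ℕ) {g : ℂ → ℝ → ℂ}
    (hg : g ∈ Submodule.span ℂ laplaceMonomials) :
    (∀ w, IntervalIntegrable (fun t : ℝ => Complex.exp (-(w * t)) * g w t / t)
      MeasureTheory.volume 0 1) ∧
    HasOrderExpansion K
      (fun w => ∫ t in (0 : ℝ)..1, Complex.exp (-(w * t)) * g w t / t) := by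
  induction hg using Submodule.span_induction with
  | mem g hg =>
    obtain ⟨i, j, b, hb, rfl⟩ := hg
    have e : ∀ (w : ℂ) (t : ℝ), Complex.exp (-(w * t)) *
        (w ^ i * (starRingEnd ℂ) w ^ j * (t : ℂ) ^ b) / t =
        w ^ i * (starRingEnd ℂ) w ^ j * ((t : ℂ) ^ (b - 1) * Complex.exp (-(w * t))) := by
      intro w t
      obtain ⟨b, rfl⟩ : ∃ b', b = b' + 2 := ⟨b - 2, by omega⟩
      rcases eq_or_ne (t : ℂ) 0 with h | h
      · simp [h]
      · rw [show b + 2 - 1 = b + 1 by omega, pow_succ _ (b + 1)]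
        field_simp
    simp only [e, intervalIntegral.integral_const_mul]
    refine ⟨fun w => Continuous.intervalIntegrable (by fun_prop) _ _, ?_⟩
    have h1 : HasOrderExpansion K (fun w => ((b - 1).factorial : ℂ) *
      homogeneousTerm (b - (i + j)) ((i : ℤ) - j - b) w) :=
      (HasOrderExpansion.homogeneousTerm _ _).const_mul _
    refine h1.add_isBigO ?_
    obtain ⟨C, hC⟩ := exists_norm_integral_pow_mul_exp_sub_le (b - 1)
    have h2 := isBigO_of_le_exp (by norm_num) (-(K : ℤ) - (i + j : ℕ)) hC
    have h3 : (fun w : ℂ => w ^ i * (starRingEnd ℂ) w ^ j) =O[sectorFilter]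
        fun w => ‖w‖ ^ ((i + j : ℕ) : ℤ) := isBigO_of_le _ fun w => by
      rw [norm_mul, norm_pow, norm_pow, RCLike.norm_conj, norm_zpow, norm_norm, zpow_natCast,
        pow_add]
    refine (h3.mul h2).congr' ?_ ?_
    · filter_upwards [eventually_sectorFilter 1] with w hw
      have hw0 : w ≠ 0 := norm_pos_iff.1 (by linarith [hw.1])
      rw [← pow_mul_conj_pow_div_pow hw0 (by omega), show b - 1 + 1 = b by omega]
      ring
    · filter_upwards [eventually_sectorFilter 1] with w hw
      rw [← zpow_add₀ (by linarith [hw.1])]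
      congr 1
      ring
  | zero =>
    simp only [Pi.zero_apply, mul_zero, zero_div, intervalIntegral.integral_zero]
    exact ⟨fun w => IntervalIntegrable.zero, HasOrderExpansion.const 0⟩
  | add f g _ _ hf hg =>
    have e : ∀ (w : ℂ) (t : ℝ), Complex.exp (-(w * t)) * (f + g) w t / t =
        Complex.exp (-(w * t)) * f w t / t + Complex.exp (-(w * t)) * g w t / t := by
      intro w t; simp only [Pi.add_apply]; ring
    simp only [e]
    refine ⟨fun w => (hf.1 w).add (hg.1 w), ?_⟩
    simp only [fun w => intervalIntegral.integral_add (hf.1 w) (hg.1 w)]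
    exact hf.2.add hg.2
  | smul a g _ hg =>
    have e : ∀ (w : ℂ) (t : ℝ), Complex.exp (-(w * t)) * (a • g) w t / t =
        a * (Complex.exp (-(w * t)) * g w t / t) := by
      intro w t; simp only [Pi.smul_apply, smul_eq_mul]; ring
    simp only [e, intervalIntegral.integral_const_mul]
    exact ⟨fun w => (hg.1 w).const_mul a, hg.2.const_mul a⟩

theorem exponentCorrection_mem_span (K : ℕ) :
    exponentCorrection K ∈ Submodule.span ℂ laplaceMonomials := by
  have e : exponentCorrection K = -∑ k ∈ Finset.Ico 1 K, (1 / (2 * k + 1) : ℂ) •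
      fun (w : ℂ) (t : ℝ) => tanExponentCoeff w k * (t : ℂ) ^ (2 * k + 1) := by
    funext w t
    simp only [exponentCorrection, Pi.neg_apply, Finset.sum_apply, Pi.smul_apply, smul_eq_mul]
    congr 1
    exact Finset.sum_congr rfl fun k _ => by ring
  rw [e]
  refine Submodule.neg_mem _ (Submodule.sum_mem _ fun k hk => Submodule.smul_mem _ _
    (Submodule.subset_span ?_))
  have := (Finset.mem_Ico.1 hk).1
  by_cases h : Even k
  · exact ⟨1, 0, 2 * k + 1, by omega, by funext w t; simp [tanExponentCoeff, h]⟩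
  · exact ⟨0, 1, 2 * k + 1, by omega, by funext w t; simp [tanExponentCoeff, h]⟩

theorem sum_exponentCorrection_mem_span (K : ℕ) :
    (fun w t => ∑ j ∈ Finset.Ico 1 K, exponentCorrection K w t ^ j / (j.factorial : ℂ)) ∈
      Submodule.span ℂ laplaceMonomials := by
  have hpow : ∀ j : ℕ, exponentCorrection K ^ (j + 1) ∈ Submodule.span ℂ laplaceMonomials := by
    intro j
    induction j with
    | zero => simpa using exponentCorrection_mem_span K
    | succ j ih => rw [pow_succ]; exact mul_mem_span_laplaceMonomials ih
                    (exponentCorrection_mem_span K)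
  have e : (fun w t => ∑ j ∈ Finset.Ico 1 K, exponentCorrection K w t ^ j / (j.factorial : ℂ)) =
      ∑ j ∈ Finset.Ico 1 K, (1 / (j.factorial : ℂ)) • exponentCorrection K ^ j := by
    funext w t
    simp only [Finset.sum_apply, Pi.smul_apply, Pi.pow_apply, smul_eq_mul]
    exact Finset.sum_congr rfl fun k _ => by ring
  rw [e]
  refine Submodule.sum_mem _ fun j hj => Submodule.smul_mem _ _ ?_
  obtain ⟨j, rfl⟩ : ∃ j', j = j' + 1 := ⟨j - 1, by have := (Finset.mem_Ico.1 hj).1; omega⟩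
  exact hpow j

/-! ### The logarithmic term and the remainder -/

/-- The integral of the main part of the expansion differs from `log w` by a constant and an
exponentially small error, since both have almost the same derivative `1 / w`. -/
theorem exists_integral_one_sub_exp_sub_log_isBigO (K : ℤ) :
    (∀ w : ℂ, IntervalIntegrable (fun t : ℝ => (1 - Complex.exp (-(w * t))) / t)
      MeasureTheory.volume 0 1) ∧
    ∃ C₀ : ℂ, (fun w : ℂ => (∫ t in (0 : ℝ)..1, (1 - Complex.exp (-(w * t))) / t) -
      Complex.log w - C₀) =O[sectorFilter] fun w => ‖w‖ ^ K := by
  set F : ℂ → ℂ := fun z => 1 - Complex.exp (-z)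
  have hF : Differentiable ℂ F := by fun_prop
  have hF0 : F 0 = 0 := by simp [F]
  have hds : Differentiable ℂ (dslope F 0) := by
    rw [← differentiableOn_univ] at hF ⊢
    exact (Complex.differentiableOn_dslope univ_mem).2 hF
  have hdz : ∀ z : ℂ, z ≠ 0 → dslope F 0 z = F z / z := fun z hz => by
    rw [dslope_of_ne _ hz, slope_def_field, hF0, sub_zero, sub_zero]
  -- A primitive of the entire function `(1 - exp (-z)) / z`.
  obtain ⟨G, hG⟩ := hds.isExactOn_univ
  have hG : ∀ z, HasDerivAt G (dslope F 0 z) z := fun z => hG z trivial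
  have hae : ∀ w : ℂ, (fun t : ℝ => w * dslope F 0 (w * t)) =ᵐ[MeasureTheory.volume]
      fun t : ℝ => (1 - Complex.exp (-(w * t))) / t := by
    intro w
    filter_upwards [(Set.countable_singleton (0 : ℝ)).ae_notMem MeasureTheory.volume] with t ht
    have ht0 : (t : ℂ) ≠ 0 := by exact_mod_cast ht
    rcases eq_or_ne w 0 with rfl | hw
    · simp
    · rw [hdz _ (mul_ne_zero hw ht0)]
      simp only [F]
      field_simp
  have hcont : ∀ w : ℂ, Continuous (fun t : ℝ => w * dslope F 0 (w * t)) := fun w => by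
    have := hds.continuous
    fun_prop
  have hint : ∀ w : ℂ, (∫ t in (0 : ℝ)..1, (1 - Complex.exp (-(w * t))) / t) = G w - G 0 := by
    intro w
    rw [← intervalIntegral.integral_congr_ae ((hae w).mono fun t ht _ => ht)]
    have h1 : ∀ t : ℝ, HasDerivAt (fun t : ℝ => G (w * t)) (w * dslope F 0 (w * t)) t := by
      intro t
      have h2 : HasDerivAt (fun z : ℂ => G (w * z)) (dslope F 0 (w * t) * (w * 1)) (t : ℂ) :=
        (hG (w * t)).comp (t : ℂ) ((hasDerivAt_id (t : ℂ)).const_mul w)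
      convert h2.comp_ofReal using 1
      ring
    rw [intervalIntegral.integral_eq_sub_of_hasDerivAt (fun t _ => h1 t)
      ((hcont w).intervalIntegrable _ _)]
    simp
  refine ⟨fun w => ((hcont w).intervalIntegrable 0 1).congr_ae (hae w).restrict, ?_⟩
  -- The derivative of `g` is `-exp (-z) / z`, so `g` converges exponentially fast along the
  -- integers; any `w` in the sector is compared with an integer near its real part.
  set g : ℂ → ℂ := fun z => G z - Complex.log z
  have hg : ∀ {R : ℝ}, 1 ≤ R → ∀ {a b : ℂ}, R ≤ a.re → R ≤ b.re →
      ‖g b - g a‖ ≤ Real.exp (-R) * ‖b - a‖ := by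
    intro R hR a b ha hb
    refine (convex_halfSpace_re_ge R).norm_image_sub_le_of_norm_hasDerivWithin_le
      (f' := fun z => dslope F 0 z - z⁻¹) (fun z hz => ?_) (fun z hz => ?_) ha hb
    · have hz : R ≤ z.re := hz
      exact ((hG z).sub (Complex.hasDerivAt_log (Or.inl (by linarith)))).hasDerivWithinAt
    · have hz : R ≤ z.re := hz
      have hz1 : 1 ≤ ‖z‖ := by linarith [Complex.re_le_norm z]
      have hz0 : z ≠ 0 := norm_pos_iff.1 (by linarith)
      have e : dslope F 0 z - z⁻¹ = -Complex.exp (-z) / z := by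
        rw [hdz z hz0]; simp only [F]; field_simp; ring
      rw [e, norm_div, norm_neg, Complex.norm_exp, Complex.neg_re]
      exact (div_le_self (Real.exp_pos _).le hz1).trans (Real.exp_le_exp.2 (by linarith))
  have hstep : ∀ n : ℕ, dist (g ((n + 1 : ℕ) : ℂ)) (g ((n + 1 + 1 : ℕ) : ℂ)) ≤
      Real.exp (-1) * Real.exp (-1) ^ n := by
    intro n
    rw [dist_comm, dist_eq_norm]
    refine (hg (R := n + 1) (by linarith [n.cast_nonneg (α := ℝ)]) (by simp) (by simp)).trans ?_
    rw [← Real.exp_nat_mul, ← Real.exp_add]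
    have : (((n + 1 + 1 : ℕ) : ℂ) - ((n + 1 : ℕ) : ℂ)) = 1 := by push_cast; ring
    rw [this, norm_one, mul_one]
    exact Real.exp_le_exp.2 (by linarith)
  have he1 : Real.exp (-1) < 1 := by
    rw [← Real.exp_zero]; exact Real.exp_lt_exp.2 (by norm_num)
  obtain ⟨C, hC⟩ := cauchySeq_tendsto_of_complete (cauchySeq_of_le_geometric _ _ he1 hstep)
  have hdist := dist_le_of_le_geometric_of_tendsto _ _ he1 hstep hC
  refine ⟨C - G 0, ?_⟩
  set D := Real.exp (-1) / (1 - Real.exp (-1))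
  have hD : 0 ≤ D := div_nonneg (Real.exp_pos _).le (by linarith)
  have hmain : ∀ w : ℂ, 4 ≤ ‖w‖ → ‖w‖ ≤ 4 * w.re →
      ‖g w - C‖ ≤ (3 + D) * (‖w‖ * Real.exp (-(1 / 4 * ‖w‖))) := by
    intro w hw hs
    set n := ⌈w.re⌉₊
    have hre : 1 ≤ w.re := by linarith
    have hn : w.re ≤ n := Nat.le_ceil _
    have hn' : (n : ℝ) < w.re + 1 := Nat.ceil_lt_add_one (by linarith)
    have hexp : Real.exp (-w.re) ≤ Real.exp (-(1 / 4 * ‖w‖)) :=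
      Real.exp_le_exp.2 (by linarith)
    have h1 : ‖g w - g ((n + 1 : ℕ) : ℂ)‖ ≤ Real.exp (-w.re) * (3 * ‖w‖) := by
      refine (hg hre (by push_cast; simp; linarith) le_rfl).trans ?_
      gcongr
      refine (norm_sub_le _ _).trans ?_
      rw [Complex.norm_natCast]
      push_cast
      linarith [Complex.re_le_norm w]
    have h2 : ‖g ((n + 1 : ℕ) : ℂ) - C‖ ≤ D * Real.exp (-w.re) := by
      rw [← dist_eq_norm]
      refine (hdist n).trans ?_
      rw [mul_div_right_comm, ← Real.exp_nat_mul]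
      gcongr
      linarith
    calc ‖g w - C‖ = ‖(g w - g ((n + 1 : ℕ) : ℂ)) + (g ((n + 1 : ℕ) : ℂ) - C)‖ := by
          rw [sub_add_sub_cancel]
      _ ≤ Real.exp (-w.re) * (3 * ‖w‖) + D * Real.exp (-w.re) := norm_add_le_of_le h1 h2
      _ ≤ Real.exp (-(1 / 4 * ‖w‖)) * (3 * ‖w‖) + D * (‖w‖ * Real.exp (-(1 / 4 * ‖w‖))) := by
          gcongr
          exact hexp.trans (le_mul_of_one_le_left (Real.exp_pos _).le (by linarith))
      _ = _ := by ring
  have hbig : (fun w : ℂ => g w - C) =O[sectorFilter]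
      fun w : ℂ => ‖w‖ * Real.exp (-(1 / 4 * ‖w‖)) := by
    refine IsBigO.of_bound (3 + D) ?_
    filter_upwards [eventually_sectorFilter 4] with w hw
    rw [Real.norm_of_nonneg (by positivity)]
    exact hmain w hw.1 hw.2
  have hexp := (isBigO_refl (fun w : ℂ => ‖w‖) sectorFilter).mul
    (exp_neg_mul_norm_isBigO (c := 1 / 4) (by norm_num) (K - 1))
  refine ((hbig.trans hexp).congr_left fun w => ?_).congr' EventuallyEq.rfl ?_
  · rw [hint]; simp only [g]; ring
  · filter_upwards [eventually_sectorFilter 1] with w hw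
    rw [← zpow_one_add₀ (by linarith [hw.1])]
    congr 1
    ring

theorem measurable_tanExponent (w : ℂ) : Measurable (tanExponent w) := by
  unfold tanExponent
  have := Real.measurable_arctan
  fun_prop

theorem continuous_exponentCorrection (K : ℕ) (w : ℂ) : Continuous (exponentCorrection K w) := by
  unfold exponentCorrection
  fun_prop

/-- The integral of `‖w‖ ^ K t ^ (2 K - 1) exp (-‖w‖ t / 8)` is of order `‖w‖ ^ (-K)`. -/
theorem intervalIntegrable_and_isBigO_remainder {K : ℕ} (hK : 1 ≤ K) :
    (∀ w : ℂ, 1 ≤ ‖w‖ → ‖w‖ ≤ 4 * w.re → IntervalIntegrable (fun t : ℝ =>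
      (Complex.exp (tanExponent w t) - Complex.exp (-(w * t)) *
        ∑ j ∈ Finset.range K, exponentCorrection K w t ^ j / (j.factorial : ℂ)) / t)
        MeasureTheory.volume 0 1) ∧
    (fun w : ℂ => ∫ t in (0 : ℝ)..1, (Complex.exp (tanExponent w t) - Complex.exp (-(w * t)) *
        ∑ j ∈ Finset.range K, exponentCorrection K w t ^ j / (j.factorial : ℂ)) / t)
      =O[sectorFilter] fun w => ‖w‖ ^ (-(K : ℤ)) := by
  obtain ⟨C, hC⟩ := exists_norm_exp_tanExponent_sub_le hK
  have hbound : ∀ w : ℂ, 1 ≤ ‖w‖ → ‖w‖ ≤ 4 * w.re →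
      ∀ᵐ t : ℝ, t ∈ Set.Ioc (0 : ℝ) 1 →
      ‖(Complex.exp (tanExponent w t) - Complex.exp (-(w * t)) *
        ∑ j ∈ Finset.range K, exponentCorrection K w t ^ j / (j.factorial : ℂ)) / t‖ ≤
      C * ‖w‖ ^ K * (t ^ (2 * K - 1) * Real.exp (-(‖w‖ / 8 * t))) := by
    intro w hw hs
    filter_upwards [(Set.countable_singleton (1 : ℝ)).ae_notMem MeasureTheory.volume]
      with t ht1 ht
    rw [norm_div, Complex.norm_real, Real.norm_of_nonneg ht.1.le, div_le_iff₀ ht.1]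
    refine (hC w hw hs t ⟨ht.1, lt_of_le_of_ne ht.2 ht1⟩).trans (le_of_eq ?_)
    have : t ^ (2 * K) = t ^ (2 * K - 1) * t := by rw [← pow_succ]; congr 1; omega
    rw [this]; ring
  have hgi : ∀ w : ℂ, IntervalIntegrable (fun t : ℝ =>
      C * ‖w‖ ^ K * (t ^ (2 * K - 1) * Real.exp (-(‖w‖ / 8 * t)))) MeasureTheory.volume 0 1 :=
    fun w => Continuous.intervalIntegrable (by fun_prop) _ _
  refine ⟨fun w hw hs => (hgi w).mono_fun' ?_ ?_, ?_⟩
  · have h1 := measurable_tanExponent w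
    have h2 := (continuous_exponentCorrection K w).measurable
    exact Measurable.aestronglyMeasurable (by fun_prop)
  · rw [Set.uIoc_of_le zero_le_one]
    exact (MeasureTheory.ae_restrict_iff' measurableSet_Ioc).2 (hbound w hw hs)
  · refine IsBigO.of_bound (|C| * ((2 * K - 1).factorial * 8 ^ (2 * K))) ?_
    filter_upwards [eventually_sectorFilter 1] with w hw
    have hw0 : 0 < ‖w‖ := by linarith [hw.1]
    refine (intervalIntegral.norm_integral_le_of_norm_le zero_le_one (hbound w hw.1 hw.2)
      (hgi w)).trans ?_
    rw [intervalIntegral.integral_const_mul]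
    have h1 : (∫ t in (0 : ℝ)..1, t ^ (2 * K - 1) * Real.exp (-(‖w‖ / 8 * t))) ≤
        (2 * K - 1).factorial / (‖w‖ / 8) ^ (2 * K) := by
      have := intervalIntegral_pow_mul_exp_neg_le (k := 2 * K - 1) (M := 1) zero_le_one
        (by positivity : 0 < ‖w‖ / 8)
      rw [show 2 * K - 1 + 1 = 2 * K by omega] at this
      simpa only [neg_mul] using this
    have h0 : 0 ≤ ∫ t in (0 : ℝ)..1, t ^ (2 * K - 1) * Real.exp (-(‖w‖ / 8 * t)) :=
      intervalIntegral.integral_nonneg zero_le_one fun t ht =>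
        mul_nonneg (pow_nonneg ht.1 _) (Real.exp_pos _).le
    calc _ ≤ |C| * ‖w‖ ^ K * ((2 * K - 1).factorial / (‖w‖ / 8) ^ (2 * K)) := by
          gcongr
          exact le_abs_self C
      _ = _ := by
          rw [Real.norm_of_nonneg (by positivity), zpow_neg, zpow_natCast, div_pow,
            show ‖w‖ ^ (2 * K) = ‖w‖ ^ K * ‖w‖ ^ K by rw [← pow_add]; congr 1; ring]
          field_simp

/-- The integral representation of the potential, as a function of `w` in the sector, has an
expansion with the logarithmic term `log ‖w‖`. -/
theorem hasOrderExpansion_integral_sub_log {K : ℕ} (hK : 1 ≤ K) :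
    HasOrderExpansion K (fun w => ((∫ t in (0 : ℝ)..1,
      (1 - (Complex.exp (tanExponent w t)).re) / t : ℝ) : ℂ) - (Real.log ‖w‖ : ℂ)) := by
  obtain ⟨hi1, C₀, hlog⟩ := exists_integral_one_sub_exp_sub_log_isBigO (-(K : ℤ))
  obtain ⟨hi2, hpoly⟩ := laplace_of_mem_span K (sum_exponentCorrection_mem_span K)
  obtain ⟨hi3, hrem⟩ := intervalIntegrable_and_isBigO_remainder hK
  have h1 : HasOrderExpansion K (fun w => (∫ t in (0 : ℝ)..1,
      (1 - Complex.exp (-(w * t))) / t) - Complex.log w) :=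
    (HasOrderExpansion.const C₀).add_isBigO hlog
  have h2 := ((h1.add (hpoly.const_mul (-1))).add
    ((HasOrderExpansion.of_isBigO hrem).const_mul (-1))).re
  refine h2.congr' ?_
  filter_upwards [eventually_sectorFilter 1] with w hw
  have hsplit : ∀ t : ℝ, (1 - Complex.exp (tanExponent w t)) / t =
      (1 - Complex.exp (-(w * t))) / t - Complex.exp (-(w * t)) *
        (∑ j ∈ Finset.Ico 1 K, exponentCorrection K w t ^ j / (j.factorial : ℂ)) / t -
      (Complex.exp (tanExponent w t) - Complex.exp (-(w * t)) *
        ∑ j ∈ Finset.range K, exponentCorrection K w t ^ j / (j.factorial : ℂ)) / t := by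
    intro t
    rw [Finset.range_eq_Ico, Finset.sum_eq_sum_Ico_succ_bot (by omega : 0 < K)]
    simp only [pow_zero, Nat.factorial_zero, Nat.cast_one, div_one, zero_add]
    ring
  have hsum := intervalIntegral.integral_sub ((hi1 w).sub (hi2 w)) (hi3 w hw.1 hw.2)
  rw [intervalIntegral.integral_sub (hi1 w) (hi2 w)] at hsum
  have hii := ((hi1 w).sub (hi2 w)).sub (hi3 w hw.1 hw.2)
  simp only [← hsplit] at hsum hii
  have hre : (∫ t in (0 : ℝ)..1, (1 - (Complex.exp (tanExponent w t)).re) / t) =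
      (∫ t in (0 : ℝ)..1, (1 - Complex.exp (tanExponent w t)) / t).re := by
    have := Complex.reCLM.intervalIntegral_comp_comm hii
    simp only [Complex.reCLM_apply] at this
    rw [← this]
    refine intervalIntegral.integral_congr fun t _ => ?_
    simp only [Complex.div_ofReal_re, Complex.sub_re, Complex.one_re]
  rw [hre, hsum, ← Complex.ofReal_sub]
  simp only [Complex.sub_re, Complex.add_re, neg_mul, one_mul, Complex.neg_re, Complex.log_re]
  congr 1
  ring

/-! ### Existence of the expansion of the potential -/

/-- The rotation of `ℤ²` by a right angle, clockwise. -/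
def rotateClockwise (z : ℤ × ℤ) : ℤ × ℤ := (z.2, -z.1)

theorem latticeToComplex_rotateClockwise (z : ℤ × ℤ) :
    latticeToComplex (rotateClockwise z) = -Complex.I * latticeToComplex z := by
  apply Complex.ext <;> simp [latticeToComplex, rotateClockwise]

theorem rotateClockwise_injective : Function.Injective rotateClockwise := by
  rintro ⟨x, y⟩ ⟨x', y'⟩ h
  simp only [rotateClockwise, Prod.mk.injEq, neg_inj] at h ⊢
  exact ⟨h.2, h.1⟩

theorem harmonicPotential_rotateClockwise (z : ℤ × ℤ) :
    harmonicPotential (rotateClockwise z) = harmonicPotential z := by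
  have := harmonicPotential_rotate z.2 (-z.1)
  rw [neg_neg] at this
  exact this.symm

/-- The lattice points in a sector around the direction of `1 - i`; its four rotated copies cover
the lattice. -/
def latticeSector : Set (ℤ × ℤ) := {z | |z.1| + |z.2| ≤ 2 * (z.1 - z.2)}

/-- The parameter `2 ((x - y) - i (x + y))` of the integral representation, for `z = x + i y`. -/
noncomputable def sectorParameter (z : ℂ) : ℂ := 2 * (1 - Complex.I) * (starRingEnd ℂ) z

theorem norm_sectorParameter (z : ℂ) : ‖sectorParameter z‖ = 2 * √2 * ‖z‖ := by
  have : ‖(1 : ℂ) - Complex.I‖ = √2 := by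
    rw [Complex.norm_def, Complex.normSq_apply]; norm_num
  rw [sectorParameter, norm_mul, norm_mul, this, RCLike.norm_conj]
  norm_num

theorem sectorParameter_re (z : ℤ × ℤ) :
    (sectorParameter (latticeToComplex z)).re = 2 * (z.1 - z.2 : ℤ) := by
  simp [sectorParameter, latticeToComplex]
  ring

theorem sectorParameter_im (z : ℤ × ℤ) :
    (sectorParameter (latticeToComplex z)).im = -2 * (z.1 + z.2 : ℤ) := by
  simp [sectorParameter, latticeToComplex]
  ring

theorem tendsto_sectorParameter :
    Tendsto (fun z => sectorParameter (latticeToComplex z)) (cofinite ⊓ 𝓟 latticeSector)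
      sectorFilter := by
  refine tendsto_inf.2 ⟨?_, tendsto_principal.2 ?_⟩
  · refine Tendsto.mono_left ?_ inf_le_left
    rw [← tendsto_norm_atTop_iff_cobounded]
    simp only [norm_sectorParameter]
    exact (tendsto_norm_cobounded_atTop.comp tendsto_latticeToComplex).const_mul_atTop
      (by positivity)
  · refine Eventually.filter_mono inf_le_right (eventually_principal.2 fun z hz => ?_)
    have hz : |z.1| + |z.2| ≤ 2 * (z.1 - z.2) := hz
    have hz' : |(z.1 : ℝ)| + |(z.2 : ℝ)| ≤ 2 * (z.1 - z.2 : ℤ) := by exact_mod_cast hz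
    have h1 : ‖latticeToComplex z‖ ≤ |(z.1 : ℝ)| + |(z.2 : ℝ)| :=
      Complex.norm_le_abs_re_add_abs_im _
    have h2 : √2 ≤ 2 := (Real.sqrt_le_left (by norm_num)).2 (by norm_num)
    show ‖_‖ ≤ _
    rw [norm_sectorParameter, sectorParameter_re]
    nlinarith [norm_nonneg (latticeToComplex z)]

theorem harmonicPotential_eq_integral_exp {z : ℤ × ℤ} (hz : z ∈ latticeSector) :
    harmonicPotential z = 2 / Real.pi * ∫ t in (0 : ℝ)..1,
      (1 - (Complex.exp (tanExponent (sectorParameter (latticeToComplex z)) t)).re) / t := by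
  rw [harmonicPotential_eq_integral_tan, intervalIntegral.integral_of_le zero_le_one,
    MeasureTheory.integral_Ioc_eq_integral_Ioo]
  congr 1
  refine MeasureTheory.setIntegral_congr_fun measurableSet_Ioo fun t ht => ?_
  have hz : |z.1| + |z.2| ≤ 2 * (z.1 - z.2) := hz
  have hq : 0 ≤ z.1 - z.2 := by
    have := abs_nonneg z.1; have := abs_nonneg z.2; omega
  obtain ⟨q, hq⟩ := Int.eq_ofNat_of_zero_le hq
  have h1 : (0 : ℝ) < 1 - t := by linarith [ht.2]
  have h2 : (0 : ℝ) < 1 + t := by linarith [ht.1]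
  have e : tanExponent (sectorParameter (latticeToComplex z)) t =
      ((q * (Real.log (1 - t) - Real.log (1 + t)) : ℝ) : ℂ) +
        ((2 * (z.1 + z.2 : ℤ) * Real.arctan t : ℝ) : ℂ) * Complex.I := by
    rw [tanExponent, sectorParameter_re, sectorParameter_im, hq]
    push_cast
    ring
  have e2 : Real.exp (q * (Real.log (1 - t) - Real.log (1 + t))) = ((1 - t) / (1 + t)) ^ q := by
    rw [← Real.log_div h1.ne' h2.ne', ← Real.log_pow, Real.exp_log (by positivity)]
  rw [e, Complex.exp_add, ← Complex.ofReal_exp, Complex.re_ofReal_mul, Complex.exp_ofReal_mul_I_re,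
    e2, hq, mul_comm (Real.cos _)]
  simp

/-- As `sectorParameter z` is a constant multiple of `conj z`, it turns homogeneous terms into
multiples of homogeneous terms of the same order. -/
theorem exists_evalOrder_sectorParameter (n : ℕ) (c : ℤ →₀ ℂ) : ∃ d : ℤ →₀ ℂ, ∀ z : ℂ, z ≠ 0 →
    evalOrder n (sectorParameter z) c = evalOrder n z d := by
  induction c using Finsupp.induction_linear with
  | zero => exact ⟨0, by simp⟩
  | add f g hf hg =>
    obtain ⟨d, hd⟩ := hf
    obtain ⟨e, he⟩ := hg
    exact ⟨d + e, fun w hw => by rw [map_add, hd w hw, he w hw, map_add]⟩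
  | single m a =>
    refine ⟨Finsupp.single (-m) (a * ((2 * (1 - Complex.I)) ^ m *
      ((2 * √2 : ℝ) : ℂ) ^ (-((n : ℤ) + m)))), fun z hz => ?_⟩
    rw [evalOrder_single, evalOrder_single, ← conj_homogeneousTerm n m hz, homogeneousTerm,
      homogeneousTerm, norm_sectorParameter, sectorParameter, Complex.ofReal_mul, mul_zpow,
      mul_zpow _ (‖z‖ : ℂ), map_mul, map_zpow₀, map_zpow₀, Complex.conj_ofReal]
    ring

theorem PotentialExpansion.trunc_sub_trunc_isBigO (E : PotentialExpansion) {j K : ℕ} (h : j ≤ K) :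
    (fun z => E.trunc K z - E.trunc j z) =O[Bornology.cobounded ℂ] fun z => ‖z‖ ^ (-(j : ℤ)) := by
  have e : ∀ z, E.trunc K z - E.trunc j z = ∑ n ∈ Finset.Ico j K, E.part n z := fun z => by
    rw [E.trunc_eq, E.trunc_eq, ← Finset.sum_range_add_sum_Ico _ h]; ring
  simp only [e]
  refine IsBigO.fun_sum fun n hn => ?_
  exact isBigO_evalOrder n _ (Finset.mem_Ico.1 hn).1

/-- Expansions to each finite order combine to one expansion, by uniqueness. -/
theorem exists_expansion_of_forall_order {S : Set (ℤ × ℤ)} (hS : IsAmple S) {f : ℤ × ℤ → ℂ}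
    (h : ∀ K : ℕ, 1 ≤ K → ∃ E : PotentialExpansion,
      (fun z => f z - E.trunc K (latticeToComplex z)) =O[cofinite ⊓ 𝓟 S]
        fun z => ‖latticeToComplex z‖ ^ (-(K : ℤ))) :
    ∃ E : PotentialExpansion, ∀ K : ℕ,
      (fun z => f z - E.trunc K (latticeToComplex z)) =O[cofinite ⊓ 𝓟 S]
        fun z => ‖latticeToComplex z‖ ^ (-(K : ℤ)) := by
  have : Nonempty PotentialExpansion := ⟨⟨0, fun _ => 0⟩⟩
  choose! E hE using h
  have hle : ∀ K : ℕ, 1 ≤ K → ∀ j ≤ K,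
      (fun z => f z - (E K).trunc j (latticeToComplex z)) =O[cofinite ⊓ 𝓟 S]
        fun z => ‖latticeToComplex z‖ ^ (-(j : ℤ)) := by
    intro K hK j hj
    have hmono : (fun z => ‖latticeToComplex z‖ ^ (-(K : ℤ))) =O[cofinite ⊓ 𝓟 S]
        fun z => ‖latticeToComplex z‖ ^ (-(j : ℤ)) := by
      refine IsBigO.of_bound 1 (Eventually.filter_mono inf_le_left ?_)
      filter_upwards [(tendsto_norm_cobounded_atTop.comp
        tendsto_latticeToComplex).eventually_ge_atTop 1] with z hz
      rw [norm_zpow, norm_zpow, norm_norm, one_mul]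
      exact zpow_le_zpow_right₀ hz (by omega)
    have h2 := (((E K).trunc_sub_trunc_isBigO hj).comp_tendsto tendsto_latticeToComplex).mono
      (inf_le_left : cofinite ⊓ 𝓟 S ≤ cofinite)
    refine (((hE K hK).trans hmono).add h2).congr_left fun z => ?_
    simp
  have hcoh : ∀ K : ℕ, 1 ≤ K → ∀ j, 1 ≤ j → j ≤ K → (E K).logCoeff = (E j).logCoeff ∧
      ∀ n < j, (E K).coeff n = (E j).coeff n := by
    intro K hK j hj hjK
    have := (E K - E j).coeff_eq_zero_of_isBigO hS hj fun i hi =>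
      ((hle j hj i hi).sub (hle K hK i (hi.trans hjK))).congr_left fun z => by
        rw [PotentialExpansion.trunc_sub]; ring
    exact ⟨sub_eq_zero.1 this.1, fun n hn => sub_eq_zero.1 (this.2 n hn)⟩
  -- The coefficients of order `n` of `E K` are the same for all `K > n`.
  refine ⟨⟨(E 1).logCoeff, fun n => (E (n + 1)).coeff n⟩, fun K => ?_⟩
  refine (hle (K + 1) (by omega) K (by omega)).congr_left fun z => ?_
  rw [PotentialExpansion.trunc, PotentialExpansion.trunc, (hcoh (K + 1) (by omega) 1 le_rfl
    (by omega)).1]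
  congr 2
  refine Finset.sum_congr rfl fun n hn => ?_
  have := Finset.mem_range.1 hn
  rw [(hcoh (K + 1) (by omega) (n + 1) (by omega) (by omega)).2 n (by omega)]

theorem exists_expansion_latticeSector {K : ℕ} (hK : 1 ≤ K) : ∃ E : PotentialExpansion,
    (fun z => (harmonicPotential z : ℂ) - E.trunc K (latticeToComplex z))
      =O[cofinite ⊓ 𝓟 latticeSector] fun z => ‖latticeToComplex z‖ ^ (-(K : ℤ)) := by
  obtain ⟨c, hc⟩ := ((hasOrderExpansion_integral_sub_log hK).add
    (HasOrderExpansion.const (Real.log (2 * √2) : ℝ))).const_mul ((2 / Real.pi : ℝ) : ℂ)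
  choose d hd using fun n => exists_evalOrder_sectorParameter n (c n)
  have h := hc.comp_tendsto tendsto_sectorParameter
  refine ⟨⟨(2 / Real.pi : ℝ), d⟩, (h.trans ?_).congr' ?_ EventuallyEq.rfl⟩
  · refine IsBigO.of_bound ((2 * √2) ^ (-(K : ℤ))) (Eventually.of_forall fun z => ?_)
    simp only [Function.comp]
    rw [norm_sectorParameter, mul_zpow, norm_mul, Real.norm_of_nonneg (by positivity)]
  · have h1 : ∀ᶠ z in cofinite ⊓ 𝓟 latticeSector, 1 ≤ ‖latticeToComplex z‖ :=
      ((tendsto_norm_cobounded_atTop.comp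
        tendsto_latticeToComplex).eventually_ge_atTop 1).filter_mono inf_le_left
    have h2 : ∀ᶠ z in cofinite ⊓ 𝓟 latticeSector, z ∈ latticeSector :=
      (eventually_principal.2 fun z hz => hz).filter_mono inf_le_right
    filter_upwards [h1, h2] with z hz hS
    have hz0 : latticeToComplex z ≠ 0 := norm_pos_iff.1 (by linarith)
    have hlog : Real.log ‖sectorParameter (latticeToComplex z)‖ =
        Real.log (2 * √2) + Real.log ‖latticeToComplex z‖ := by
      rw [norm_sectorParameter, Real.log_mul (by positivity) (by linarith)]
    simp only [Function.comp]
    rw [PotentialExpansion.trunc_eq, harmonicPotential_eq_integral_exp hS, hlog]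
    simp only [PotentialExpansion.part_eq_evalOrder, fun n => hd n _ hz0]
    push_cast
    ring

namespace PotentialExpansion

/-- The expansion of `z ↦ E (u z)` for `|u| = 1`. -/
noncomputable def twist (u : ℂ) (E : PotentialExpansion) : PotentialExpansion where
  logCoeff := E.logCoeff
  coeff n := Finsupp.onFinset (E.coeff n).support (fun m => u ^ m * E.coeff n m) fun m hm => by
    rw [Finsupp.mem_support_iff]; exact right_ne_zero_of_mul hm

theorem trunc_twist {u : ℂ} (hu : ‖u‖ = 1) (E : PotentialExpansion) (K : ℕ) (z : ℂ) :
    (E.twist u).trunc K z = E.trunc K (u * z) := by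
  rw [trunc, trunc, norm_mul, hu, one_mul]
  congr 1
  refine Finset.sum_congr rfl fun n _ => ?_
  simp only [twist]
  rw [Finsupp.onFinset_sum _ (fun m => by simp)]
  refine Finset.sum_congr rfl fun m _ => ?_
  simp only [mul_zpow]
  ring

end PotentialExpansion

theorem isAmple_latticeSector_inter :
    IsAmple (latticeSector ∩ rotateClockwise ⁻¹' latticeSector) := by
  refine ⟨3, fun N hN m hm => ?_⟩
  have h1 : (3 : ℤ) * m ≤ m * N := by
    have : 3 * m ≤ m * N := by rw [mul_comm]; exact Nat.mul_le_mul_left m hN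
    exact_mod_cast this
  have h2 : (0 : ℤ) ≤ m := by positivity
  constructor
  · show |(m : ℤ) * N| + |(m : ℤ)| ≤ 2 * (m * N - m)
    rw [abs_of_nonneg (by omega), abs_of_nonneg h2]
    omega
  · show |(m : ℤ)| + |-((m : ℤ) * N)| ≤ 2 * (m - -(m * N))
    rw [abs_neg, abs_of_nonneg (by omega : (0 : ℤ) ≤ m * N), abs_of_nonneg h2]
    omega

theorem IsAmple.mono {S T : Set (ℤ × ℤ)} (hS : IsAmple S) (h : S ⊆ T) : IsAmple T := by
  obtain ⟨N₀, h₀⟩ := hS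
  exact ⟨N₀, fun N hN m hm => h (h₀ N hN m hm)⟩

/-- The expansion in one sector is invariant under rotation by a right angle, by uniqueness on the
intersection of two neighbouring sectors; so it is valid on the whole lattice. -/
theorem exists_isExpansionOf_harmonicPotential :
    ∃ E : PotentialExpansion, E.IsExpansionOf harmonicPotential := by
  obtain ⟨F, hF⟩ := exists_expansion_of_forall_order
    (isAmple_latticeSector_inter.mono Set.inter_subset_left)
    (f := fun z => (harmonicPotential z : ℂ)) fun K hK => exists_expansion_latticeSector hK
  have hnorm : ‖(-Complex.I : ℂ)‖ = 1 := by simp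
  have hrot : F = F.twist (-Complex.I) := by
    refine PotentialExpansion.eq_of_isBigO_sub isAmple_latticeSector_inter fun K => ?_
    have h1 := (hF K).mono (inf_le_inf_left cofinite (principal_mono.2
      (Set.inter_subset_left (s := latticeSector) (t := rotateClockwise ⁻¹' latticeSector))))
    have ht : Tendsto rotateClockwise
        (cofinite ⊓ 𝓟 (latticeSector ∩ rotateClockwise ⁻¹' latticeSector))
        (cofinite ⊓ 𝓟 latticeSector) := by
      refine tendsto_inf.2 ⟨(rotateClockwise_injective.tendsto_cofinite).mono_left inf_le_left,
        tendsto_principal.2 (Eventually.filter_mono inf_le_right (eventually_principal.2 ?_))⟩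
      exact fun z hz => hz.2
    have h2 := (hF K).comp_tendsto ht
    have h3 : (fun z => (harmonicPotential z : ℂ) -
        (F.twist (-Complex.I)).trunc K (latticeToComplex z))
        =O[cofinite ⊓ 𝓟 (latticeSector ∩ rotateClockwise ⁻¹' latticeSector)]
        fun z => ‖latticeToComplex z‖ ^ (-(K : ℤ)) := by
      refine h2.congr (fun z => ?_) (fun z => ?_)
      · simp only [Function.comp, harmonicPotential_rotateClockwise,
          latticeToComplex_rotateClockwise]
        rw [PotentialExpansion.trunc_twist hnorm]
      · simp only [Function.comp, latticeToComplex_rotateClockwise, norm_mul, hnorm, one_mul]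
    exact (h3.sub h1).congr_left fun z => by ring
  refine ⟨F, fun K => ?_⟩
  obtain ⟨C, hC⟩ := (hF K).bound
  rw [eventually_inf_principal] at hC
  refine IsBigO.of_bound C ?_
  have hT := rotateClockwise_injective.tendsto_cofinite
  have hinv : ∀ z, (harmonicPotential (rotateClockwise z) : ℂ) -
      F.trunc K (latticeToComplex (rotateClockwise z)) =
      (harmonicPotential z : ℂ) - F.trunc K (latticeToComplex z) := by
    intro z
    rw [harmonicPotential_rotateClockwise, latticeToComplex_rotateClockwise,
      ← PotentialExpansion.trunc_twist hnorm, ← hrot]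
  have hninv : ∀ z, ‖latticeToComplex (rotateClockwise z)‖ = ‖latticeToComplex z‖ := by
    intro z; rw [latticeToComplex_rotateClockwise, norm_mul, hnorm, one_mul]
  filter_upwards [hC, hT.eventually hC, (hT.comp hT).eventually hC,
    (hT.comp (hT.comp hT)).eventually hC] with z h0 h1 h2 h3
  simp only [Function.comp, hinv, hninv] at h1 h2 h3
  have hcover : z ∈ latticeSector ∨ rotateClockwise z ∈ latticeSector ∨
      rotateClockwise (rotateClockwise z) ∈ latticeSector ∨
      rotateClockwise (rotateClockwise (rotateClockwise z)) ∈ latticeSector := by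
    obtain ⟨x, y⟩ := z
    simp only [latticeSector, rotateClockwise, Set.mem_ofPred_eq, abs_neg]
    rcases abs_cases x with hx | hx <;> rcases abs_cases y with hy | hy <;> omega
  rcases hcover with h | h | h | h
  exacts [h0 h, h1 h, h2 h, h3 h]

/-! ### The coefficients of the formal discrete Laplacian -/

theorem complexBinomial_zero_left {i : ℕ} (hi : i ≠ 0) : complexBinomial 0 i = 0 := by
  obtain ⟨i, rfl⟩ := Nat.exists_eq_succ_of_ne_zero hi
  rw [complexBinomial, Finset.prod_eq_zero (Finset.mem_range.2 i.succ_pos)]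
  simp

/-- As `log |1 + h|` is the real part of a holomorphic function, only the monomials `h ^ N` and
`(conj h) ^ N` contribute. -/
theorem stepLaplacian_logTaylorCoeff_apply {N : ℕ} (hN : 1 ≤ N) (M : ℤ) :
    stepLaplacian logTaylorCoeff 0 N M =
      if (4 : ℤ) ∣ M ∧ M.natAbs = N then -1 / (2 * (N : ℂ)) else 0 := by
  have h0 : complexBinomial 0 0 = 1 := by simp [complexBinomial]
  have hN0 : N ≠ 0 := by omega
  have hz : ∀ p ∈ Finset.HasAntidiagonal.antidiagonal N, p ≠ (N, 0) → p ≠ (0, N) →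
      logTaylorCoeff p.1 p.2 = 0 := by
    rintro ⟨i, j⟩ hp h1 h2
    rw [Finset.HasAntidiagonal.mem_antidiagonal] at hp
    have hp : i + j = N := hp
    have hj : j ≠ 0 := by rintro rfl; exact h1 (by simp at hp; simp [hp])
    have hi : i ≠ 0 := by rintro rfl; exact h2 (by simp at hp; simp [hp])
    simp [logTaylorCoeff, complexBinomial_zero_left hi, complexBinomial_zero_left hj]
  have hne : ((N, 0) : ℕ × ℕ) ≠ (0, N) := by simp [hN0]
  have hs : stepLaplacian logTaylorCoeff 0 N =
      Finsupp.single (-(N : ℤ)) (if (4 : ℤ) ∣ N then logTaylorCoeff N 0 else 0) +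
        Finsupp.single (N : ℤ) (if (4 : ℤ) ∣ N then logTaylorCoeff 0 N else 0) := by
    rw [stepLaplacian, Finset.sum_eq_add_of_mem ((N, 0) : ℕ × ℕ) (0, N) (by simp) (by simp) hne]
    · simp
    · intro p hp hp'
      rw [hz p hp hp'.1 hp'.2]
      simp
  have hl1 : (4 : ℤ) ∣ N → logTaylorCoeff N 0 = -1 / (2 * N) := by
    intro h
    have he : Even N := by
      obtain ⟨k, hk⟩ := h; exact ⟨(2 * k).toNat, by omega⟩
    rw [logTaylorCoeff, h0, complexBinomial_zero_left hN0, he.neg_one_pow]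
    field_simp
    simp
  have hl2 : (4 : ℤ) ∣ N → logTaylorCoeff 0 N = -1 / (2 * N) := by
    intro h
    have he : Even N := by
      obtain ⟨k, hk⟩ := h; exact ⟨(2 * k).toNat, by omega⟩
    rw [logTaylorCoeff, h0, complexBinomial_zero_left hN0, he.neg_one_pow]
    field_simp
    simp
  rw [hs, Finsupp.add_apply, Finsupp.single_apply, Finsupp.single_apply]
  by_cases h4 : (4 : ℤ) ∣ N
  · rw [if_pos h4, if_pos h4, hl1 h4, hl2 h4]
    rcases eq_or_ne (-(N : ℤ)) M with rfl | h1
    · rw [if_pos rfl, if_neg (by omega), if_pos ⟨by omega, by omega⟩, add_zero]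
    · rw [if_neg h1, zero_add]
      rcases eq_or_ne (N : ℤ) M with rfl | h2
      · rw [if_pos rfl, if_pos ⟨by omega, by omega⟩]
      · rw [if_neg h2, if_neg (by omega)]
  · rw [if_neg h4, if_neg h4, ite_self, ite_self, if_neg (by omega), add_zero]

namespace PotentialExpansion

variable (E : PotentialExpansion)

theorem laplacianPiece_apply (n d : ℕ) (M : ℤ) :
    E.laplacianPiece n d M = ∑ p ∈ Finset.HasAntidiagonal.antidiagonal d,
      if (4 : ℤ) ∣ (p.1 : ℤ) - p.2 then homogeneousTaylorCoeff n (M + p.1 - p.2) p.1 p.2 *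
        E.coeff n (M + p.1 - p.2) else 0 := by
  simp only [laplacianPiece, Finsupp.sum, stepLaplacian, Finsupp.finsetSum_apply,
    Finsupp.smul_apply, smul_eq_mul, Finset.mul_sum]
  rw [Finset.sum_comm]
  refine Finset.sum_congr rfl fun p _ => ?_
  rw [Finset.sum_eq_single (M + p.1 - p.2)]
  · rw [show M + p.1 - p.2 - p.1 + p.2 = M by ring, Finsupp.single_eq_same]
    split_ifs
    · ring
    · simp
  · intro m _ hm
    rw [Finsupp.single_eq_of_ne (by omega), mul_zero]
  · intro h
    rw [Finsupp.notMem_support_iff.1 h, zero_mul]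

/-- The coefficient of `z ^ m |z| ^ (-(n + 2 + m))` in the formal discrete Laplacian, with the term
of the highest order split off. -/
theorem laplacian_coeff_apply (n : ℕ) (m : ℤ) :
    E.laplacian.coeff (n + 2) m =
      E.logCoeff * (if (4 : ℤ) ∣ m ∧ m.natAbs = n + 2 then -1 / (2 * ((n : ℂ) + 2)) else 0) +
      (((n : ℂ) ^ 2 - (m : ℂ) ^ 2) / 4 * E.coeff n m +
      ∑ p ∈ (Finset.range (n + 3) ×ˢ Finset.range (n + 3)).filter
        (fun p => 4 ≤ p.1 + p.2 ∧ p.1 + p.2 ≤ n + 2 ∧ (4 : ℤ) ∣ (p.1 : ℤ) - p.2),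
        homogeneousTaylorCoeff (n + 2 - (p.1 + p.2)) (m + p.1 - p.2) p.1 p.2 *
          E.coeff (n + 2 - (p.1 + p.2)) (m + p.1 - p.2)) := by
  have h11 : homogeneousTaylorCoeff n m 1 1 = ((n : ℂ) ^ 2 - (m : ℂ) ^ 2) / 4 := by
    simp [homogeneousTaylorCoeff, complexBinomial]; ring
  have hmem : ((1, 1) : ℕ × ℕ) ∉ (Finset.range (n + 3) ×ˢ Finset.range (n + 3)).filter
        (fun p => 4 ≤ p.1 + p.2 ∧ p.1 + p.2 ≤ n + 2 ∧ (4 : ℤ) ∣ (p.1 : ℤ) - p.2) := by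
    simp
  have hcons : ((n : ℂ) ^ 2 - (m : ℂ) ^ 2) / 4 * E.coeff n m =
      homogeneousTaylorCoeff (n + 2 - (1 + 1)) (m + (1 : ℕ) - (1 : ℕ)) 1 1 *
          E.coeff (n + 2 - (1 + 1)) (m + (1 : ℕ) - (1 : ℕ)) := by
    rw [show n + 2 - (1 + 1) = n by omega, add_sub_cancel_right, h11]
  rw [hcons, ← Finset.sum_insert (f := fun p : ℕ × ℕ =>
    homogeneousTaylorCoeff (n + 2 - (p.1 + p.2)) (m + p.1 - p.2) p.1 p.2 *
          E.coeff (n + 2 - (p.1 + p.2)) (m + p.1 - p.2)) hmem]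
  -- The only pair with `1 ≤ i + j ≤ 3` and `4 ∣ i - j` is `(1, 1)`.
  have hset : insert ((1, 1) : ℕ × ℕ) ((Finset.range (n + 3) ×ˢ Finset.range (n + 3)).filter
        (fun p => 4 ≤ p.1 + p.2 ∧ p.1 + p.2 ≤ n + 2 ∧ (4 : ℤ) ∣ (p.1 : ℤ) - p.2)) =
      ((Finset.range (n + 3) ×ˢ Finset.range (n + 3)).filter
        (fun p => 1 ≤ p.1 + p.2 ∧ p.1 + p.2 ≤ n + 2)).filter
          (fun p => (4 : ℤ) ∣ (p.1 : ℤ) - p.2) := by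
    ext ⟨i, j⟩
    simp only [Finset.mem_insert, Finset.mem_filter, Finset.mem_product, Finset.mem_range,
      Prod.mk.injEq]
    omega
  rw [hset, Finset.sum_filter]
  simp only [laplacian, Nat.add_eq_zero_iff, OfNat.ofNat_ne_zero, and_false, if_false,
    Finsupp.add_apply, Finsupp.smul_apply, smul_eq_mul, Finsupp.finsetSum_apply,
    laplacianPiece_apply]
  rw [stepLaplacian_logTaylorCoeff_apply (by omega)]
  congr 1
  · push_cast; rfl
  · rw [Finset.sum_sigma']
    refine Finset.sum_bij' (fun s _ => s.2) (fun p _ => ⟨n + 2 - (p.1 + p.2), p⟩) ?_ ?_ ?_ ?_ ?_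
    · rintro ⟨k, i, j⟩ h
      simp only [Finset.mem_sigma, Finset.mem_range, Finset.HasAntidiagonal.mem_antidiagonal,
        Finset.mem_filter, Finset.mem_product] at h ⊢
      omega
    · rintro ⟨i, j⟩ h
      simp only [Finset.mem_sigma, Finset.mem_range, Finset.HasAntidiagonal.mem_antidiagonal,
        Finset.mem_filter, Finset.mem_product] at h ⊢
      omega
    · rintro ⟨k, i, j⟩ h
      simp only [Finset.mem_sigma, Finset.mem_range,
        Finset.HasAntidiagonal.mem_antidiagonal] at h
      have : n + 2 - (i + j) = k := by omega
      simp only [this]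
    · rintro ⟨i, j⟩ h
      rfl
    · rintro ⟨k, i, j⟩ h
      simp only [Finset.mem_sigma, Finset.mem_range,
        Finset.HasAntidiagonal.mem_antidiagonal] at h
      have : n + 2 - (i + j) = k := by omega
      simp only [this]

/-! ### Consequences of the symmetries and of the diagonal values -/

/-- The expansion of `z ↦ E (conj z)`. -/
noncomputable def reflect : PotentialExpansion where
  logCoeff := E.logCoeff
  coeff n := Finsupp.equivMapDomain (Equiv.neg ℤ) (E.coeff n)

theorem trunc_reflect (K : ℕ) (z : ℂ) : E.reflect.trunc K z = E.trunc K ((starRingEnd ℂ) z) := by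
  have h : ∀ n m, homogeneousTerm n (-m) z = homogeneousTerm n m ((starRingEnd ℂ) z) := by
    intro n m
    rcases eq_or_ne z 0 with rfl | hz
    · rcases eq_or_ne m 0 with rfl | hm
      · simp [homogeneousTerm]
      · simp [homogeneousTerm, zero_zpow _ hm]
    · rw [← conj_homogeneousTerm n m hz, homogeneousTerm, homogeneousTerm, map_mul, map_zpow₀,
        map_zpow₀, Complex.conj_ofReal, RCLike.norm_conj]
  rw [trunc_eq, trunc_eq, RCLike.norm_conj]
  congr 1
  refine Finset.sum_congr rfl fun n _ => ?_
  simp only [part, reflect, Finsupp.sum_equivMapDomain, Equiv.neg_apply, h]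

theorem eq_of_trunc_eq {E F : PotentialExpansion} (h : ∀ K z, E.trunc K z = F.trunc K z) : E = F :=
  eq_of_isBigO_sub isAmple_univ fun K => by simpa only [h, sub_self] using isBigO_zero _ _

theorem isSymmetric_iff : E.IsSymmetric ↔ E.twist Complex.I = E ∧ E.reflect = E := by
  constructor
  · intro h
    exact ⟨eq_of_trunc_eq fun K z => by rw [trunc_twist Complex.norm_I, (h K z).1],
      eq_of_trunc_eq fun K z => by rw [trunc_reflect, (h K z).2]⟩
  · rintro ⟨h1, h2⟩ K z
    rw [← trunc_twist Complex.norm_I, ← trunc_reflect, h1, h2]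
    exact ⟨rfl, rfl⟩

variable {E}

theorem IsSymmetric.coeff_eq_zero (h : E.IsSymmetric) (n : ℕ) {m : ℤ} (hm : ¬ (4 : ℤ) ∣ m) :
    E.coeff n m = 0 := by
  have h1 := congrArg (fun F : PotentialExpansion => F.coeff n m) (E.isSymmetric_iff.1 h).1
  simp only [twist, Finsupp.onFinset_apply] at h1
  by_contra hne
  have h2 : Complex.I ^ m = 1 := mul_right_cancel₀ hne (by rw [h1, one_mul])
  have h4 : Complex.I ^ (m % 4) = 1 := by
    rw [← Int.emod_add_mul_ediv m 4, zpow_add₀ Complex.I_ne_zero, zpow_mul] at h2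
    have : Complex.I ^ (4 : ℤ) = 1 := by exact_mod_cast Complex.I_pow_four
    rwa [this, one_zpow, mul_one] at h2
  have h5 : m % 4 = 1 ∨ m % 4 = 2 ∨ m % 4 = 3 := by omega
  rcases h5 with h5 | h5 | h5 <;> rw [h5] at h4
  · rw [zpow_one] at h4
    simpa using congrArg Complex.re h4
  · have : Complex.I ^ (2 : ℤ) = -1 := by exact_mod_cast Complex.I_sq
    rw [this] at h4
    norm_num at h4
  · have : Complex.I ^ (3 : ℤ) = -Complex.I := by exact_mod_cast Complex.I_pow_three
    rw [this] at h4
    simpa using congrArg Complex.re h4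

theorem IsSymmetric.coeff_neg (h : E.IsSymmetric) (n : ℕ) (m : ℤ) :
    E.coeff n (-m) = E.coeff n m := by
  have h1 := congrArg (fun F : PotentialExpansion => F.coeff n m) (E.isSymmetric_iff.1 h).2
  simpa [reflect, Finsupp.equivMapDomain_apply] using h1

/-- The diagonal equations determine `α` and, for each order, the value of the expansion on the
diagonal. -/
theorem SatisfiesDiagonalEquations.part_eq (h : E.SatisfiesDiagonalEquations) :
    E.logCoeff = 2 / Real.pi ∧
    E.part 0 (1 + Complex.I) =
      (((2 * Real.eulerMascheroniConstant + Real.log 8) / Real.pi : ℝ) : ℂ) ∧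
    ∀ n, 1 ≤ n → E.part n (1 + Complex.I) = 4 / Real.pi * diagonalSeriesCoeff n := by
  have hnorm : ‖(1 : ℂ) + Complex.I‖ = √2 := by
    rw [Complex.norm_def, Complex.normSq_apply]; norm_num
  -- The difference of the two expansions along the diagonal; in order `0` the part of `α log |z|`
  -- that comes from `|1 + i| = √2` is included.
  have hkey : ∀ N : ℕ, 1 ≤ N → E.logCoeff - 2 / Real.pi = 0 ∧ ∀ n < N,
      (if n = 0 then E.logCoeff * (Real.log √2 : ℝ) + E.part 0 (1 + Complex.I) - 4 / Real.pi *
        (Real.log 2 + Real.eulerMascheroniConstant / 2 : ℝ) else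
          E.part n (1 + Complex.I) - 4 / Real.pi * diagonalSeriesCoeff n) = 0 := by
    intro N hN
    refine log_zpow_coeff_eq_zero _ (fun n => if n = 0 then E.logCoeff * (Real.log √2 : ℝ) +
      E.part 0 (1 + Complex.I) - 4 / Real.pi *
        (Real.log 2 + Real.eulerMascheroniConstant / 2 : ℝ) else
          E.part n (1 + Complex.I) - 4 / Real.pi * diagonalSeriesCoeff n) hN fun K hK _ => ?_
    refine ((diagonalValue_isBigO hK).sub (h K)).congr' ?_ EventuallyEq.rfl
    filter_upwards [eventually_gt_atTop 0] with m hm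
    have hm' : (0 : ℝ) < m := by exact_mod_cast hm
    have hpart : ∀ n, E.part n ((m : ℂ) * (1 + Complex.I)) =
        (m : ℂ) ^ (-(n : ℤ)) * E.part n (1 + Complex.I) := by
      intro n
      have := E.part_ofReal_mul n hm' (1 + Complex.I)
      simpa using this
    have hlog : Real.log ‖(m : ℂ) * (1 + Complex.I)‖ = Real.log m + Real.log √2 := by
      rw [norm_mul, hnorm, Complex.norm_natCast, Real.log_mul hm'.ne' (by positivity)]
    rw [trunc_eq, hlog]
    simp only [hpart]
    have hr : Finset.range K = insert 0 (Finset.Icc 1 (K - 1)) := by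
      ext i; simp only [Finset.mem_range, Finset.mem_insert, Finset.mem_Icc]; omega
    have h0 : (0 : ℕ) ∉ Finset.Icc 1 (K - 1) := by simp
    rw [hr, Finset.sum_insert h0, Finset.sum_insert h0, if_pos rfl]
    have hs : ∑ n ∈ Finset.Icc 1 (K - 1), (m : ℂ) ^ (-(n : ℤ)) *
        (if n = 0 then E.logCoeff * (Real.log √2 : ℝ) + E.part 0 (1 + Complex.I) - 4 / Real.pi *
        (Real.log 2 + Real.eulerMascheroniConstant / 2 : ℝ) else
          E.part n (1 + Complex.I) - 4 / Real.pi * diagonalSeriesCoeff n) =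
        ∑ n ∈ Finset.Icc 1 (K - 1), (m : ℂ) ^ (-(n : ℤ)) * E.part n (1 + Complex.I) -
          4 / Real.pi * ∑ n ∈ Finset.Icc 1 (K - 1),
            diagonalSeriesCoeff n * (m : ℂ) ^ (-(n : ℤ)) := by
      rw [Finset.mul_sum, ← Finset.sum_sub_distrib]
      refine Finset.sum_congr rfl fun n hn => ?_
      have := (Finset.mem_Icc.1 hn).1
      rw [if_neg (by omega)]
      ring
    rw [hs]
    push_cast
    simp only [neg_zero, zpow_zero]
    ring
  have hα := sub_eq_zero.1 (hkey 1 le_rfl).1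
  refine ⟨hα, ?_, fun n hn => ?_⟩
  · have h0 := (hkey 1 le_rfl).2 0 (by omega)
    rw [if_pos rfl, hα] at h0
    have hl8 : Real.log 8 = 3 * Real.log 2 := by
      rw [show (8 : ℝ) = 2 ^ 3 by norm_num, Real.log_pow]; norm_num
    rw [Real.log_sqrt (by norm_num)] at h0
    rw [hl8]
    push_cast at h0 ⊢
    linear_combination h0
  · have := (hkey (n + 1) (by omega)).2 n (by omega)
    rw [if_neg (by omega)] at this
    exact sub_eq_zero.1 this

end PotentialExpansion

/-! ### The coefficients are those computed by the algorithm -/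

theorem coefficientTable_of_lt {N n : ℕ} (h : n < N) (m : ℤ) :
    coefficientTable N n m = algorithmCoefficient n m := by
  induction N with
  | zero => omega
  | succ N ih =>
    rcases eq_or_ne n N with rfl | hn
    · rfl
    · simp only [coefficientTable]
      rw [if_neg hn, ih (by omega)]

theorem algorithmCoefficient_eq (n : ℕ) (m : ℤ) :
    algorithmCoefficient n m = solveOrder (coefficientTable n) n m := by
  simp only [algorithmCoefficient, coefficientTable, if_true]

theorem algorithmCoefficient_zero (m : ℤ) : algorithmCoefficient 0 m = 0 := by
  rw [algorithmCoefficient_eq, solveOrder, if_pos (Or.inl rfl)]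

/-- For `4 ∣ m` the power `(1 + i) ^ m` is real, since `(1 + i) ^ 4 = -4`. -/
theorem homogeneousTerm_diagonal (n : ℕ) {m : ℤ} (hm : (4 : ℤ) ∣ m) :
    homogeneousTerm n m (1 + Complex.I) = (-1) ^ (m.natAbs / 4) * (√2 : ℂ) ^ (-(n : ℤ)) := by
  obtain ⟨k, rfl⟩ := hm
  have hnorm : ‖(1 : ℂ) + Complex.I‖ = √2 := by
    rw [Complex.norm_def, Complex.normSq_apply]; norm_num
  have h4 : (1 + Complex.I) ^ (4 : ℤ) = -4 := by
    have h2 : (1 + Complex.I) ^ 2 = 2 * Complex.I := by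
      linear_combination Complex.I_sq
    have : (1 + Complex.I) ^ 4 = -4 := by
      linear_combination ((1 + Complex.I) ^ 2 + 2 * Complex.I) * h2 + 4 * Complex.I_sq
    exact_mod_cast this
  have hs : (√2 : ℂ) ≠ 0 := by simp
  have hs4 : (√2 : ℂ) ^ (4 : ℤ) = 4 := by
    have h : (√2 : ℝ) ^ 4 = 4 := by
      rw [show (√2 : ℝ) ^ 4 = (√2 ^ 2) ^ 2 by ring, Real.sq_sqrt (by norm_num)]; norm_num
    exact_mod_cast congrArg (fun x : ℝ => (x : ℂ)) h
  rw [homogeneousTerm, hnorm, zpow_mul, h4, neg_add, zpow_add₀ hs, ← mul_neg, zpow_mul _ 4, hs4,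
    Int.natAbs_mul, show (4 : ℤ).natAbs = 4 from rfl, Nat.mul_div_cancel_left _ (by norm_num)]
  have h1 : (-4 : ℂ) ^ k * 4 ^ (-k) = (-1) ^ k.natAbs := by
    rw [show (-4 : ℂ) = -1 * 4 by norm_num, mul_zpow, mul_assoc,
      ← zpow_add₀ (by norm_num : (4 : ℂ) ≠ 0), add_neg_cancel, zpow_zero, mul_one]
    rcases Int.natAbs_eq k with h | h
    · conv_lhs => rw [h, zpow_natCast]
    · conv_lhs => rw [h, zpow_neg, zpow_natCast, ← inv_pow, inv_neg_one]
  linear_combination (√2 : ℂ) ^ (-(n : ℤ)) * h1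

namespace PotentialExpansion

variable {E : PotentialExpansion}

/-- The frequencies of order `n` are bounded by `2 n`: a step of order `s` of the Laplacian changes
the frequency by at most `s`, and the order by `s - 2`. -/
theorem coeff_eq_zero_of_lt_natAbs (hDE : ∀ n, E.laplacian.coeff n = 0) (hsym : E.IsSymmetric)
    (n : ℕ) {m : ℤ} (hm : 2 * n < m.natAbs) :
    E.coeff n m = 0 := by
  induction n using Nat.strong_induction_on generalizing m with
  | _ n ih =>
    by_cases h4 : (4 : ℤ) ∣ m
    swap
    · exact hsym.coeff_eq_zero n h4
    have h := E.laplacian_coeff_apply n m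
    rw [hDE, Finsupp.zero_apply, if_neg (by omega), mul_zero, zero_add,
      Finset.sum_eq_zero, add_zero] at h
    · refine (mul_eq_zero.1 h.symm).resolve_left ?_
      have h1 : ((n : ℤ) ^ 2 - m ^ 2) ≠ 0 := by
        rw [← Int.natAbs_sq m]
        have : n < m.natAbs := by omega
        have : n ^ 2 < m.natAbs ^ 2 := Nat.pow_lt_pow_left this (by norm_num)
        zify at this
        simp only [Int.natCast_natAbs] at this ⊢
        omega
      have h2 : ((n : ℂ) ^ 2 - (m : ℂ) ^ 2) ≠ 0 := by exact_mod_cast h1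
      exact div_ne_zero h2 (by norm_num)
    · rintro ⟨i, j⟩ hp
      simp only [Finset.mem_filter, Finset.mem_product, Finset.mem_range] at hp
      simp only
      rw [ih (n + 2 - (i + j)) (by omega) (by omega), mul_zero]

theorem coeff_zero_eq_zero (hDE : ∀ n, E.laplacian.coeff n = 0) (hsym : E.IsSymmetric)
    {m : ℤ} (hm : m ≠ 0) : E.coeff 0 m = 0 :=
  coeff_eq_zero_of_lt_natAbs hDE hsym 0 (by omega)

/-- The value of the part of order `n` on the diagonal, as a sum over the frequencies. -/
theorem part_diagonal (hsym : E.IsSymmetric) (n : ℕ) {s : Finset ℤ}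
    (hs : ∀ m, (4 : ℤ) ∣ m → E.coeff n m ≠ 0 → m ∈ s) :
    E.part n (1 + Complex.I) = (√2 : ℂ) ^ (-(n : ℤ)) *
      ∑ m ∈ s with (4 : ℤ) ∣ m, (-1) ^ (m.natAbs / 4) * E.coeff n m := by
  have h1 : E.part n (1 + Complex.I) = ∑ m ∈ s with (4 : ℤ) ∣ m,
      E.coeff n m * homogeneousTerm n m (1 + Complex.I) := by
    refine Finset.sum_subset (fun m hm => ?_) fun m _ hm => ?_
    · rw [Finsupp.mem_support_iff] at hm
      have h4 : (4 : ℤ) ∣ m := by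
        by_contra h; exact hm (hsym.coeff_eq_zero n h)
      exact Finset.mem_filter.2 ⟨hs m h4 hm, h4⟩
    · simp only [Finsupp.notMem_support_iff.1 hm, zero_mul]
  rw [h1, Finset.mul_sum]
  refine Finset.sum_congr rfl fun m hm => ?_
  rw [homogeneousTerm_diagonal n (Finset.mem_filter.1 hm).2]
  ring

/-- The differential equations determine the coefficients that are not harmonic from those of lower
order. -/
theorem coeff_eq_solveDifferential (hDE : ∀ n, E.laplacian.coeff n = 0) (hsym : E.IsSymmetric)
    (hα : E.logCoeff = 2 / Real.pi) {n : ℕ}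
    (ih : ∀ k < n, 1 ≤ k → ∀ m, E.coeff k m = (algorithmCoefficient k m : ℂ) / Real.pi)
    {m : ℤ} (h4 : (4 : ℤ) ∣ m) (hm : m.natAbs ≠ n) :
    E.coeff n m = (solveDifferential (coefficientTable n) n m : ℂ) / Real.pi := by
  have hpi : (Real.pi : ℂ) ≠ 0 := by exact_mod_cast Real.pi_ne_zero
  have hne : ((m : ℂ) ^ 2 - (n : ℂ) ^ 2) ≠ 0 := by
    have h1 : (m ^ 2 - (n : ℤ) ^ 2) ≠ 0 := by
      intro h
      have h2 : m ^ 2 = (n : ℤ) ^ 2 := by linarith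
      exact hm (by simpa using Int.natAbs_eq_iff_sq_eq.2 h2)
    exact_mod_cast h1
  have h := E.laplacian_coeff_apply n m
  have hsum : ∑ p ∈ (Finset.range (n + 3) ×ˢ Finset.range (n + 3)).filter
        (fun p => 4 ≤ p.1 + p.2 ∧ p.1 + p.2 ≤ n + 2 ∧ (4 : ℤ) ∣ (p.1 : ℤ) - p.2),
        homogeneousTaylorCoeff (n + 2 - (p.1 + p.2)) (m + p.1 - p.2) p.1 p.2 *
          E.coeff (n + 2 - (p.1 + p.2)) (m + p.1 - p.2) =
      ((∑ p ∈ (Finset.range (n + 3) ×ˢ Finset.range (n + 3)).filter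
        (fun p => 4 ≤ p.1 + p.2 ∧ p.1 + p.2 ≤ n + 2 ∧ (4 : ℤ) ∣ (p.1 : ℤ) - p.2),
        rationalBinomial ((((m + p.1 - p.2 : ℤ) : ℚ) - ((n + 2 - (p.1 + p.2) : ℕ) : ℚ)) / 2) p.1 *
        rationalBinomial ((-((m + p.1 - p.2 : ℤ) : ℚ) - ((n + 2 - (p.1 + p.2) : ℕ) : ℚ)) / 2) p.2 *
        coefficientTable n (n + 2 - (p.1 + p.2)) (m + p.1 - p.2) : ℚ) : ℂ) / Real.pi := by
    rw [Rat.cast_sum, Finset.sum_div]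
    refine Finset.sum_congr rfl ?_
    rintro ⟨i, j⟩ hp
    simp only [Finset.mem_filter, Finset.mem_product, Finset.mem_range] at hp
    simp only
    rw [coefficientTable_of_lt (by omega), Rat.cast_mul, Rat.cast_mul, ratCast_rationalBinomial,
      ratCast_rationalBinomial]
    rcases Nat.eq_zero_or_pos (n + 2 - (i + j)) with h0 | h0
    -- In order `0` the algorithm starts with zeros although `c_{0,0} ≠ 0`: this constant has
    -- vanishing Taylor terms.
    · rw [h0, algorithmCoefficient_zero, Rat.cast_zero, mul_zero, zero_div]
      rcases eq_or_ne (m + i - j) 0 with hm' | hm'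
      · rw [hm']
        have : i ≠ 0 ∨ j ≠ 0 := by omega
        rcases this with hi | hj
        · simp [homogeneousTaylorCoeff, complexBinomial_zero_left hi]
        · simp [homogeneousTaylorCoeff, complexBinomial_zero_left hj]
      · rw [coeff_zero_eq_zero hDE hsym hm', mul_zero]
    · rw [ih _ (by omega) h0, homogeneousTaylorCoeff]
      push_cast
      ring
  rw [hDE, Finsupp.zero_apply, hsum, hα] at h
  rw [solveDifferential]
  set Q := ∑ p ∈ (Finset.range (n + 3) ×ˢ Finset.range (n + 3)).filter
        (fun p => 4 ≤ p.1 + p.2 ∧ p.1 + p.2 ≤ n + 2 ∧ (4 : ℤ) ∣ (p.1 : ℤ) - p.2),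
        rationalBinomial ((((m + p.1 - p.2 : ℤ) : ℚ) - ((n + 2 - (p.1 + p.2) : ℕ) : ℚ)) / 2) p.1 *
        rationalBinomial ((-((m + p.1 - p.2 : ℤ) : ℚ) - ((n + 2 - (p.1 + p.2) : ℕ) : ℚ)) / 2) p.2 *
        coefficientTable n (n + 2 - (p.1 + p.2)) (m + p.1 - p.2)
  have hn2 : (n : ℂ) + 2 ≠ 0 := by exact_mod_cast (Nat.succ_ne_zero (n + 1))
  by_cases hmn : m.natAbs = n + 2
  · rw [if_pos ⟨h4, hmn⟩] at h
    rw [if_pos hmn]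
    push_cast
    field_simp at h ⊢
    linear_combination h
  · rw [if_neg (fun hh => hmn hh.2)] at h
    rw [if_neg hmn]
    push_cast
    field_simp at h ⊢
    linear_combination h

/-- The coefficients are those of the algorithm. -/
theorem coeff_eq_algorithmCoefficient (hDE : ∀ n, E.laplacian.coeff n = 0) (hsym : E.IsSymmetric)
    (hα : E.logCoeff = 2 / Real.pi)
    (hdiag : ∀ n, 1 ≤ n → E.part n (1 + Complex.I) = 4 / Real.pi * diagonalSeriesCoeff n)
    (n : ℕ) (hn : 1 ≤ n) (m : ℤ) :
    E.coeff n m = (algorithmCoefficient n m : ℂ) / Real.pi := by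
  induction n using Nat.strong_induction_on generalizing m with
  | _ n ih =>
    have hsolve := fun {r : ℤ} => coeff_eq_solveDifferential hDE hsym hα (n := n)
      (fun k hk hk1 r => ih k hk hk1 r) (m := r)
    have hpi : (Real.pi : ℂ) ≠ 0 := by exact_mod_cast Real.pi_ne_zero
    rw [algorithmCoefficient_eq, solveOrder]
    by_cases h4 : (4 : ℤ) ∣ m
    swap
    · rw [if_pos (Or.inr h4), hsym.coeff_eq_zero n h4, Rat.cast_zero, zero_div]
    rw [if_neg (by omega)]
    by_cases hmn : m.natAbs = n
    swap
    · rw [if_neg hmn, hsolve h4 hmn]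
    rw [if_pos hmn]
    have h4n : 4 ∣ n := by omega
    have heven : Even n := by obtain ⟨k, rfl⟩ := h4n; exact ⟨2 * k, by ring⟩
    -- the frequencies `r` with `|r| ≤ 2 n` as `t - 2 n`, `0 ≤ t ≤ 4 n`
    set e : ℕ ↪ ℤ := ⟨fun t => (t : ℤ) - 2 * n, fun a b hab => by simpa using hab⟩
    have hpart := part_diagonal hsym n (s := (Finset.range (4 * n + 1)).map e) fun r hr4 hr => by
      have hr2 : r.natAbs ≤ 2 * n := by
        by_contra hlt
        exact hr (coeff_eq_zero_of_lt_natAbs hDE hsym n (by omega))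
      refine Finset.mem_map.2 ⟨(r + 2 * n).toNat, Finset.mem_range.2 (by omega), ?_⟩
      show (((r + 2 * n).toNat : ℕ) : ℤ) - 2 * n = r
      omega
    rw [hdiag n hn, Finset.filter_map, Finset.sum_map] at hpart
    have hroot : (√2 : ℂ) ^ (-(n : ℤ)) = ((2 : ℂ) ^ (n / 2))⁻¹ := by
      obtain ⟨k, hk⟩ := heven
      have h2 : ((√2 : ℝ) : ℂ) ^ 2 = 2 := by
        rw [← Complex.ofReal_pow, Real.sq_sqrt (by norm_num)]; norm_num
      rw [zpow_neg, zpow_natCast, show n / 2 = k by omega, show n = 2 * k by omega, pow_mul, h2]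
    set T := (Finset.range (4 * n + 1)).filter
        (fun t : ℕ => (4 : ℤ) ∣ (t : ℤ) - 2 * n ∧ ((t : ℤ) - 2 * n).natAbs ≠ n)
    -- The two frequencies `n` and `-n` have equal coefficients; the others are known.
    have hsplit : ∑ t ∈ (Finset.range (4 * n + 1)).filter ((fun r : ℤ => (4 : ℤ) ∣ r) ∘ e),
        (-1 : ℂ) ^ ((e t).natAbs / 4) * E.coeff n (e t) =
        2 * (-1) ^ (n / 4) * E.coeff n m + ∑ t ∈ T,
          (-1 : ℂ) ^ (((t : ℤ) - 2 * n).natAbs / 4) *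
            ((solveDifferential (coefficientTable n) n ((t : ℤ) - 2 * n) : ℂ) / Real.pi) := by
      rw [← Finset.sum_filter_add_sum_filter_not _ (fun t => (e t).natAbs = n)]
      congr 1
      · have hpair : ((Finset.range (4 * n + 1)).filter ((fun r : ℤ => (4 : ℤ) ∣ r) ∘ e)).filter
            (fun t => (e t).natAbs = n) = {n, 3 * n} := by
          ext t
          have he : e t = (t : ℤ) - 2 * n := rfl
          simp only [Finset.mem_filter, Finset.mem_range, Finset.mem_insert, Finset.mem_singleton,
            Function.comp, he]
          omega
        have h1 : e n = -(n : ℤ) := by show (n : ℤ) - 2 * n = _; ring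
        have h3 : e (3 * n) = (n : ℤ) := by show ((3 * n : ℕ) : ℤ) - 2 * n = _; push_cast; ring
        have hm : E.coeff n m = E.coeff n n := by
          rcases Int.natAbs_eq m with h | h
          · rw [h, hmn]
          · rw [h, hmn, hsym.coeff_neg]
        rw [hpair, Finset.sum_pair (by omega), h1, h3, hsym.coeff_neg, Int.natAbs_neg,
          Int.natAbs_natCast, hm]
        ring
      · rw [Finset.filter_filter]
        refine Finset.sum_congr rfl fun t ht => ?_
        have he : e t = (t : ℤ) - 2 * n := rfl
        have ht' := (Finset.mem_filter.1 ht).2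
        rw [← hsolve ht'.1 ht'.2, he]
    rw [hsplit, hroot] at hpart
    have hsign : ((-1 : ℂ) ^ (n / 4)) ^ 2 = 1 := by
      rw [← pow_mul, mul_comm, pow_mul]; norm_num
    have h2 : (2 : ℂ) ^ (n / 2) ≠ 0 := pow_ne_zero _ two_ne_zero
    rw [diagonalSeriesCoeff] at hpart
    rw [diagonalCoefficient, if_pos heven]
    push_cast
    simp only [← mul_div_assoc, ← Finset.sum_div] at hpart
    set S := ∑ t ∈ T, (-1 : ℂ) ^ (((t : ℤ) - 2 * n).natAbs / 4) *
      (solveDifferential (coefficientTable n) n ((t : ℤ) - 2 * n) : ℂ)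
    have hfin : 2 * (-1 : ℂ) ^ (n / 4) * E.coeff n m = 2 ^ (n / 2) *
        (4 / Real.pi * ((bernoulli n : ℂ) / n * (1 / 2 - 1 / 2 ^ n))) - S / Real.pi := by
      rw [hpart, mul_inv_cancel_left₀ h2]
      ring
    linear_combination (-1 : ℂ) ^ (n / 4) / 2 * hfin - E.coeff n m * hsign

/-- The differential equations, the diagonal values and the symmetries determine all
coefficients. -/
theorem coeff_formula (hDE : E.SatisfiesDifferentialEquations)
    (hdiag : E.SatisfiesDiagonalEquations) (hsym : E.IsSymmetric) :
    E.logCoeff = ((2 / Real.pi : ℝ) : ℂ) ∧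
      (∀ m : ℤ, E.coeff 0 m = if m = 0 then
        (((2 * Real.eulerMascheroniConstant + Real.log 8) / Real.pi : ℝ) : ℂ) else 0) ∧
      (∀ n : ℕ, 1 ≤ n → ∀ m : ℤ,
        E.coeff n m = (((algorithmCoefficient n m : ℝ) / Real.pi : ℝ) : ℂ)) := by
  have hlap := E.satisfiesDifferentialEquations_iff.1 hDE
  obtain ⟨hα, h0, h1⟩ := hdiag.part_eq
  refine ⟨by rw [hα]; push_cast; rfl, fun m => ?_, fun n hn m => ?_⟩
  · split_ifs with hm
    · have := part_diagonal hsym 0 (s := {0}) fun m _ hm => by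
        by_contra h
        exact hm (coeff_zero_eq_zero hlap hsym (by simpa using h))
      rw [hm, ← h0, this, Finset.filter_true_of_mem (by simp), Finset.sum_singleton]
      simp
    · exact coeff_zero_eq_zero hlap hsym hm
  · rw [coeff_eq_algorithmCoefficient hlap hsym hα h1 n hn m, Complex.ofReal_div,
      Complex.ofReal_ratCast]

theorem eq_of_coeff_formula {F : PotentialExpansion} (hDE : E.SatisfiesDifferentialEquations)
    (hdiag : E.SatisfiesDiagonalEquations) (hsym : E.IsSymmetric)
    (hDE' : F.SatisfiesDifferentialEquations) (hdiag' : F.SatisfiesDiagonalEquations)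
    (hsym' : F.IsSymmetric) : E = F := by
  obtain ⟨a1, a2, a3⟩ := coeff_formula hDE hdiag hsym
  obtain ⟨b1, b2, b3⟩ := coeff_formula hDE' hdiag' hsym'
  refine ext' (a1.trans b1.symm) fun n => Finsupp.ext fun m => ?_
  rcases Nat.eq_zero_or_pos n with rfl | hn
  · rw [a2, b2]
  · rw [a3 n hn, b3 n hn]

/-! ### The expansion of the potential satisfies the three conditions -/

theorem IsExpansionOf.unique {f : ℤ × ℤ → ℝ} {F : PotentialExpansion} (hE : E.IsExpansionOf f)
    (hF : F.IsExpansionOf f) : E = F :=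
  eq_of_isBigO_sub isAmple_univ fun K =>
    (((hF K).sub (hE K)).mono inf_le_left).congr_left fun z => by ring

theorem IsExpansionOf.comp_injective {f : ℤ × ℤ → ℝ} (hE : E.IsExpansionOf f) {R : ℤ × ℤ → ℤ × ℤ}
    (hR : Function.Injective R) (hf : ∀ z, f (R z) = f z)
    (hnorm : ∀ z, ‖latticeToComplex (R z)‖ = ‖latticeToComplex z‖) {F : PotentialExpansion}
    (hF : ∀ K z, F.trunc K (latticeToComplex z) = E.trunc K (latticeToComplex (R z))) :
    F.IsExpansionOf f := fun K =>
  ((hE K).comp_tendsto hR.tendsto_cofinite).congr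
    (fun z => by simp only [Function.comp, hf, hF])
    (fun z => by simp only [Function.comp, hnorm])

theorem IsExpansionOf.isSymmetric (hE : E.IsExpansionOf harmonicPotential) : E.IsSymmetric := by
  refine E.isSymmetric_iff.2 ⟨?_, ?_⟩
  · have hl : ∀ z : ℤ × ℤ, latticeToComplex (-z.2, z.1) = Complex.I * latticeToComplex z := by
      intro z
      apply Complex.ext <;> simp [latticeToComplex]
    refine IsExpansionOf.unique (hE.comp_injective (R := fun z => (-z.2, z.1)) ?_ ?_ ?_ ?_) hE
    · rintro ⟨x, y⟩ ⟨x', y'⟩ h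
      simp only [Prod.mk.injEq, neg_inj] at h ⊢
      exact ⟨h.2, h.1⟩
    · exact fun z => harmonicPotential_rotate z.1 z.2
    · intro z; rw [hl, norm_mul, Complex.norm_I, one_mul]
    · intro K z; rw [trunc_twist Complex.norm_I, hl]
  · have hl : ∀ z : ℤ × ℤ, latticeToComplex (z.1, -z.2) = (starRingEnd ℂ) (latticeToComplex z) := by
      intro z
      apply Complex.ext <;> simp [latticeToComplex]
    refine IsExpansionOf.unique (hE.comp_injective (R := fun z => (z.1, -z.2)) ?_ ?_ ?_ ?_) hE
    · rintro ⟨x, y⟩ ⟨x', y'⟩ h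
      simp only [Prod.mk.injEq, neg_inj] at h ⊢
      exact h
    · exact fun z => harmonicPotential_reflect z.1 z.2
    · intro z; rw [hl, RCLike.norm_conj]
    · intro K z; rw [trunc_reflect, hl]

theorem IsExpansionOf.satisfiesDiagonalEquations (hE : E.IsExpansionOf harmonicPotential) :
    E.SatisfiesDiagonalEquations := by
  intro K
  have ht : Tendsto (fun m : ℕ => ((m : ℤ), (m : ℤ))) atTop cofinite := by
    rw [← Nat.cofinite_eq_atTop]
    exact Function.Injective.tendsto_cofinite fun a b h => by simpa using h
  have hl : ∀ m : ℕ, latticeToComplex ((m : ℤ), (m : ℤ)) = (m : ℂ) * (1 + Complex.I) := by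
    intro m
    apply Complex.ext <;> simp [latticeToComplex]
  refine (((hE K).comp_tendsto ht).trans (IsBigO.of_bound 1 ?_)).congr_left fun m => ?_
  · filter_upwards [eventually_gt_atTop 0] with m hm
    have hm' : (0 : ℝ) < m := by exact_mod_cast hm
    have h1 : (m : ℝ) ≤ ‖latticeToComplex ((m : ℤ), (m : ℤ))‖ := by
      refine le_trans ?_ (norm_latticeToComplex_ge _)
      simp
    simp only [Function.comp]
    rw [norm_zpow, norm_zpow, norm_norm, Real.norm_of_nonneg hm'.le, one_mul, zpow_neg, zpow_neg,
      zpow_natCast, zpow_natCast]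
    gcongr
  · simp only [Function.comp, harmonicPotential_diagonal, hl]

end PotentialExpansion

theorem mainTheorem5 :
    (∀ z : ℤ × ℤ, Tendsto (srwPartialSum z) atTop (𝓝 (harmonicPotential z))) ∧
    (∀ m : ℕ, harmonicPotential ((m : ℤ), (m : ℤ)) = diagonalValue m) ∧
    ∃ E : PotentialExpansion,
      (∀ F : PotentialExpansion, F.IsExpansionOf harmonicPotential ↔ F = E) ∧
      (∀ F : PotentialExpansion,
        (F.SatisfiesDifferentialEquations ∧ F.SatisfiesDiagonalEquations ∧ F.IsSymmetric) ↔
          F = E) ∧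
      E.logCoeff = ((2 / Real.pi : ℝ) : ℂ) ∧
      (∀ m : ℤ, E.coeff 0 m = if m = 0 then
        (((2 * Real.eulerMascheroniConstant + Real.log 8) / Real.pi : ℝ) : ℂ) else 0) ∧
      (∀ n : ℕ, 1 ≤ n → ∀ m : ℤ,
        E.coeff n m = (((algorithmCoefficient n m : ℝ) / Real.pi : ℝ) : ℂ)) := by
  obtain ⟨E, hE⟩ := exists_isExpansionOf_harmonicPotential
  have hDE := hE.satisfiesDifferentialEquations
  have hdiag := hE.satisfiesDiagonalEquations
  have hsym := hE.isSymmetric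
  refine ⟨tendsto_srwPartialSum, harmonicPotential_diagonal, E, fun F => ⟨fun h => h.unique hE, ?_⟩,
    fun F => ⟨fun h => PotentialExpansion.eq_of_coeff_formula h.1 h.2.1 h.2.2 hDE hdiag hsym, ?_⟩,
    PotentialExpansion.coeff_formula hDE hdiag hsym⟩
  · rintro rfl; exact hE
  · rintro rfl; exact ⟨hDE, hdiag, hsym⟩
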